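/- Let $T>0$ and let $N\ge 0$ be an integer. Consider $$a(x,t,\varepsilon)u_t-\varepsilon^2u_{xxt}+b(x,t,\varepsilon)u^2u_x-2\varepsilon^2u_xu_{xx}-\varepsilon^2uu_{xxx}=0,\qquad (x,t)\in\mathbb R\times[0,T],\tag{E}$$ where $a=\sum_{k=0}^N\varepsilon^ka_k(x,t)+O(\varepsilon^{N+1})$ and $b=\sum_{k=0}^N\varepsilon^kb_k(x,t)+O(\varepsilon^{N+1})$. Here $\Psi(x,t,\varepsilon)=O(\varepsilon^M)$ on a set $S$ means: for every compact $K\subset S$ there are $C$ and $\varepsilon_0>0$ with $|\Psi(x,t,\varepsilon)|\le C\varepsilon^M$ for all $(x,t)\in K$, $\varepsilon\in(0,\varepsilon_0)$. **Spaces.** $G$ is the space of smooth $f(x,t,\tau)$ on $\mathbb R\times[0,T]\times\mathbb R$ such that $\tau^n\partial_x^p\partial_t^q\partial_\tau^rf\to0$ as $\tau\to+\infty$ and, for some smooth $f^-(x,t)$, $\tau^n\partial_x^p\partial_t^q\partial_\tau^r(f-f^-)\to0$ as $\tau\to-\infty$, for all $n,p,q,r\ge0$, uniformly for $(x,t)$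 in compact sets. $G_0\subset G$ consists of those $f$ with $f\to0$ as $\tau\to-\infty$, uniformly for $(x,t)$ in compact sets. $\widetilde G$, $\widetilde G_0$ are the analogous spaces of functions of $(t,\tau)$, with uniformity in $t\in[0,T]$. **Assumptions.** 1. $a_k,b_k\in C^\infty(\mathbb R\times[0,T])$ for $0\le k\le N$, and $a_0b_0\ne0$ on $\mathbb R\times[0,T]$. 2. $\varphi\in C^\infty([0,T])$ satisfies $\varphi'(t)=6\,a_0(\varphi(t),t)/b_0(\varphi(t),t)$, and $a_0(\varphi(t),t)>0$ for all $t\in[0,T]$. Let $\Gamma=\{x=\varphi(t)\}$ and $\tau=(x-\varphi(t))/\varepsilon$; let $C_0\in C^\infty([0,T])$ be arbitrary, and put $$V_0(x,t,\tau)=v_0(t,\tau)=-6\,\frac{a_0}{b_0}\cosh^{-2}\Bigl(\sqrt{a_0}\,\frac{\tau}{2}+C_0(t)\Bigr),$$ where here and in the linear equation below $a_0,b_0$ are taken at $(\varphi(t),t)$. **Construction.** For $j=1,\dots,N$ put $V_j(x,t,\tau)=u_j^-(x,t)\eta_j(t,\tau)+\psi_j(t,\tau)$, with the following ingredients. * Let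 $-\mathcal F_j(t,\tau)$ be the coefficient of $\varepsilon^{j-1}$ in the expansion, in powers of $\varepsilon$ at fixed $(t,\tau)$, of the left-hand side of (E) (with $a,b$ replaced by $\sum_{k\le N}\varepsilon^ka_k$, $\sum_{k\le N}\varepsilon^kb_k$) for $u=\sum_{i<j}\varepsilon^iV_i(x,t,\tau)$, taken at $x=\varphi(t)+\varepsilon\tau$. Let $E_j(t)=-\int_{\mathbb R}\mathcal F_j(t,\xi)\,d\xi$, so that $\Phi_j(t,\tau)=\int_{-\infty}^\tau\mathcal F_j(t,\xi)\,d\xi+E_j(t)$ tends to $0$ as $\tau\to+\infty$, and let $\nu_j(t)=-\dfrac{1}{a_0(\varphi(t),t)\,\varphi'(t)}\lim_{\tau\to-\infty}\Phi_j(t,\tau)$. * $\eta_j\in\widetilde G$ with $\eta_j\to1$ as $\tau\to-\infty$, and $\psi_j\in\widetilde G_0$, are such that $v_j=\nu_j\eta_j+\psi_j$ solves $$(\varphi'-v_0)v_{j,\tau\tau\tau}-a_0\varphi'v_{j,\tau}+b_0(v_0^2v_j)_\tau-2(v_{0,\tau}v_{j,\tau})_\tau-v_{0,\tau\tau\tau}v_j=\mathcal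 F_j .\tag{L$_j$}$$ * $u_j^-\in C^\infty(\mathbb R\times[0,T])$ solves the transport problem $a_0\,\partial_tu_j^-=f_j^-$ in $\{x\le\varphi(t)\}$, $u_j^-|_\Gamma=\nu_j$, where $-f_j^-$ is the coefficient of $\varepsilon^j$ in the left-hand side of (E) (with the same truncated coefficients) for $u=\sum_{1\le i<j}\varepsilon^iu_i^-$. **Conclusion.** (i) Let $1\le m\le N$ and suppose that the ingredients of all indices $j<m$ have been constructed (in particular, that the transport problems of these indices are solved). Then $\mathcal F_m\in\widetilde G_0$; and if the orthogonality condition $\int_{\mathbb R}\mathcal F_m(t,\tau)v_0(t,\tau)\,d\tau=0$, $t\in[0,T]$, holds, then $\eta_m,\psi_m$ as above, with $\nu_m\eta_m+\psi_m$ solving (L$_m$), exist. (It is not assumed that $\lim_{\tau\to-\infty}\Phi_m=0$.) (ii) Suppose that the ingredients of all indices $1\le j\le N$ have been constructed, in particular that the transport problems are solved for $x\le\varphi(t)$. Let $\mu>0$ and $$u_N=\begin{cases}\sum_{j=1}^N\varepsilon^ju_j^-(x,t),&x\le\varphi(t)-\mu,\\ \sum_{j=0}^N\varepsilon^jV_j(x,t,\tau),&|x-\varphi(t)|<\mu,\\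 0,&x\ge\varphi(t)+\mu.\end{cases}$$ Let $R(x,t,\varepsilon)$ be the left-hand side of (E) at $(x,t)$ evaluated on the smooth expression which defines $u_N$ at $(x,t)$; it coincides with the left-hand side of (E) for $u_N$ itself wherever $|x-\varphi(t)|\ne\mu$. Then * $u_N$ satisfies (E) with accuracy $O(\varepsilon^N)$: $R=O(\varepsilon^N)$ on $\mathbb R\times[0,T]$; * $u_N$ is the $N$-th approximation of one-phase soliton-like type with zero background: $V_0\in G_0$ is nontrivial, $V_j\in G$ for $1\le j\le N$, and $u_N=\sum_{j=0}^N\varepsilon^jV_j(x,t,\tau)+O(\varepsilon^{N+1})$ on $\mathbb R\times[0,T]$; * $u_N$ satisfies (E) with accuracy $O(\varepsilon^{N+1})$ as $\tau\to\pm\infty$: for every compact $K\subset\mathbb R\times[0,T]$ and every integer $m\ge0$ there are $C$ and $\varepsilon_0>0$ with $|R|\le C\bigl(\varepsilon^{N+1}+\varepsilon^N(1+|\tau|)^{-m}\bigr)$ for $(x,t)\in K$, $0<\varepsilon<\varepsilon_0$; in particular $R=O(\varepsilon^{N+1})$ on $(\mathbb R\times[0,T])\setminus\Gamma$. -/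

import Mathlib

open Set Filter Topology MeasureTheory
open scoped ContDiff

noncomputable section

namespace MCH

/-! ### Partial derivatives

The time variable runs through `[0, T]`, so that time derivatives are taken within `Icc 0 T`
(one-sided at the two end points). -/

/-- `∂u/∂x` for a function `u(x, t)`. -/
def px (u : ℝ → ℝ → ℝ) : ℝ → ℝ → ℝ := fun x t => deriv (fun y => u y t) x

/-- `∂u/∂t` for a function `u(x, t)`, `t ∈ [0, T]`. -/
def pt (T : ℝ) (u : ℝ → ℝ → ℝ) : ℝ → ℝ → ℝ :=
  fun x t => derivWithin (fun s => u x s) (Icc 0 T) t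

/-- `∂g/∂t` for a function `g(t, τ)`, `t ∈ [0, T]`. -/
def gt (T : ℝ) (g : ℝ → ℝ → ℝ) : ℝ → ℝ → ℝ :=
  fun t τ => derivWithin (fun s => g s τ) (Icc 0 T) t

/-- `∂g/∂τ` for a function `g(t, τ)`. -/
def gtau (g : ℝ → ℝ → ℝ) : ℝ → ℝ → ℝ := fun t τ => deriv (fun s => g t s) τ

/-- `∂f/∂x` for a function `f(x, t, τ)`. -/
def dX (f : ℝ → ℝ → ℝ → ℝ) : ℝ → ℝ → ℝ → ℝ := fun x t τ => deriv (fun y => f y t τ) x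

/-- `∂f/∂t` for a function `f(x, t, τ)`, `t ∈ [0, T]`. -/
def dT (T : ℝ) (f : ℝ → ℝ → ℝ → ℝ) : ℝ → ℝ → ℝ → ℝ :=
  fun x t τ => derivWithin (fun s => f x s τ) (Icc 0 T) t

/-- `∂f/∂τ` for a function `f(x, t, τ)`. -/
def dTau (f : ℝ → ℝ → ℝ → ℝ) : ℝ → ℝ → ℝ → ℝ := fun x t τ => deriv (fun s => f x t s) τ

/-! ### Function spaces -/

/-- The strip `ℝ × [0, T]`. -/
def strip (T : ℝ) : Set (ℝ × ℝ) := univ ×ˢ Icc 0 T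

/-- `u ∈ C^∞(ℝ × [0, T])`. -/
def Smooth2 (T : ℝ) (u : ℝ → ℝ → ℝ) : Prop :=
  ContDiffOn ℝ ∞ (fun p : ℝ × ℝ => u p.1 p.2) (strip T)

/-- The space `G` of functions `f(x, t, τ)`: smooth, rapidly decreasing as `τ → +∞`, and rapidly
approaching a function `f⁻(x, t)` as `τ → -∞`, locally uniformly in `(x, t)` and with all
derivatives. -/
def InG (T : ℝ) (f : ℝ → ℝ → ℝ → ℝ) : Prop :=
  ContDiffOn ℝ ∞ (fun p : ℝ × ℝ × ℝ => f p.1 p.2.1 p.2.2) (univ ×ˢ (Icc 0 T ×ˢ univ)) ∧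
  (∀ n p q r : ℕ, ∀ K : Set (ℝ × ℝ), IsCompact K → K ⊆ strip T →
    TendstoUniformlyOn
      (fun (τ : ℝ) (z : ℝ × ℝ) => τ ^ n * dX^[p] ((dT T)^[q] (dTau^[r] f)) z.1 z.2 τ)
      (fun _ => 0) atTop K) ∧
  ∃ fm : ℝ → ℝ → ℝ, Smooth2 T fm ∧
    ∀ n p q r : ℕ, ∀ K : Set (ℝ × ℝ), IsCompact K → K ⊆ strip T →
      TendstoUniformlyOn
        (fun (τ : ℝ) (z : ℝ × ℝ) =>
          τ ^ n * dX^[p] ((dT T)^[q] (dTau^[r] (fun x t s => f x t s - fm x t))) z.1 z.2 τ)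
        (fun _ => 0) atBot K

/-- The subspace `G₀` of `G`: in addition `f → 0` as `τ → -∞`. -/
def InG0 (T : ℝ) (f : ℝ → ℝ → ℝ → ℝ) : Prop :=
  InG T f ∧ ∀ K : Set (ℝ × ℝ), IsCompact K → K ⊆ strip T →
    TendstoUniformlyOn (fun (τ : ℝ) (z : ℝ × ℝ) => f z.1 z.2 τ) (fun _ => 0) atBot K

/-- The space `G̃` of functions `g(t, τ)`, the analogue of `G` without the variable `x`. -/
def InGt (T : ℝ) (g : ℝ → ℝ → ℝ) : Prop :=
  ContDiffOn ℝ ∞ (fun p : ℝ × ℝ => g p.1 p.2) (Icc 0 T ×ˢ univ) ∧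
  (∀ n p q : ℕ, TendstoUniformlyOn
      (fun (τ : ℝ) (t : ℝ) => τ ^ n * (gt T)^[p] (gtau^[q] g) t τ)
      (fun _ => 0) atTop (Icc 0 T)) ∧
  ∃ gm : ℝ → ℝ, ContDiffOn ℝ ∞ gm (Icc 0 T) ∧
    ∀ n p q : ℕ, TendstoUniformlyOn
      (fun (τ : ℝ) (t : ℝ) => τ ^ n * (gt T)^[p] (gtau^[q] (fun t s => g t s - gm t)) t τ)
      (fun _ => 0) atBot (Icc 0 T)

/-- The subspace `G̃₀` of `G̃`: in addition `g → 0` as `τ → -∞`. -/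
def InGt0 (T : ℝ) (g : ℝ → ℝ → ℝ) : Prop :=
  InGt T g ∧ TendstoUniformlyOn (fun (τ : ℝ) (t : ℝ) => g t τ) (fun _ => 0) atBot (Icc 0 T)

/-! ### Asymptotic order and the equation -/

/-- `Ψ(x, t, ε) = O(ε ^ M)` on `S`: uniformly on the compact subsets of `S`. -/
def BigOOn (S : Set (ℝ × ℝ)) (M : ℕ) (Ψ : ℝ → ℝ → ℝ → ℝ) : Prop :=
  ∀ K : Set (ℝ × ℝ), IsCompact K → K ⊆ S →
    ∃ C : ℝ, ∃ ε₀ : ℝ, 0 < ε₀ ∧ ∀ ε ∈ Ioo 0 ε₀, ∀ z ∈ K, |Ψ z.1 z.2 ε| ≤ C * ε ^ M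

/-- The left-hand side
`a u_t - ε² u_xxt + b u² u_x - 2 ε² u_x u_xx - ε² u u_xxx`
of the equation at `(x, t)`, for the value `ε` of the parameter and the values `A`, `B` of the
coefficients `a`, `b` at that point. -/
def eqn (T A B ε : ℝ) (u : ℝ → ℝ → ℝ) (x t : ℝ) : ℝ :=
  A * pt T u x t - ε ^ 2 * pt T (px (px u)) x t + B * (u x t) ^ 2 * px u x t
    - 2 * ε ^ 2 * px u x t * px (px u) x t - ε ^ 2 * u x t * px (px (px u)) x t

/-- The data: the final time `T`, the order `N`, the coefficients `a_k`, `b_k` of the expansions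
of `a` and `b`, the phase function `φ` and the (time-dependent) shift `C₀` of the main term. -/
structure Setup where
  T : ℝ
  N : ℕ
  a : ℕ → ℝ → ℝ → ℝ
  b : ℕ → ℝ → ℝ → ℝ
  φ : ℝ → ℝ
  C₀ : ℝ → ℝ

/-- The ingredients of the higher terms: `u_j⁻(x, t)`, `η_j(t, τ)` and `ψ_j(t, τ)`, `j ≥ 1`. -/
structure Terms where
  u : ℕ → ℝ → ℝ → ℝ
  η : ℕ → ℝ → ℝ → ℝ
  ψ : ℕ → ℝ → ℝ → ℝ

namespace Setup

variable (P : Setup)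

/-- `φ'(t)`, `t ∈ [0, T]`. -/
def dφ (t : ℝ) : ℝ := derivWithin P.φ (Icc 0 P.T) t

/-- `∑_{k ≤ N} ε^k a_k(x, t)`. -/
def aSum (ε x t : ℝ) : ℝ := ∑ k ∈ Finset.range (P.N + 1), ε ^ k * P.a k x t

/-- `∑_{k ≤ N} ε^k b_k(x, t)`. -/
def bSum (ε x t : ℝ) : ℝ := ∑ k ∈ Finset.range (P.N + 1), ε ^ k * P.b k x t

/-- The main term on the curve:
`v₀ = -6 (a₀/b₀) cosh⁻²(√a₀ τ/2 + C₀)`, with `a₀`, `b₀` taken at `(φ(t), t)`. -/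
def v0 (t τ : ℝ) : ℝ :=
  -6 * (P.a 0 (P.φ t) t / P.b 0 (P.φ t) t) *
    ((Real.cosh (Real.sqrt (P.a 0 (P.φ t) t) * (τ / 2) + P.C₀ t)) ^ 2)⁻¹

/-- The terms of the singular part: `V₀ = v₀(t, τ)`, and `V_j = u_j⁻(x, t) η_j(t, τ) + ψ_j(t, τ)`
for `j ≥ 1`. -/
def V (Q : Terms) (j : ℕ) : ℝ → ℝ → ℝ → ℝ :=
  fun x t τ => if j = 0 then P.v0 t τ else Q.u j x t * Q.η j t τ + Q.ψ j t τ

/-- `ε` times the total `x`-derivative of `W(x, t, (x - φ(t))/ε)`. -/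
def totX (ε : ℝ) (W : ℝ → ℝ → ℝ → ℝ) : ℝ → ℝ → ℝ → ℝ :=
  fun x t τ => ε * dX W x t τ + dTau W x t τ

/-- `ε` times the total `t`-derivative of `W(x, t, (x - φ(t))/ε)`. -/
def totT (ε : ℝ) (W : ℝ → ℝ → ℝ → ℝ) : ℝ → ℝ → ℝ → ℝ :=
  fun x t τ => ε * dT P.T W x t τ - P.dφ t * dTau W x t τ

/-- `ε` times the left-hand side of the equation (with `a`, `b` replaced by their truncated
expansions) after the substitution `u = W(x, t, τ)`, `τ = (x - φ(t))/ε`. -/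
def scaledEqn (ε : ℝ) (W : ℝ → ℝ → ℝ → ℝ) (x t τ : ℝ) : ℝ :=
  P.aSum ε x t * P.totT ε W x t τ
    - P.totT ε (totX ε (totX ε W)) x t τ
    + P.bSum ε x t * (W x t τ) ^ 2 * totX ε W x t τ
    - 2 * totX ε W x t τ * totX ε (totX ε W) x t τ
    - W x t τ * totX ε (totX ε (totX ε W)) x t τ

/-- The right-hand side `𝓕_j(t, τ)` of the equation for `v_j`: substitute
`∑_{i < j} ε^i V_i(x, t, τ)` into the equation multiplied by `ε`, put `x = φ(t) + ε τ`,
expand in powers of `ε` at fixed `(t, τ)`, and take minus the coefficient of `ε^j`. -/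
def F (Q : Terms) (j : ℕ) (t τ : ℝ) : ℝ :=
  -(iteratedDeriv j (fun ε => P.scaledEqn ε
      (fun x t τ => ∑ i ∈ Finset.range j, ε ^ i * P.V Q i x t τ) (P.φ t + ε * τ) t τ) 0
    / (j.factorial : ℝ))

/-- The left-hand side of the linear equation for `v_j`:
`(φ' - v₀) v_τττ - a₀ φ' v_τ + b₀ (v₀² v)_τ - 2 (v₀_τ v_τ)_τ - v₀_τττ v`,
with `a₀`, `b₀` taken at `(φ(t), t)`. -/
def linOp (v : ℝ → ℝ → ℝ) (t τ : ℝ) : ℝ :=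
  (P.dφ t - P.v0 t τ) * gtau (gtau (gtau v)) t τ
    - P.a 0 (P.φ t) t * P.dφ t * gtau v t τ
    + P.b 0 (P.φ t) t * gtau (fun t τ => (P.v0 t τ) ^ 2 * v t τ) t τ
    - 2 * gtau (fun t τ => gtau P.v0 t τ * gtau v t τ) t τ
    - gtau (gtau (gtau P.v0)) t τ * v t τ

/-- The constant of integration in `Φ_j(t, τ) = ∫_{-∞}^τ 𝓕_j(t, ξ) dξ + E_j(t)`, determined by
`Φ_j → 0` as `τ → +∞`. Thus `E_j` is the limit of `Φ_j` as `τ → -∞`. -/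
def E (Q : Terms) (j : ℕ) (t : ℝ) : ℝ := -∫ ξ, P.F Q j t ξ

/-- `ν_j(t) = -(a₀(φ(t), t) φ'(t))⁻¹ lim_{τ → -∞} Φ_j(t, τ)`. -/
def ν (Q : Terms) (j : ℕ) (t : ℝ) : ℝ := -(P.E Q j t / (P.a 0 (P.φ t) t * P.dφ t))

/-- The right-hand side `f_j⁻(x, t)` of the transport equation: minus the coefficient of `ε^j` in
the left-hand side of the equation for `u = ∑_{1 ≤ i < j} ε^i u_i⁻`. -/
def fMinus (Q : Terms) (j : ℕ) (x t : ℝ) : ℝ :=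
  -(iteratedDeriv j (fun ε => eqn P.T (P.aSum ε x t) (P.bSum ε x t) ε
      (fun x t => ∑ i ∈ Finset.Ico 1 j, ε ^ i * Q.u i x t) x t) 0
    / (j.factorial : ℝ))

/-- The orthogonality condition of index `j`. -/
def Orthogonal (Q : Terms) (j : ℕ) : Prop :=
  ∀ t ∈ Icc 0 P.T, ∫ τ, P.F Q j t τ * P.v0 t τ = 0

/-- `v_j = ν_j η + ψ`, with `η ∈ G̃`, `η → 1` as `τ → -∞`, and `ψ ∈ G̃₀`, solves the linear
equation for `v_j`. -/
def SolvesLinear (Q : Terms) (j : ℕ) (η ψ : ℝ → ℝ → ℝ) : Prop :=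
  InGt P.T η ∧ (∀ t ∈ Icc 0 P.T, Tendsto (fun τ => η t τ) atBot (𝓝 1)) ∧ InGt0 P.T ψ ∧
  ∀ t ∈ Icc 0 P.T, ∀ τ, P.linOp (fun t τ => P.ν Q j t * η t τ + ψ t τ) t τ = P.F Q j t τ

/-- `u_j⁻` is smooth, solves `a₀ ∂_t u_j⁻ = f_j⁻` for `x ≤ φ(t)`, and equals `ν_j` on the
curve `x = φ(t)`. -/
def SolvesTransport (Q : Terms) (j : ℕ) : Prop :=
  Smooth2 P.T (Q.u j) ∧
  (∀ t ∈ Icc 0 P.T, ∀ x ≤ P.φ t, P.a 0 x t * pt P.T (Q.u j) x t = P.fMinus Q j x t) ∧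
  ∀ t ∈ Icc 0 P.T, Q.u j (P.φ t) t = P.ν Q j t

/-- `Y_N⁻ = ∑_{1 ≤ j ≤ N} ε^j u_j⁻(x, t)`. -/
def YMinus (Q : Terms) (ε : ℝ) : ℝ → ℝ → ℝ :=
  fun x t => ∑ j ∈ Finset.Icc 1 P.N, ε ^ j * Q.u j x t

/-- `Y_N = ∑_{0 ≤ j ≤ N} ε^j V_j(x, t, (x - φ(t))/ε)`. -/
def Y (Q : Terms) (ε : ℝ) : ℝ → ℝ → ℝ :=
  fun x t => ∑ j ∈ Finset.range (P.N + 1), ε ^ j * P.V Q j x t ((x - P.φ t) / ε)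

open Classical in
/-- The function which defines `u_N` near or at `(x, t)`: `Y_N⁻` if `x ≤ φ(t) - μ`,
`0` if `x ≥ φ(t) + μ`, and `Y_N` if `|x - φ(t)| < μ`. -/
def piece (Q : Terms) (μ ε x t : ℝ) : ℝ → ℝ → ℝ :=
  if x ≤ P.φ t - μ then P.YMinus Q ε
  else if P.φ t + μ ≤ x then fun _ _ => 0
  else P.Y Q ε

/-- The piecewise function `u_N(x, t, ε)`. -/
def uN (Q : Terms) (μ : ℝ) (x t ε : ℝ) : ℝ := P.piece Q μ ε x t x t

/-- The discrepancy of `u_N`: the left-hand side of the equation at `(x, t)` for the (smooth)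
piece that defines `u_N` there. -/
def discrepancy (a b : ℝ → ℝ → ℝ → ℝ) (Q : Terms) (μ : ℝ) (x t ε : ℝ) : ℝ :=
  eqn P.T (a x t ε) (b x t ε) ε (P.piece Q μ ε x t) x t

end Setup

/-- `u = ∑_{j ≤ N} ε^j [U_j(x, t) + V_j(x, t, τ)] + O(ε^{N+1})`, `τ = (x - φ(t))/ε`, is an expansion
of order `N` of one-phase soliton-like type. -/
def SolitonLikeExpansion (T : ℝ) (N : ℕ) (φ : ℝ → ℝ) (U : ℕ → ℝ → ℝ → ℝ)
    (V : ℕ → ℝ → ℝ → ℝ → ℝ) (u : ℝ → ℝ → ℝ → ℝ) : Prop :=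
  ContDiffOn ℝ ∞ φ (Icc 0 T) ∧
  (∀ j ≤ N, Smooth2 T (U j)) ∧
  InG0 T (V 0) ∧ (∃ x τ : ℝ, ∃ t ∈ Icc 0 T, V 0 x t τ ≠ 0) ∧
  (∀ j, 1 ≤ j → j ≤ N → InG T (V j)) ∧
  BigOOn (strip T) (N + 1) (fun x t ε =>
    u x t ε - ∑ j ∈ Finset.range (N + 1), ε ^ j * (U j x t + V j x t ((x - φ t) / ε)))

end MCH

end

/-! Accuracy. Substituting `W = ∑ ε^i V_i` into `ε` times the equation gives a polynomial in `ε`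
with coefficients `c_k(x, t, τ)`. The limits of the `c_k` as `τ → ±∞` come from the same
substitution into the limits of `W`. At `+∞` this is the zero solution, so `c_k → 0`. At `-∞` it is
`ε` times the equation for `∑ ε^i u_i⁻`, and the transport equations annihilate its orders up to `N`
for `x ≤ φ(t)`. Hence every `c_k` with `k ≤ N + 1` decreases rapidly, with all derivatives, on `Side
φ`: for `τ ≥ 0`, and for `τ ≤ 0` as long as `x ≤ φ(t)` (`Regular.exists_coeff`).

Now fix `(t, τ)` and view `∑ s^k c_k(φ(t) + s τ, t, τ)` as a function of `s ∈ [0, ε]`; `s = ε` is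
the point of interest, and the whole segment stays in `Side φ`. The Taylor coefficients at `s = 0`
of orders `0, …, N` vanish: order zero is the equation of `v₀`, and order `l` is the linear equation
for `v_l`, because `u_l⁻ = ν_l` on the curve (`Regular.iteratedDeriv_scaled`). The derivative of
order `N + 1` is smaller than any power of `(1 + |τ|)⁻¹`, so Taylor's formula yields `ε^(N+1) (1 +
|τ|)^(-m)`, while the coefficients with `k ≥ N + 2` yield `ε^(N+2)` (`Regular.scaledEqn_bound`).
Division by `ε` gives all accuracy statements near the curve. The decay of `c_0, …, c_m`, restricted
to the curve, also shows that `𝓕_m` is rapidly decreasing (`Regular.rap_F`).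

Solvability. In the variable `z = κ τ + C₀`, `κ = √a₀ / 2`, one has `v₀ = -φ' S` with `S = cosh⁻²
z`, and the linear operator is `κ³ φ'` times `w ↦ (M w)'`, where `M w = ((1 + S) w')' + (-4 + 4 S +
18 S²) w` is formally self-adjoint and `M S' = 0`. For the step `χ = (1 - tanh z) / 2` one finds `∫
(M χ)' = 4` and `∫ (M χ)' S = 0`. Subtracting `ν_m χ` therefore makes the right-hand side of mean
zero, which is what the formula for `ν_m` achieves, and does not disturb orthogonality to `S`. What
remains is `g'` with `g` rapidly decreasing and `∫ g S' = 0`, and `M ψ = g` is solved by variation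
of parameters with `S'` and an explicit growing solution (`ClRap.green`, `exists_rapid_solution`).

Estimates for all derivatives at once are obtained from families closed under partial derivatives
each member of which satisfies the basic estimate (`Cl.of_family`). -/

namespace MCH

/-! ### Smooth functions of `(x, t, τ)` and their partial derivatives -/

/-- The domain `ℝ × [0, T] × ℝ`. -/
noncomputable def dom (T : ℝ) : Set (ℝ × ℝ × ℝ) := univ ×ˢ (Icc 0 T ×ˢ univ)

/-- The function of one variable `p ∈ ℝ³` given by a function of `(x, t, τ)`. -/
def unc (f : ℝ → ℝ → ℝ → ℝ) : ℝ × ℝ × ℝ → ℝ := fun p => f p.1 p.2.1 p.2.2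

/-- Smoothness on `ℝ × [0, T] × ℝ`. -/
def Sm (T : ℝ) (f : ℝ → ℝ → ℝ → ℝ) : Prop := ContDiffOn ℝ ∞ (unc f) (dom T)

/-- Equality on `ℝ × [0, T] × ℝ`. -/
def EqD (T : ℝ) (f g : ℝ → ℝ → ℝ → ℝ) : Prop :=
  ∀ x, ∀ t ∈ Icc 0 T, ∀ τ, f x t τ = g x t τ

/-- The three coordinate directions. -/
inductive Dir
  | x | t | s

/-- The partial derivative in a coordinate direction. -/
noncomputable def pd (T : ℝ) : Dir → (ℝ → ℝ → ℝ → ℝ) → ℝ → ℝ → ℝ → ℝ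
  | Dir.x => dX
  | Dir.t => dT T
  | Dir.s => dTau

/-- The coordinate vectors. -/
def Dir.vec : Dir → ℝ × ℝ × ℝ
  | Dir.x => (1, 0, 0)
  | Dir.t => (0, 1, 0)
  | Dir.s => (0, 0, 1)

variable {T : ℝ} {f g : ℝ → ℝ → ℝ → ℝ}

lemma mem_dom {x t τ : ℝ} (ht : t ∈ Icc 0 T) : (x, t, τ) ∈ dom T := by
  simpa [dom] using ht

lemma uniqueDiffOn_dom (hT : 0 < T) : UniqueDiffOn ℝ (dom T) :=
  uniqueDiffOn_univ.prod ((uniqueDiffOn_Icc hT).prod uniqueDiffOn_univ)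

lemma EqD.symm (h : EqD T f g) : EqD T g f := fun x t ht τ => (h x t ht τ).symm

lemma EqD.refl (f : ℝ → ℝ → ℝ → ℝ) : EqD T f f := fun _ _ _ _ => rfl

lemma EqD.trans {h : ℝ → ℝ → ℝ → ℝ} (h₁ : EqD T f g) (h₂ : EqD T g h) : EqD T f h :=
  fun x t ht τ => (h₁ x t ht τ).trans (h₂ x t ht τ)

lemma EqD.pd (h : EqD T f g) (i : Dir) : EqD T (pd T i f) (pd T i g) := by
  intro x t ht τ
  cases i
  · exact congrArg (fun F : ℝ → ℝ => deriv F x) (funext fun y => h y t ht τ)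
  · exact derivWithin_congr (fun s hs => h x s hs τ) (h x t ht τ)
  · exact congrArg (fun F : ℝ → ℝ => deriv F τ) (funext fun y => h x t ht y)

lemma EqD.add {f' g' : ℝ → ℝ → ℝ → ℝ} (h : EqD T f f') (h' : EqD T g g') :
    EqD T (f + g) (f' + g') := fun x t ht τ => by
  simp only [Pi.add_apply, h x t ht τ, h' x t ht τ]

lemma EqD.mul {f' g' : ℝ → ℝ → ℝ → ℝ} (h : EqD T f f') (h' : EqD T g g') :
    EqD T (f * g) (f' * g') := fun x t ht τ => by
  simp only [Pi.mul_apply, h x t ht τ, h' x t ht τ]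

lemma Sm.congr (hf : Sm T f) (h : EqD T f g) : Sm T g :=
  ContDiffOn.congr hf fun p hp => (h p.1 p.2.1 (by simpa [dom] using hp) p.2.2).symm

lemma Sm.hasFDeriv (hf : Sm T f) {p : ℝ × ℝ × ℝ} (hp : p ∈ dom T) :
    HasFDerivWithinAt (unc f) (fderivWithin ℝ (unc f) (dom T) p) (dom T) p :=
  (hf.differentiableOn (by simp) p hp).hasFDerivWithinAt

lemma Sm.hasDeriv_x_aux (hf : Sm T f) {t : ℝ} (ht : t ∈ Icc 0 T) (x τ : ℝ) :
    HasDerivAt (fun y => f y t τ)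
      (fderivWithin ℝ (unc f) (dom T) (x, t, τ) Dir.x.vec) x := by
  have h := (hf.hasFDeriv (mem_dom (x := x) (τ := τ) ht)).comp_hasDerivWithinAt
    (s := univ) (f := fun y : ℝ => (y, t, τ)) (f' := Dir.x.vec) x
    (((hasDerivAt_id x).prodMk ((hasDerivAt_const x t).prodMk (hasDerivAt_const x τ))
      ).hasDerivWithinAt) (fun _ _ => mem_dom ht)
  exact h.hasDerivAt univ_mem

lemma Sm.hasDeriv_s_aux (hf : Sm T f) {t : ℝ} (ht : t ∈ Icc 0 T) (x τ : ℝ) :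
    HasDerivAt (fun y => f x t y)
      (fderivWithin ℝ (unc f) (dom T) (x, t, τ) Dir.s.vec) τ := by
  have h := (hf.hasFDeriv (mem_dom (x := x) (τ := τ) ht)).comp_hasDerivWithinAt
    (s := univ) (f := fun y : ℝ => (x, t, y)) (f' := Dir.s.vec) τ
    (((hasDerivAt_const τ x).prodMk ((hasDerivAt_const τ t).prodMk (hasDerivAt_id τ))
      ).hasDerivWithinAt) (fun _ _ => mem_dom ht)
  exact h.hasDerivAt univ_mem

lemma Sm.hasDeriv_t_aux (hf : Sm T f) {t : ℝ} (ht : t ∈ Icc 0 T) (x τ : ℝ) :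
    HasDerivWithinAt (fun y => f x y τ)
      (fderivWithin ℝ (unc f) (dom T) (x, t, τ) Dir.t.vec) (Icc 0 T) t :=
  (hf.hasFDeriv (mem_dom (x := x) (τ := τ) ht)).comp_hasDerivWithinAt
    (s := Icc 0 T) (f := fun y : ℝ => (x, y, τ)) (f' := Dir.t.vec) t
    (((hasDerivAt_const t x).prodMk ((hasDerivAt_id t).prodMk (hasDerivAt_const t τ))
      ).hasDerivWithinAt) (fun _ hy => mem_dom hy)

lemma Sm.pd_eq (hT : 0 < T) (hf : Sm T f) (i : Dir) {t : ℝ} (ht : t ∈ Icc 0 T) (x τ : ℝ) :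
    pd T i f x t τ = fderivWithin ℝ (unc f) (dom T) (x, t, τ) i.vec := by
  cases i
  · exact (hf.hasDeriv_x_aux ht x τ).deriv
  · exact (hf.hasDeriv_t_aux ht x τ).derivWithin (uniqueDiffOn_Icc hT t ht)
  · exact (hf.hasDeriv_s_aux ht x τ).deriv

lemma Sm.hasDeriv_x (hT : 0 < T) (hf : Sm T f) {t : ℝ} (ht : t ∈ Icc 0 T) (x τ : ℝ) :
    HasDerivAt (fun y => f y t τ) (dX f x t τ) x := by
  have h := hf.hasDeriv_x_aux ht x τ
  rwa [← hf.pd_eq hT _ ht] at h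

lemma Sm.hasDeriv_s (hT : 0 < T) (hf : Sm T f) {t : ℝ} (ht : t ∈ Icc 0 T) (x τ : ℝ) :
    HasDerivAt (fun y => f x t y) (dTau f x t τ) τ := by
  have h := hf.hasDeriv_s_aux ht x τ
  rwa [← hf.pd_eq hT _ ht] at h

lemma Sm.hasDeriv_t (hT : 0 < T) (hf : Sm T f) {t : ℝ} (ht : t ∈ Icc 0 T) (x τ : ℝ) :
    HasDerivWithinAt (fun y => f x y τ) (dT T f x t τ) (Icc 0 T) t := by
  have h := hf.hasDeriv_t_aux ht x τ
  rwa [← hf.pd_eq hT _ ht] at h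

lemma Sm.contDiffOn_fderivWithin (hT : 0 < T) (hf : Sm T f) :
    ContDiffOn ℝ ∞ (fderivWithin ℝ (unc f) (dom T)) (dom T) :=
  ContDiffOn.fderivWithin hf (uniqueDiffOn_dom hT) (by simp)

lemma Sm.pd (hT : 0 < T) (hf : Sm T f) (i : Dir) : Sm T (pd T i f) := by
  refine ContDiffOn.congr ((hf.contDiffOn_fderivWithin hT).clm_apply
    (contDiffOn_const (c := i.vec))) fun p hp => ?_
  exact hf.pd_eq hT i (by simpa [dom] using hp) p.1 p.2.2

/-- Symmetry of second derivatives holds also at the end times, because the domain lies in the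
closure of its interior; this needs `0 < T`. -/
lemma Sm.pd_comm (hT : 0 < T) (hf : Sm T f) (i j : Dir) :
    EqD T (MCH.pd T i (MCH.pd T j f)) (MCH.pd T j (MCH.pd T i f)) := by
  intro x t ht τ
  have hp := mem_dom (x := x) (τ := τ) ht
  have key : ∀ i j : Dir, MCH.pd T i (MCH.pd T j f) x t τ =
      fderivWithin ℝ (fderivWithin ℝ (unc f) (dom T)) (dom T) (x, t, τ) i.vec j.vec := by
    intro i j
    rw [(hf.pd hT j).pd_eq hT i ht]
    have h1 : fderivWithin ℝ (unc (MCH.pd T j f)) (dom T) (x, t, τ) =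
        fderivWithin ℝ (fun p => fderivWithin ℝ (unc f) (dom T) p j.vec) (dom T) (x, t, τ) := by
      refine fderivWithin_congr (fun p hp => ?_) ?_
      · exact hf.pd_eq hT j (by simpa [dom] using hp) p.1 p.2.2
      · exact hf.pd_eq hT j ht x τ
    rw [h1]
    have hd := ((hf.contDiffOn_fderivWithin hT).differentiableOn (by simp) _ hp)
    rw [fderivWithin_clm_apply (uniqueDiffOn_dom hT _ hp) hd (by fun_prop)]
    simp
  rw [key, key]
  have hsymm : IsSymmSndFDerivWithinAt ℝ (unc f) (dom T) (x, t, τ) := by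
    refine ContDiffWithinAt.isSymmSndFDerivWithinAt (n := ∞) (hf _ hp)
      (by simpa using (WithTop.coe_le_coe.2 le_top : ((2 : ℕ∞) : WithTop ℕ∞) ≤ ((⊤ : ℕ∞) : WithTop ℕ∞)))
      (uniqueDiffOn_dom hT) ?_ hp
    have : interior (dom T) = univ ×ˢ (Ioo 0 T ×ˢ univ) := by
      simp [dom, interior_prod_eq]
    rw [this, closure_prod_eq, closure_prod_eq, closure_Ioo hT.ne]
    simpa [dom] using hp
  exact hsymm.eq _ _

lemma Sm.add (hf : Sm T f) (hg : Sm T g) : Sm T (f + g) := ContDiffOn.add hf hg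

lemma Sm.mul (hf : Sm T f) (hg : Sm T g) : Sm T (f * g) := ContDiffOn.mul hf hg

lemma Sm.neg (hf : Sm T f) : Sm T (-f) := ContDiffOn.neg hf

lemma Sm.sub (hf : Sm T f) (hg : Sm T g) : Sm T (f - g) := ContDiffOn.sub hf hg

lemma Sm.const (c : ℝ) : Sm T (fun _ _ _ => c) := contDiffOn_const

lemma Sm.tau : Sm T (fun _ _ τ => τ) := contDiff_snd.snd.contDiffOn

lemma Sm.of_xt {u : ℝ → ℝ → ℝ} (hu : Smooth2 T u) : Sm T (fun x t _ => u x t) := by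
  refine ContDiffOn.comp (g := fun p : ℝ × ℝ => u p.1 p.2)
    (f := fun p : ℝ × ℝ × ℝ => (p.1, p.2.1)) hu (by fun_prop) ?_
  intro p hp
  simpa [dom, strip] using hp

lemma Sm.of_ts {u : ℝ → ℝ → ℝ}
    (hu : ContDiffOn ℝ ∞ (fun p : ℝ × ℝ => u p.1 p.2) (Icc 0 T ×ˢ univ)) :
    Sm T (fun _ t τ => u t τ) := by
  refine ContDiffOn.comp (g := fun p : ℝ × ℝ => u p.1 p.2)
    (f := fun p : ℝ × ℝ × ℝ => (p.2.1, p.2.2)) hu (by fun_prop) ?_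
  intro p hp
  simpa [dom] using hp

lemma Sm.of_t {u : ℝ → ℝ} (hu : ContDiffOn ℝ ∞ u (Icc 0 T)) : Sm T (fun _ t _ => u t) := by
  refine ContDiffOn.comp (g := u) (f := fun p : ℝ × ℝ × ℝ => p.2.1) hu (by fun_prop) ?_
  intro p hp
  simpa [dom] using hp

lemma Sm.of_s {u : ℝ → ℝ} (hu : ContDiff ℝ ∞ u) : Sm T (fun _ _ τ => u τ) :=
  (hu.comp contDiff_snd.snd).contDiffOn

lemma Sm.to_ts (hf : Sm T f) (x : ℝ) :
    ContDiffOn ℝ ∞ (fun p : ℝ × ℝ => f x p.1 p.2) (Icc 0 T ×ˢ univ) := by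
  refine ContDiffOn.comp (g := unc f) (f := fun p : ℝ × ℝ => (x, p.1, p.2)) hf (by fun_prop) ?_
  intro p hp
  simpa [dom] using hp

lemma Sm.contDiff_slice (hf : Sm T f) (x : ℝ) {t : ℝ} (ht : t ∈ Icc 0 T) :
    ContDiff ℝ ∞ (fun τ => f x t τ) := by
  rw [← contDiffOn_univ]
  exact ContDiffOn.comp (g := unc f) (f := fun τ : ℝ => (x, t, τ)) hf (by fun_prop)
    fun _ _ => mem_dom ht

lemma Sm.to_xt (hf : Sm T f) (τ : ℝ) : Smooth2 T (fun x t => f x t τ) := by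
  refine ContDiffOn.comp (g := unc f) (f := fun p : ℝ × ℝ => (p.1, p.2, τ)) hf (by fun_prop) ?_
  intro p hp
  simpa [dom, strip] using hp

lemma pd_add (hT : 0 < T) (hf : Sm T f) (hg : Sm T g) (i : Dir) :
    EqD T (pd T i (f + g)) (pd T i f + pd T i g) := by
  intro x t ht τ
  cases i
  · exact ((hf.hasDeriv_x hT ht x τ).add (hg.hasDeriv_x hT ht x τ)).deriv
  · exact ((hf.hasDeriv_t hT ht x τ).add (hg.hasDeriv_t hT ht x τ)).derivWithin
      (uniqueDiffOn_Icc hT t ht)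
  · exact ((hf.hasDeriv_s hT ht x τ).add (hg.hasDeriv_s hT ht x τ)).deriv

lemma pd_mul (hT : 0 < T) (hf : Sm T f) (hg : Sm T g) (i : Dir) :
    EqD T (pd T i (f * g)) (pd T i f * g + f * pd T i g) := by
  intro x t ht τ
  cases i
  · exact ((hf.hasDeriv_x hT ht x τ).mul (hg.hasDeriv_x hT ht x τ)).deriv
  · exact ((hf.hasDeriv_t hT ht x τ).mul (hg.hasDeriv_t hT ht x τ)).derivWithin
      (uniqueDiffOn_Icc hT t ht)
  · exact ((hf.hasDeriv_s hT ht x τ).mul (hg.hasDeriv_s hT ht x τ)).deriv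

lemma pd_const (c : ℝ) (i : Dir) : pd T i (fun _ _ _ => c) = fun _ _ _ => 0 := by
  cases i <;> funext x t τ <;> simp [pd, dX, dT, dTau]

/-! ### Classes of functions defined by estimates for all derivatives -/

/-- `Der T f g`: the function `g` is an iterated partial derivative of `f`. -/
inductive Der (T : ℝ) (f : ℝ → ℝ → ℝ → ℝ) : (ℝ → ℝ → ℝ → ℝ) → Prop
  | refl : Der T f f
  | step (i : Dir) {g : ℝ → ℝ → ℝ → ℝ} : Der T f g → Der T f (pd T i g)

/-- Smooth functions all of whose derivatives satisfy `B`. -/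
def Cl (T : ℝ) (B : (ℝ → ℝ → ℝ → ℝ) → Prop) (f : ℝ → ℝ → ℝ → ℝ) : Prop :=
  Sm T f ∧ ∀ g, Der T f g → B g

/-- The property `B` depends on the values on `ℝ × [0, T] × ℝ` only. -/
def Respects (T : ℝ) (B : (ℝ → ℝ → ℝ → ℝ) → Prop) : Prop :=
  ∀ f g, EqD T f g → B f → B g

variable {B B₁ B₂ : (ℝ → ℝ → ℝ → ℝ) → Prop}

lemma Der.sm (hT : 0 < T) (hf : Sm T f) (h : Der T f g) : Sm T g := by
  induction h with
  | refl => exact hf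
  | step i _ ih => exact ih.pd hT i

lemma Der.trans {h : ℝ → ℝ → ℝ → ℝ} (h₁ : Der T f g) (h₂ : Der T g h) : Der T f h := by
  induction h₂ with
  | refl => exact h₁
  | step i _ ih => exact ih.step i

lemma Der.head (h : Der T f g) : g = f ∨ ∃ i, Der T (pd T i f) g := by
  induction h with
  | refl => exact Or.inl rfl
  | step i _ ih =>
    rcases ih with rfl | ⟨j, hj⟩
    · exact Or.inr ⟨i, Der.refl⟩
    · exact Or.inr ⟨j, hj.step i⟩

lemma Cl.base (h : Cl T B f) : B f := h.2 f Der.refl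

lemma Cl.der (hT : 0 < T) (h : Cl T B f) (hg : Der T f g) : Cl T B g :=
  ⟨hg.sm hT h.1, fun _ hk => h.2 _ (hg.trans hk)⟩

lemma Cl.pd (hT : 0 < T) (h : Cl T B f) (i : Dir) : Cl T B (pd T i f) :=
  h.der hT (Der.refl.step i)

/-- Peels off the innermost derivative, by `Der.head`, so that a class can be checked on the
function and its three first derivatives. -/
lemma Cl.of_pd (hf : Sm T f) (hB : B f) (h : ∀ i, Cl T B (MCH.pd T i f)) : Cl T B f := by
  refine ⟨hf, fun g hg => ?_⟩
  rcases hg.head with rfl | ⟨i, hi⟩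
  · exact hB
  · exact (h i).2 _ hi

lemma Cl.mono (h : Cl T B₁ f) (hB : ∀ g, B₁ g → B₂ g) : Cl T B₂ f :=
  ⟨h.1, fun g hg => hB g (h.2 g hg)⟩

/-- A family of smooth functions which satisfy `B`, closed under partial derivatives, consists
of functions of the class defined by `B`. -/
lemma Cl.of_family (hB : Respects T B) (A : (ℝ → ℝ → ℝ → ℝ) → Prop)
    (hs : ∀ a, A a → Sm T a) (hA : ∀ a, A a → B a)
    (hd : ∀ a, A a → ∀ i, ∃ a', A a' ∧ EqD T (MCH.pd T i a) a') (hf : A f) : Cl T B f := by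
  refine ⟨hs f hf, fun g hg => ?_⟩
  obtain ⟨a, ha, he⟩ : ∃ a, A a ∧ EqD T g a := by
    induction hg with
    | refl => exact ⟨f, hf, EqD.refl f⟩
    | step i _ ih =>
      obtain ⟨a, ha, he⟩ := ih
      obtain ⟨a', ha', he'⟩ := hd a ha i
      exact ⟨a', ha', (he.pd i).trans he'⟩
  exact hB _ _ he.symm (hA a ha)

lemma Cl.congr (hB : Respects T B) (h : Cl T B f) (he : EqD T f g) : Cl T B g := by
  refine ⟨h.1.congr he, fun k hk => ?_⟩
  obtain ⟨a, ha, he⟩ : ∃ a, Der T f a ∧ EqD T k a := by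
    induction hk with
    | refl => exact ⟨f, Der.refl, he.symm⟩
    | step i _ ih =>
      obtain ⟨a, ha, he⟩ := ih
      exact ⟨_, ha.step i, he.pd i⟩
  exact hB _ _ he.symm (h.2 a ha)

/-- Sums of products of derivatives of two functions. -/
inductive ProdSpan (T : ℝ) (f g : ℝ → ℝ → ℝ → ℝ) : (ℝ → ℝ → ℝ → ℝ) → Prop
  | mul {f' g' : ℝ → ℝ → ℝ → ℝ} : Der T f f' → Der T g g' → ProdSpan T f g (f' * g')
  | add {a b : ℝ → ℝ → ℝ → ℝ} : ProdSpan T f g a → ProdSpan T f g b → ProdSpan T f g (a + b)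

lemma ProdSpan.sm (hT : 0 < T) (hf : Sm T f) (hg : Sm T g) {a : ℝ → ℝ → ℝ → ℝ}
    (h : ProdSpan T f g a) : Sm T a := by
  induction h with
  | mul h₁ h₂ => exact (h₁.sm hT hf).mul (h₂.sm hT hg)
  | add _ _ h₁ h₂ => exact h₁.add h₂

/-- By the Leibniz rule the family `ProdSpan` is closed under partial derivatives. -/
lemma Cl.mul (hT : 0 < T) (hB : Respects T B) (hadd : ∀ a b, B a → B b → B (a + b))
    (hmul : ∀ a b, B₁ a → B₂ b → B (a * b)) (hf : Cl T B₁ f) (hg : Cl T B₂ g) :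
    Cl T B (f * g) := by
  refine Cl.of_family hB (ProdSpan T f g) (fun a ha => ha.sm hT hf.1 hg.1) ?_ ?_
    (ProdSpan.mul Der.refl Der.refl)
  · intro a ha
    induction ha with
    | mul h₁ h₂ => exact hmul _ _ (hf.2 _ h₁) (hg.2 _ h₂)
    | add _ _ h₁ h₂ => exact hadd _ _ h₁ h₂
  · intro a ha i
    induction ha with
    | mul h₁ h₂ =>
      exact ⟨_, ProdSpan.add (ProdSpan.mul (h₁.step i) h₂) (ProdSpan.mul h₁ (h₂.step i)),
        pd_mul hT (h₁.sm hT hf.1) (h₂.sm hT hg.1) i⟩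
    | add h₁ h₂ ih₁ ih₂ =>
      obtain ⟨a₁, ha₁, he₁⟩ := ih₁
      obtain ⟨a₂, ha₂, he₂⟩ := ih₂
      exact ⟨_, ha₁.add ha₂,
        (pd_add hT (h₁.sm hT hf.1 hg.1) (h₂.sm hT hf.1 hg.1) i).trans (he₁.add he₂)⟩

lemma Cl.add (hT : 0 < T) (hB : Respects T B) (hadd : ∀ a b, B a → B b → B (a + b))
    (hf : Cl T B f) (hg : Cl T B g) : Cl T B (f + g) := by
  refine Cl.of_family hB (fun a => ∃ f' g', Der T f f' ∧ Der T g g' ∧ a = f' + g') ?_ ?_ ?_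
    ⟨f, g, Der.refl, Der.refl, rfl⟩
  · rintro a ⟨f', g', hf', hg', rfl⟩
    exact (hf'.sm hT hf.1).add (hg'.sm hT hg.1)
  · rintro a ⟨f', g', hf', hg', rfl⟩
    exact hadd _ _ (hf.2 _ hf') (hg.2 _ hg')
  · rintro a ⟨f', g', hf', hg', rfl⟩ i
    exact ⟨_, ⟨_, _, hf'.step i, hg'.step i, rfl⟩, pd_add hT (hf'.sm hT hf.1) (hg'.sm hT hg.1) i⟩

end MCH

namespace MCH

/-! ### Rapid decrease and slow growth -/

variable {T : ℝ} {f g : ℝ → ℝ → ℝ → ℝ} {S S' : ℝ → ℝ → ℝ → Prop}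

/-- Rapid decrease in `τ` on `S`, locally uniformly in `x`. -/
def Rap (T : ℝ) (S : ℝ → ℝ → ℝ → Prop) (f : ℝ → ℝ → ℝ → ℝ) : Prop :=
  ∀ (n : ℕ) (R : ℝ), ∃ C : ℝ, 0 ≤ C ∧ ∀ x t τ, |x| ≤ R → t ∈ Icc 0 T → S x t τ →
    (1 + |τ|) ^ n * |f x t τ| ≤ C

/-- At most polynomial growth in `τ` on `S`, locally uniformly in `x`. -/
def Slow (T : ℝ) (S : ℝ → ℝ → ℝ → Prop) (f : ℝ → ℝ → ℝ → ℝ) : Prop :=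
  ∀ R : ℝ, ∃ (n : ℕ) (C : ℝ), 0 ≤ C ∧ ∀ x t τ, |x| ≤ R → t ∈ Icc 0 T → S x t τ →
    |f x t τ| ≤ C * (1 + |τ|) ^ n

/-- The half-space `τ ≥ 0`. -/
def Pos : ℝ → ℝ → ℝ → Prop := fun _ _ τ => 0 ≤ τ

/-- The half-space `τ ≤ 0`. -/
def Neg : ℝ → ℝ → ℝ → Prop := fun _ _ τ => τ ≤ 0

/-- The whole space. -/
def All : ℝ → ℝ → ℝ → Prop := fun _ _ _ => True

lemma Rap.respects : Respects T (Rap T S) := by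
  intro f g h hf n R
  obtain ⟨C, h0, hC⟩ := hf n R
  exact ⟨C, h0, fun x t τ hx ht hs => by rw [← h x t ht τ]; exact hC x t τ hx ht hs⟩

lemma Slow.respects : Respects T (Slow T S) := by
  intro f g h hf R
  obtain ⟨n, C, h0, hC⟩ := hf R
  exact ⟨n, C, h0, fun x t τ hx ht hs => by rw [← h x t ht τ]; exact hC x t τ hx ht hs⟩

lemma Rap.add (hf : Rap T S f) (hg : Rap T S g) : Rap T S (f + g) := by
  intro n R
  obtain ⟨C, h0, hC⟩ := hf n R
  obtain ⟨C', h0', hC'⟩ := hg n R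
  refine ⟨C + C', by positivity, fun x t τ hx ht hs => ?_⟩
  have h1 := hC x t τ hx ht hs
  have h2 := hC' x t τ hx ht hs
  calc (1 + |τ|) ^ n * |f x t τ + g x t τ|
      ≤ (1 + |τ|) ^ n * (|f x t τ| + |g x t τ|) := by
        gcongr; exact abs_add_le _ _
    _ ≤ C + C' := by rw [mul_add]; exact add_le_add h1 h2

lemma one_le_weight (τ : ℝ) (n : ℕ) : 1 ≤ (1 + |τ|) ^ n :=
  one_le_pow₀ (by linarith [abs_nonneg τ])

lemma Slow.add (hf : Slow T S f) (hg : Slow T S g) : Slow T S (f + g) := by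
  intro R
  obtain ⟨n, C, h0, hC⟩ := hf R
  obtain ⟨n', C', h0', hC'⟩ := hg R
  refine ⟨n + n', C + C', by positivity, fun x t τ hx ht hs => ?_⟩
  have h1 := hC x t τ hx ht hs
  have h2 := hC' x t τ hx ht hs
  have e1 := one_le_weight τ n
  have e2 := one_le_weight τ n'
  calc |f x t τ + g x t τ| ≤ |f x t τ| + |g x t τ| := abs_add_le _ _
    _ ≤ C * (1 + |τ|) ^ n + C' * (1 + |τ|) ^ n' := add_le_add h1 h2
    _ ≤ C * ((1 + |τ|) ^ n * (1 + |τ|) ^ n') + C' * ((1 + |τ|) ^ n * (1 + |τ|) ^ n') := by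
        gcongr
        · exact le_mul_of_one_le_right (by positivity) e2
        · exact le_mul_of_one_le_left (by positivity) e1
    _ = (C + C') * (1 + |τ|) ^ (n + n') := by rw [pow_add]; ring

lemma Rap.mul_slow (hf : Rap T S f) (hg : Slow T S g) : Rap T S (f * g) := by
  intro n R
  obtain ⟨m, C', h0', hC'⟩ := hg R
  obtain ⟨C, h0, hC⟩ := hf (n + m) R
  refine ⟨C * C', by positivity, fun x t τ hx ht hs => ?_⟩
  have h1 := hC x t τ hx ht hs
  have h2 := hC' x t τ hx ht hs
  calc (1 + |τ|) ^ n * |f x t τ * g x t τ|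
      = (1 + |τ|) ^ n * |f x t τ| * |g x t τ| := by rw [abs_mul]; ring
    _ ≤ (1 + |τ|) ^ n * |f x t τ| * (C' * (1 + |τ|) ^ m) := by gcongr
    _ = (1 + |τ|) ^ (n + m) * |f x t τ| * C' := by rw [pow_add]; ring
    _ ≤ C * C' := by gcongr

lemma Slow.mul (hf : Slow T S f) (hg : Slow T S g) : Slow T S (f * g) := by
  intro R
  obtain ⟨n, C, h0, hC⟩ := hf R
  obtain ⟨n', C', h0', hC'⟩ := hg R
  refine ⟨n + n', C * C', by positivity, fun x t τ hx ht hs => ?_⟩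
  have h1 := hC x t τ hx ht hs
  have h2 := hC' x t τ hx ht hs
  calc |f x t τ * g x t τ| = |f x t τ| * |g x t τ| := abs_mul _ _
    _ ≤ (C * (1 + |τ|) ^ n) * (C' * (1 + |τ|) ^ n') := by gcongr
    _ = C * C' * (1 + |τ|) ^ (n + n') := by rw [pow_add]; ring

lemma Rap.slow (hf : Rap T S f) : Slow T S f := by
  intro R
  obtain ⟨C, h0, hC⟩ := hf 0 R
  exact ⟨0, C, h0, fun x t τ hx ht hs => by simpa using hC x t τ hx ht hs⟩

lemma Rap.mono (hf : Rap T S f) (h : ∀ x, ∀ t ∈ Icc 0 T, ∀ τ, S' x t τ → S x t τ) :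
    Rap T S' f := by
  intro n R
  obtain ⟨C, h0, hC⟩ := hf n R
  exact ⟨C, h0, fun x t τ hx ht hs => hC x t τ hx ht (h x t ht τ hs)⟩

lemma Rap.union (hf : Rap T S f) (hf' : Rap T S' f) :
    Rap T (fun x t τ => S x t τ ∨ S' x t τ) f := by
  intro n R
  obtain ⟨C, h0, hC⟩ := hf n R
  obtain ⟨C', h0', hC'⟩ := hf' n R
  refine ⟨C + C', by positivity, fun x t τ hx ht hs => ?_⟩
  rcases hs with hs | hs
  · linarith [hC x t τ hx ht hs]
  · linarith [hC' x t τ hx ht hs]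

lemma Slow.union (hf : Slow T S f) (hf' : Slow T S' f) :
    Slow T (fun x t τ => S x t τ ∨ S' x t τ) f := by
  intro R
  obtain ⟨n, C, h0, hC⟩ := hf R
  obtain ⟨n', C', h0', hC'⟩ := hf' R
  refine ⟨n + n', C + C', by positivity, fun x t τ hx ht hs => ?_⟩
  have e1 := one_le_weight τ n
  have e2 := one_le_weight τ n'
  rw [pow_add]
  rcases hs with hs | hs
  · refine (hC x t τ hx ht hs).trans ?_
    gcongr
    · linarith
    · exact le_mul_of_one_le_right (by positivity) e2
  · refine (hC' x t τ hx ht hs).trans ?_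
    gcongr
    · linarith
    · exact le_mul_of_one_le_left (by positivity) e1

lemma Slow.mono (hf : Slow T S f) (h : ∀ x, ∀ t ∈ Icc 0 T, ∀ τ, S' x t τ → S x t τ) :
    Slow T S' f := by
  intro R
  obtain ⟨n, C, h0, hC⟩ := hf R
  exact ⟨n, C, h0, fun x t τ hx ht hs => hC x t τ hx ht (h x t ht τ hs)⟩

/-- Functions rapidly decreasing on `S` with all derivatives. -/
abbrev ClRap (T : ℝ) (S : ℝ → ℝ → ℝ → Prop) (f : ℝ → ℝ → ℝ → ℝ) : Prop := Cl T (Rap T S) f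

/-- Functions slowly growing on `S` with all derivatives. -/
abbrev ClSlow (T : ℝ) (S : ℝ → ℝ → ℝ → Prop) (f : ℝ → ℝ → ℝ → ℝ) : Prop := Cl T (Slow T S) f

lemma ClRap.add (hT : 0 < T) (hf : ClRap T S f) (hg : ClRap T S g) : ClRap T S (f + g) :=
  Cl.add hT Rap.respects (fun _ _ => Rap.add) hf hg

lemma ClSlow.add (hT : 0 < T) (hf : ClSlow T S f) (hg : ClSlow T S g) : ClSlow T S (f + g) :=
  Cl.add hT Slow.respects (fun _ _ => Slow.add) hf hg

lemma ClSlow.mul (hT : 0 < T) (hf : ClSlow T S f) (hg : ClSlow T S g) : ClSlow T S (f * g) :=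
  Cl.mul hT Slow.respects (fun _ _ => Slow.add) (fun _ _ => Slow.mul) hf hg

lemma ClRap.mul_slow (hT : 0 < T) (hf : ClRap T S f) (hg : ClSlow T S g) : ClRap T S (f * g) :=
  Cl.mul hT Rap.respects (fun _ _ => Rap.add) (fun _ _ => Rap.mul_slow) hf hg

lemma ClRap.slow (hf : ClRap T S f) : ClSlow T S f := hf.mono fun _ => Rap.slow

lemma ClRap.mono_set (hf : ClRap T S f) (h : ∀ x, ∀ t ∈ Icc 0 T, ∀ τ, S' x t τ → S x t τ) :
    ClRap T S' f := ⟨hf.1, fun g hg => (hf.2 g hg).mono h⟩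

lemma ClSlow.mono_set (hf : ClSlow T S f) (h : ∀ x, ∀ t ∈ Icc 0 T, ∀ τ, S' x t τ → S x t τ) :
    ClSlow T S' f := ⟨hf.1, fun g hg => (hf.2 g hg).mono h⟩

lemma ClRap.of_all (hf : ClRap T All f) : ClRap T S f := hf.mono_set fun _ _ _ _ _ => trivial

lemma ClSlow.of_all (hf : ClSlow T All f) : ClSlow T S f := hf.mono_set fun _ _ _ _ _ => trivial

lemma ClRap.pos_neg (hf : ClRap T Pos f) (hf' : ClRap T Neg f) : ClRap T All f :=
  ⟨hf.1, fun g hg => ((hf.2 g hg).union (hf'.2 g hg)).mono fun _ _ _ τ _ => le_total 0 τ⟩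

lemma ClSlow.pos_neg (hf : ClSlow T Pos f) (hf' : ClSlow T Neg f) : ClSlow T All f :=
  ⟨hf.1, fun g hg => ((hf.2 g hg).union (hf'.2 g hg)).mono fun _ _ _ τ _ => le_total 0 τ⟩

/-! ### Smooth functions on compact sets -/

lemma Sm.bounded (hf : Sm T f) (R R' : ℝ) :
    ∃ C : ℝ, 0 ≤ C ∧ ∀ x t τ, |x| ≤ R → t ∈ Icc 0 T → |τ| ≤ R' → |f x t τ| ≤ C := by
  have hK : IsCompact (Icc (-R) R ×ˢ (Icc 0 T ×ˢ Icc (-R') R')) :=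
    isCompact_Icc.prod (isCompact_Icc.prod isCompact_Icc)
  obtain ⟨C, hC⟩ := hK.exists_bound_of_continuousOn (f := unc f)
    (hf.continuousOn.mono (by
      rintro ⟨x, t, τ⟩ ⟨_, h, _⟩
      exact mem_dom h))
  refine ⟨max C 0, le_max_right _ _, fun x t τ hx ht hτ => (hC (x, t, τ) ?_).trans (le_max_left _ _)⟩
  exact ⟨abs_le.1 hx, ht, abs_le.1 hτ⟩

lemma ClSlow.of_xt (hT : 0 < T) {u : ℝ → ℝ → ℝ} (hu : Smooth2 T u) :
    ClSlow T S (fun x t _ => u x t) := by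
  refine Cl.of_family Slow.respects (fun a => ∃ u : ℝ → ℝ → ℝ, Smooth2 T u ∧ a = fun x t _ => u x t)
    ?_ ?_ ?_ ⟨u, hu, rfl⟩
  · rintro a ⟨u, hu, rfl⟩
    exact Sm.of_xt hu
  · rintro a ⟨u, hu, rfl⟩ R
    obtain ⟨C, h0, hC⟩ := (Sm.of_xt hu).bounded R 0
    exact ⟨0, C, h0, fun x t τ hx ht _ => by simpa using hC x t 0 hx ht (by simp)⟩
  · rintro a ⟨u, hu, rfl⟩ i
    have h := (Sm.of_xt hu).pd hT i
    refine ⟨_, ⟨_, h.to_xt 0, rfl⟩, ?_⟩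
    intro x t ht τ
    cases i
    · rfl
    · rfl
    · simp [MCH.pd, dTau]

lemma ClSlow.const (hT : 0 < T) (c : ℝ) : ClSlow T S (fun _ _ _ => c) :=
  ClSlow.of_xt hT (u := fun _ _ => c) contDiffOn_const

lemma smooth2_of_t {u : ℝ → ℝ} (hu : ContDiffOn ℝ ∞ u (Icc 0 T)) : Smooth2 T (fun _ t => u t) :=
  (Sm.of_t hu).to_xt 0

lemma ClSlow.of_t (hT : 0 < T) {u : ℝ → ℝ} (hu : ContDiffOn ℝ ∞ u (Icc 0 T)) :
    ClSlow T S (fun _ t _ => u t) :=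
  ClSlow.of_xt hT (smooth2_of_t hu)

lemma ClRap.zero : ClRap T S (fun _ _ _ => 0) := by
  refine Cl.of_family Rap.respects (fun a => a = fun _ _ _ => 0) ?_ ?_ ?_ rfl
  · rintro a rfl; exact Sm.const 0
  · rintro a rfl n R; exact ⟨0, le_rfl, by simp⟩
  · rintro a rfl i; exact ⟨_, rfl, by rw [pd_const]; exact EqD.refl _⟩

lemma ClSlow.tau (hT : 0 < T) : ClSlow T S (fun _ _ τ => τ) := by
  refine Cl.of_pd Sm.tau ?_ ?_
  · intro R
    refine ⟨1, 1, zero_le_one, fun x t τ _ _ _ => by simp⟩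
  · intro i
    cases i
    · have : MCH.pd T Dir.x (fun _ _ τ => τ) = fun _ _ _ => 0 := by
        funext x t τ; simp [MCH.pd, dX]
      rw [this]; exact ClSlow.const hT 0
    · have : MCH.pd T Dir.t (fun _ _ τ => τ) = fun _ _ _ => 0 := by
        funext x t τ; simp [MCH.pd, dT]
      rw [this]; exact ClSlow.const hT 0
    · have : MCH.pd T Dir.s (fun _ _ τ => τ) = fun _ _ _ => 1 := by
        funext x t τ; simp [MCH.pd, dTau]
      rw [this]; exact ClSlow.const hT 1

lemma ClRap.const_mul (hT : 0 < T) (c : ℝ) (hf : ClRap T S f) :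
    ClRap T S (fun x t τ => c * f x t τ) := by
  refine (hf.mul_slow hT (ClSlow.const hT c)).congr Rap.respects fun x t _ τ => ?_
  simp [mul_comm]

lemma ClRap.neg (hT : 0 < T) (hf : ClRap T S f) : ClRap T S (-f) :=
  (hf.const_mul hT (-1)).congr Rap.respects fun x t _ τ => by simp

lemma ClRap.sub (hT : 0 < T) (hf : ClRap T S f) (hg : ClRap T S g) : ClRap T S (f - g) := by
  rw [sub_eq_add_neg]; exact hf.add hT (hg.neg hT)

/-! ### Uniform limits -/

lemma Rap.tendsto_of_bound {l : Filter ℝ} (hl : Tendsto (fun τ : ℝ => |τ|) l atTop)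
    (hS : ∀ᶠ τ in l, ∀ x t, S x t τ) (hf : Rap T S f) (n : ℕ) {K : Set (ℝ × ℝ)}
    (hK : IsCompact K) (hKT : K ⊆ strip T) :
    TendstoUniformlyOn (fun (τ : ℝ) (z : ℝ × ℝ) => τ ^ n * f z.1 z.2 τ) (fun _ => 0) l K := by
  obtain ⟨R, hR⟩ := hK.exists_bound_of_continuousOn (f := fun z : ℝ × ℝ => z.1) (by fun_prop)
  -- One power more than required: the surplus factor `1 + |τ|` turns a bound into convergence to
  -- zero.
  obtain ⟨C, h0, hC⟩ := hf (n + 1) R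
  rw [Metric.tendstoUniformlyOn_iff]
  intro e he
  filter_upwards [hS, hl.eventually_gt_atTop (C / e)] with τ hτ hτ' z hz
  have h1 := hC z.1 z.2 τ (hR z hz) (hKT hz).2 (hτ _ _)
  rw [dist_comm, Real.dist_eq, sub_zero, abs_mul, abs_pow]
  have h2 : |τ| ^ n * |f z.1 z.2 τ| * (1 + |τ|) ≤ C := by
    calc |τ| ^ n * |f z.1 z.2 τ| * (1 + |τ|)
        ≤ (1 + |τ|) ^ n * |f z.1 z.2 τ| * (1 + |τ|) := by
          gcongr; linarith
      _ = (1 + |τ|) ^ (n + 1) * |f z.1 z.2 τ| := by rw [pow_succ]; ring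
      _ ≤ C := h1
  have h3 : C < e * (1 + |τ|) := by
    rw [div_lt_iff₀ he] at hτ'; nlinarith
  have h4 : 0 < 1 + |τ| := by positivity
  by_contra! hcon
  nlinarith

/-- For large `|τ|` the convergence gives `|τ|^n |f| < 1`, and `1 + |τ| ≤ 2 |τ|`; the remaining
values of `τ` form a compact range on which `f` is bounded. -/
lemma Rap.of_tendsto {l : Filter ℝ} (hf : Sm T f)
    (hS : ∀ U ∈ l, ∃ r : ℝ, ∀ x t τ, S x t τ → r ≤ |τ| → τ ∈ U)
    (h : ∀ (n : ℕ) (R : ℝ), TendstoUniformlyOn (fun (τ : ℝ) (z : ℝ × ℝ) => τ ^ n * f z.1 z.2 τ)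
      (fun _ => 0) l (Icc (-R) R ×ˢ Icc 0 T)) : Rap T S f := by
  intro n R
  have h1 := Metric.tendstoUniformlyOn_iff.1 (h n R) 1 one_pos
  obtain ⟨r, hr⟩ := hS _ h1
  obtain ⟨C, h0, hC⟩ := hf.bounded R (max r 1)
  refine ⟨2 ^ n + (1 + max r 1) ^ n * C, by positivity, fun x t τ hx ht hs => ?_⟩
  rcases le_total (max r 1) |τ| with hτ | hτ
  · have h2 := hr x t τ hs ((le_max_left _ _).trans hτ) (x, t) ⟨abs_le.1 hx, ht⟩
    rw [dist_comm, Real.dist_eq, sub_zero, abs_mul, abs_pow] at h2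
    have h3 : (1:ℝ) ≤ |τ| := (le_max_right _ _).trans hτ
    have h4 : (1 + |τ|) ^ n * |f x t τ| ≤ 2 ^ n * (|τ| ^ n * |f x t τ|) := by
      rw [← mul_assoc, ← mul_pow]
      gcongr; linarith
    have : (0:ℝ) ≤ (1 + max r 1) ^ n * C := by positivity
    have h5 : (2:ℝ) ^ n * (|τ| ^ n * |f x t τ|) ≤ 2 ^ n * 1 := by
      gcongr
    linarith
  · have h2 := hC x t τ hx ht hτ
    have : (0:ℝ) ≤ 2 ^ n := by positivity
    have h3 : (1 + |τ|) ^ n * |f x t τ| ≤ (1 + max r 1) ^ n * C := by gcongr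
    linarith

lemma pos_of_atTop : ∀ U ∈ (atTop : Filter ℝ), ∃ r : ℝ, ∀ x t τ, Pos x t τ → r ≤ |τ| → τ ∈ U := by
  intro U hU
  obtain ⟨r, hr⟩ := mem_atTop_sets.1 hU
  exact ⟨r, fun x t τ h h' => hr τ (by rwa [abs_of_nonneg h] at h')⟩

lemma neg_of_atBot : ∀ U ∈ (atBot : Filter ℝ), ∃ r : ℝ, ∀ x t τ, Neg x t τ → r ≤ |τ| → τ ∈ U := by
  intro U hU
  obtain ⟨r, hr⟩ := mem_atBot_sets.1 hU
  exact ⟨-r, fun x t τ h h' => hr τ (by rw [abs_of_nonpos h] at h'; linarith)⟩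

lemma Sm.iterate (hT : 0 < T) (hf : Sm T f) (i : Dir) (p : ℕ) : Sm T ((MCH.pd T i)^[p] f) := by
  induction p with
  | zero => exact hf
  | succ p ih => simp only [Function.iterate_succ_apply']; exact ih.pd hT i

lemma Der.iterate (h : Der T f g) (i : Dir) (p : ℕ) : Der T f ((pd T i)^[p] g) := by
  induction p with
  | zero => exact h
  | succ p ih => simp only [Function.iterate_succ_apply']; exact ih.step i

lemma Sm.pd_iterate_comm (hT : 0 < T) (hf : Sm T f) (i j : Dir) (p : ℕ) :
    EqD T (MCH.pd T i ((MCH.pd T j)^[p] f)) ((MCH.pd T j)^[p] (MCH.pd T i f)) := by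
  induction p with
  | zero => exact EqD.refl _
  | succ p ih =>
    simp only [Function.iterate_succ_apply']
    exact ((hf.iterate hT j p).pd_comm hT i j).trans (ih.pd j)

/-- A function of `(t, τ)` as a function of `(x, t, τ)`. -/
def emb (g : ℝ → ℝ → ℝ) : ℝ → ℝ → ℝ → ℝ := fun _ t τ => g t τ

lemma emb_iterate (g : ℝ → ℝ → ℝ) (p q : ℕ) :
    emb ((gt T)^[p] (gtau^[q] g)) = (pd T Dir.t)^[p] ((pd T Dir.s)^[q] (emb g)) := by
  have hq : emb (gtau^[q] g) = (pd T Dir.s)^[q] (emb g) := by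
    induction q with
    | zero => rfl
    | succ q ih => rw [Function.iterate_succ_apply', Function.iterate_succ_apply']; exact congrArg (pd T Dir.s) ih
  rw [← hq]
  induction p with
  | zero => rfl
  | succ p ih => rw [Function.iterate_succ_apply', Function.iterate_succ_apply']; exact congrArg (pd T Dir.t) ih

/-- A derivative in `x` kills a function of `(t, τ)`. Otherwise the derivatives commute and can be
sorted into the order in which the definition of the space takes them. -/
lemma der_emb (hT : 0 < T) {g : ℝ → ℝ → ℝ} (hg : Sm T (emb g)) {k : ℝ → ℝ → ℝ → ℝ}
    (h : Der T (emb g) k) :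
    EqD T k (fun _ _ _ => 0) ∨ ∃ p q : ℕ, EqD T k (emb ((gt T)^[p] (gtau^[q] g))) := by
  induction h with
  | refl => exact Or.inr ⟨0, 0, EqD.refl _⟩
  | step i _ ih =>
    rcases ih with ih | ⟨p, q, ih⟩
    · left
      have := ih.pd i
      rwa [pd_const] at this
    · cases i
      · left
        refine (ih.pd Dir.x).trans fun x t _ τ => ?_
        simp [pd, dX, emb]
      · right
        refine ⟨p + 1, q, (ih.pd Dir.t).trans ?_⟩
        rw [Function.iterate_succ_apply']
        exact EqD.refl _
      · right
        refine ⟨p, q + 1, (ih.pd Dir.s).trans ?_⟩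
        rw [emb_iterate, emb_iterate, Function.iterate_succ_apply']
        exact (hg.iterate hT _ q).pd_iterate_comm hT _ _ p

lemma TendstoUniformlyOn.emb_prod {l : Filter ℝ} {h : ℝ → ℝ → ℝ}
    (H : TendstoUniformlyOn (fun (τ : ℝ) (t : ℝ) => h t τ) (fun _ => 0) l (Icc 0 T)) (A : Set ℝ) :
    TendstoUniformlyOn (fun (τ : ℝ) (z : ℝ × ℝ) => h z.2 τ) (fun _ => 0) l (A ×ˢ Icc 0 T) := by
  rw [Metric.tendstoUniformlyOn_iff] at H ⊢
  intro e he
  filter_upwards [H e he] with τ hτ z hz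
  exact hτ z.2 hz.2

lemma ClRap.of_tendsto_emb (hT : 0 < T) {l : Filter ℝ} {g : ℝ → ℝ → ℝ} (hg : Sm T (emb g))
    (hS : ∀ U ∈ l, ∃ r : ℝ, ∀ x t τ, S x t τ → r ≤ |τ| → τ ∈ U)
    (h : ∀ n p q : ℕ, TendstoUniformlyOn
      (fun (τ : ℝ) (t : ℝ) => τ ^ n * (gt T)^[p] (gtau^[q] g) t τ) (fun _ => 0) l (Icc 0 T)) :
    ClRap T S (emb g) := by
  refine ⟨hg, fun k hk => ?_⟩
  rcases der_emb hT hg hk with h0 | ⟨p, q, he⟩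
  · exact Rap.respects _ _ h0.symm ClRap.zero.base
  · refine Rap.respects _ _ he.symm (Rap.of_tendsto ?_ hS fun n R => ?_)
    · exact (hk.sm hT hg).congr he
    · exact TendstoUniformlyOn.emb_prod (h := fun t τ => τ ^ n * (gt T)^[p] (gtau^[q] g) t τ)
        (h n p q) _

lemma InGt.pos (hT : 0 < T) {g : ℝ → ℝ → ℝ} (h : InGt T g) : ClRap T Pos (emb g) :=
  ClRap.of_tendsto_emb hT (Sm.of_ts h.1) pos_of_atTop h.2.1

/-- The limit function in the definition of the space is not specified; the pointwise limits
identify it with the constant `c`. -/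
lemma InGt.neg (hT : 0 < T) {g : ℝ → ℝ → ℝ} (h : InGt T g) {c : ℝ}
    (hc : ∀ t ∈ Icc 0 T, Tendsto (fun τ => g t τ) atBot (𝓝 c)) :
    ClRap T Neg (emb fun t τ => g t τ - c) := by
  obtain ⟨hs, -, gm, hgm, H⟩ := h
  have hgm' : ∀ t ∈ Icc 0 T, gm t = c := by
    intro t ht
    have h1 := (H 0 0 0).tendsto_at ht
    simp only [pow_zero, one_mul, Function.iterate_zero, id] at h1
    have h2 := (hc t ht).sub h1
    simpa [tendsto_const_nhds_iff] using h2
  have hsm : Sm T (emb fun t s => g t s - gm t) := (Sm.of_ts hs).sub (Sm.of_t hgm)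
  refine (ClRap.of_tendsto_emb hT hsm neg_of_atBot H).congr Rap.respects fun x t ht τ => ?_
  simp [emb, hgm' t ht]

lemma InGt0.all (hT : 0 < T) {g : ℝ → ℝ → ℝ} (h : InGt0 T g) : ClRap T All (emb g) := by
  refine (h.1.pos hT).pos_neg ?_
  simpa using h.1.neg hT (c := 0) (fun t ht => h.2.tendsto_at ht)

lemma TendstoUniformlyOn.of_emb {l : Filter ℝ} {h : ℝ → ℝ → ℝ}
    (H : ∀ K : Set (ℝ × ℝ), IsCompact K → K ⊆ strip T →
      TendstoUniformlyOn (fun (τ : ℝ) (z : ℝ × ℝ) => h z.2 τ) (fun _ => 0) l K) :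
    TendstoUniformlyOn (fun (τ : ℝ) (t : ℝ) => h t τ) (fun _ => 0) l (Icc 0 T) := by
  have := H ({0} ×ˢ Icc 0 T) (isCompact_singleton.prod isCompact_Icc)
    (prod_mono (subset_univ _) subset_rfl)
  rw [Metric.tendstoUniformlyOn_iff] at this ⊢
  intro e he
  filter_upwards [this e he] with τ hτ t ht
  exact hτ (0, t) ⟨rfl, ht⟩

lemma der_emb_iterate (g : ℝ → ℝ → ℝ) (p q : ℕ) : Der T (emb g) (emb ((gt T)^[p] (gtau^[q] g))) := by
  rw [emb_iterate]
  exact (Der.refl.iterate _ q).iterate _ p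

lemma eventually_pos : ∀ᶠ τ in atTop, ∀ x t, Pos x t τ := by
  filter_upwards [eventually_ge_atTop 0] with τ hτ x t using hτ

lemma eventually_neg : ∀ᶠ τ in atBot, ∀ x t, Neg x t τ := by
  filter_upwards [eventually_le_atBot 0] with τ hτ x t using hτ

lemma inGt_of_rap {g : ℝ → ℝ → ℝ} {c : ℝ} (h₁ : ClRap T Pos (emb g))
    (h₂ : ClRap T Neg (emb fun t τ => g t τ - c)) : InGt T g := by
  refine ⟨h₁.1.to_ts 0, fun n p q => ?_, fun _ => c, contDiffOn_const, fun n p q => ?_⟩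
  · exact TendstoUniformlyOn.of_emb (h := fun t τ => τ ^ n * (gt T)^[p] (gtau^[q] g) t τ)
      fun K hK hKT => (h₁.2 _ (der_emb_iterate g p q)).tendsto_of_bound tendsto_abs_atTop_atTop
        eventually_pos n hK hKT
  · exact TendstoUniformlyOn.of_emb
      (h := fun t τ => τ ^ n * (gt T)^[p] (gtau^[q] (fun t s => g t s - c)) t τ)
      fun K hK hKT => (h₂.2 _ (der_emb_iterate _ p q)).tendsto_of_bound tendsto_abs_atBot_atTop
        eventually_neg n hK hKT

lemma inGt0_of_rap {g : ℝ → ℝ → ℝ} (h : ClRap T All (emb g)) : InGt0 T g := by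
  refine ⟨inGt_of_rap (c := 0) h.of_all (by simpa using h.of_all), ?_⟩
  refine TendstoUniformlyOn.of_emb fun K hK hKT => ?_
  simpa [emb] using (h.base.tendsto_of_bound tendsto_abs_atBot_atTop
    (Eventually.of_forall fun _ _ _ => trivial) 0 hK hKT)

end MCH

namespace MCH

/-! ### Functions with limits as `τ → ±∞` -/

variable {T : ℝ} {f g fm gm fp gp : ℝ → ℝ → ℝ → ℝ}

/-- Independence of `τ`, and smoothness. -/
def XT (T : ℝ) (f : ℝ → ℝ → ℝ → ℝ) : Prop :=
  ∃ u : ℝ → ℝ → ℝ, Smooth2 T u ∧ EqD T f (fun x t _ => u x t)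

lemma XT.slow (hT : 0 < T) {S : ℝ → ℝ → ℝ → Prop} (h : XT T f) : ClSlow T S f := by
  obtain ⟨u, hu, he⟩ := h
  exact (ClSlow.of_xt hT hu).congr Slow.respects he.symm

lemma XT.congr (h : XT T f) (he : EqD T f g) : XT T g := by
  obtain ⟨u, hu, he'⟩ := h
  exact ⟨u, hu, he.symm.trans he'⟩

lemma XT.add (hf : XT T f) (hg : XT T g) : XT T (f + g) := by
  obtain ⟨u, hu, he⟩ := hf
  obtain ⟨v, hv, he'⟩ := hg
  exact ⟨_, ((Sm.of_xt hu).add (Sm.of_xt hv)).to_xt 0, he.add he'⟩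

lemma XT.mul (hf : XT T f) (hg : XT T g) : XT T (f * g) := by
  obtain ⟨u, hu, he⟩ := hf
  obtain ⟨v, hv, he'⟩ := hg
  exact ⟨_, ((Sm.of_xt hu).mul (Sm.of_xt hv)).to_xt 0, he.mul he'⟩

lemma XT.of_xt {u : ℝ → ℝ → ℝ} (hu : Smooth2 T u) : XT T (fun x t _ => u x t) :=
  ⟨u, hu, EqD.refl _⟩

lemma XT.zero : XT T (0 : ℝ → ℝ → ℝ → ℝ) := XT.of_xt (u := fun _ _ => 0) contDiffOn_const

lemma XT.pd (hT : 0 < T) (hf : XT T f) (i : Dir) : XT T (pd T i f) := by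
  obtain ⟨u, hu, he⟩ := hf
  refine ⟨_, ((Sm.of_xt hu).pd hT i).to_xt 0, (he.pd i).trans ?_⟩
  intro x t ht τ
  cases i
  · rfl
  · rfl
  · simp [MCH.pd, dTau]

/-- `f` approaches `fm` as `τ → -∞` and `fp` as `τ → +∞`, rapidly and with all derivatives. -/
structure Lim (T : ℝ) (f fm fp : ℝ → ℝ → ℝ → ℝ) : Prop where
  xtm : XT T fm
  xtp : XT T fp
  neg : ClRap T Neg (f - fm)
  pos : ClRap T Pos (f - fp)

lemma Lim.slow (hT : 0 < T) (h : Lim T f fm fp) : ClSlow T All f := by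
  refine ClSlow.pos_neg ?_ ?_
  · simpa using h.pos.slow.add hT (h.xtp.slow hT)
  · simpa using h.neg.slow.add hT (h.xtm.slow hT)

lemma Lim.sm (hT : 0 < T) (h : Lim T f fm fp) : Sm T f := (h.slow hT).1

lemma Lim.add (hT : 0 < T) (h : Lim T f fm fp) (h' : Lim T g gm gp) :
    Lim T (f + g) (fm + gm) (fp + gp) where
  xtm := h.xtm.add h'.xtm
  xtp := h.xtp.add h'.xtp
  neg := by rw [add_sub_add_comm]; exact h.neg.add hT h'.neg
  pos := by rw [add_sub_add_comm]; exact h.pos.add hT h'.pos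

/-- From `f g - f₋ g₋ = (f - f₋) g + (g - g₋) f₋`, where each summand is a rapidly decreasing factor
times a slowly growing one. -/
lemma Lim.mul (hT : 0 < T) (h : Lim T f fm fp) (h' : Lim T g gm gp) :
    Lim T (f * g) (fm * gm) (fp * gp) where
  xtm := h.xtm.mul h'.xtm
  xtp := h.xtp.mul h'.xtp
  neg := by
    have := (h.neg.mul_slow hT (h'.slow hT).of_all).add hT (h'.neg.mul_slow hT (h.xtm.slow hT))
    convert this using 1; ring
  pos := by
    have := (h.pos.mul_slow hT (h'.slow hT).of_all).add hT (h'.pos.mul_slow hT (h.xtp.slow hT))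
    convert this using 1; ring

lemma pd_sub (hT : 0 < T) (hf : Sm T f) (hg : Sm T g) (i : Dir) :
    EqD T (pd T i (f - g)) (pd T i f - pd T i g) := by
  intro x t ht τ
  have := pd_add hT (hf.sub hg) hg i x t ht τ
  simp only [sub_add_cancel, Pi.add_apply, Pi.sub_apply] at this ⊢
  linarith

lemma XT.sm (h : XT T f) : Sm T f := by
  obtain ⟨u, hu, he⟩ := h
  exact (Sm.of_xt hu).congr he.symm

lemma Lim.pd (hT : 0 < T) (h : Lim T f fm fp) (i : Dir) :
    Lim T (pd T i f) (pd T i fm) (pd T i fp) where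
  xtm := h.xtm.pd hT i
  xtp := h.xtp.pd hT i
  neg := (h.neg.pd hT i).congr Rap.respects (pd_sub hT (h.sm hT) h.xtm.sm i)
  pos := (h.pos.pd hT i).congr Rap.respects (pd_sub hT (h.sm hT) h.xtp.sm i)

lemma EqD.sub {f' g' : ℝ → ℝ → ℝ → ℝ} (h : EqD T f f') (h' : EqD T g g') :
    EqD T (f - g) (f' - g') := fun x t ht τ => by
  simp only [Pi.sub_apply, h x t ht τ, h' x t ht τ]

lemma Lim.congr (h : Lim T f fm fp) (e : EqD T f g) (em : EqD T fm gm) (ep : EqD T fp gp) :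
    Lim T g gm gp where
  xtm := h.xtm.congr em
  xtp := h.xtp.congr ep
  neg := h.neg.congr Rap.respects (e.sub em)
  pos := h.pos.congr Rap.respects (e.sub ep)

lemma Lim.of_xt {u : ℝ → ℝ → ℝ} (hu : Smooth2 T u) :
    Lim T (fun x t _ => u x t) (fun x t _ => u x t) (fun x t _ => u x t) where
  xtm := .of_xt hu
  xtp := .of_xt hu
  neg := by rw [sub_self]; exact ClRap.zero
  pos := by rw [sub_self]; exact ClRap.zero

lemma Lim.of_rap (h : ClRap T All f) : Lim T f 0 0 where
  xtm := .zero
  xtp := .zero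
  neg := by rw [sub_zero]; exact h.of_all
  pos := by rw [sub_zero]; exact h.of_all

lemma Lim.inG (hT : 0 < T) (h : Lim T f fm 0) : InG T f := by
  refine ⟨h.sm hT, fun n p q r K hK hKT => ?_, ?_⟩
  · have hd : Der T f (dX^[p] ((dT T)^[q] (dTau^[r] f))) :=
      ((Der.refl.iterate Dir.s r).iterate Dir.t q).iterate Dir.x p
    have := h.pos
    rw [sub_zero] at this
    exact (this.2 _ hd).tendsto_of_bound tendsto_abs_atTop_atTop eventually_pos n hK hKT
  · obtain ⟨u, hu, he⟩ := h.xtm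
    refine ⟨u, hu, fun n p q r K hK hKT => ?_⟩
    have h' : ClRap T Neg (fun x t s => f x t s - u x t) :=
      h.neg.congr Rap.respects ((EqD.refl f).sub he)
    exact (h'.2 _ (((Der.refl.iterate Dir.s r).iterate Dir.t q).iterate Dir.x p)).tendsto_of_bound
      tendsto_abs_atBot_atTop eventually_neg n hK hKT

/-! ### Families polynomial in `ε` -/

/-- Families of functions which are polynomials in `ε` with coefficients that have limits as
`τ → ±∞`. -/
inductive PL (T : ℝ) : (ℝ → ℝ → ℝ → ℝ → ℝ) → (ℝ → ℝ → ℝ → ℝ → ℝ) → (ℝ → ℝ → ℝ → ℝ → ℝ) → Prop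
  | coef {f fm fp : ℝ → ℝ → ℝ → ℝ} : Lim T f fm fp → PL T (fun _ => f) (fun _ => fm) (fun _ => fp)
  | add {f fm fp g gm gp : ℝ → ℝ → ℝ → ℝ → ℝ} : PL T f fm fp → PL T g gm gp →
      PL T (f + g) (fm + gm) (fp + gp)
  | eps {f fm fp : ℝ → ℝ → ℝ → ℝ → ℝ} : PL T f fm fp →
      PL T (fun ε => ε • f ε) (fun ε => ε • fm ε) (fun ε => ε • fp ε)
  | congr {f fm fp g gm gp : ℝ → ℝ → ℝ → ℝ → ℝ} : PL T f fm fp → (∀ ε, EqD T (f ε) (g ε)) →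
      (∀ ε, EqD T (fm ε) (gm ε)) → (∀ ε, EqD T (fp ε) (gp ε)) → PL T g gm gp

section PL

variable {f fm fp g gm gp : ℝ → ℝ → ℝ → ℝ → ℝ}

lemma EqD.smul {f g : ℝ → ℝ → ℝ → ℝ} (h : EqD T f g) (c : ℝ) : EqD T (c • f) (c • g) :=
  fun x t ht τ => by simp only [Pi.smul_apply, h x t ht τ]

lemma Lim.mul_pl (hT : 0 < T) {h hm hp : ℝ → ℝ → ℝ → ℝ} (hh : Lim T h hm hp)
    (H : PL T f fm fp) :
    PL T (fun ε => h * f ε) (fun ε => hm * fm ε) (fun ε => hp * fp ε) := by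
  induction H with
  | coef h' => exact .coef (hh.mul hT h')
  | add _ _ h₁ h₂ =>
    refine (h₁.add h₂).congr ?_ ?_ ?_ <;> intro ε x t _ τ <;> simp [mul_add]
  | eps _ ih =>
    refine ih.eps.congr ?_ ?_ ?_ <;> intro ε x t _ τ <;> simp [mul_left_comm]
  | congr _ e₁ e₂ e₃ ih =>
    exact ih.congr (fun ε => (EqD.refl _).mul (e₁ ε)) (fun ε => (EqD.refl _).mul (e₂ ε))
      (fun ε => (EqD.refl _).mul (e₃ ε))

lemma PL.mul (hT : 0 < T) (H : PL T f fm fp) (H' : PL T g gm gp) :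
    PL T (f * g) (fm * gm) (fp * gp) := by
  induction H with
  | coef h => exact h.mul_pl hT H'
  | add _ _ h₁ h₂ =>
    refine (h₁.add h₂).congr ?_ ?_ ?_ <;> intro ε x t _ τ <;> simp [add_mul]
  | eps _ ih =>
    refine ih.eps.congr ?_ ?_ ?_ <;> intro ε x t _ τ <;> simp [mul_assoc]
  | congr _ e₁ e₂ e₃ ih =>
    exact ih.congr (fun ε => (e₁ ε).mul (EqD.refl _)) (fun ε => (e₂ ε).mul (EqD.refl _))
      (fun ε => (e₃ ε).mul (EqD.refl _))

lemma Sm.smul {f : ℝ → ℝ → ℝ → ℝ} (h : Sm T f) (c : ℝ) : Sm T (c • f) := ContDiffOn.const_smul c h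

lemma PL.sm (hT : 0 < T) (H : PL T f fm fp) (ε : ℝ) :
    Sm T (f ε) ∧ Sm T (fm ε) ∧ Sm T (fp ε) := by
  induction H with
  | coef h => exact ⟨h.sm hT, h.xtm.sm, h.xtp.sm⟩
  | add _ _ h₁ h₂ => exact ⟨h₁.1.add h₂.1, h₁.2.1.add h₂.2.1, h₁.2.2.add h₂.2.2⟩
  | eps _ ih => exact ⟨ih.1.smul ε, ih.2.1.smul ε, ih.2.2.smul ε⟩
  | congr _ e₁ e₂ e₃ ih => exact ⟨ih.1.congr (e₁ ε), ih.2.1.congr (e₂ ε), ih.2.2.congr (e₃ ε)⟩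

lemma pd_smul (f : ℝ → ℝ → ℝ → ℝ) (c : ℝ) (i : Dir) : pd T i (c • f) = c • pd T i f := by
  cases i <;> funext x t τ <;>
    simp [pd, dX, dT, dTau, derivWithin_const_mul_field]

lemma PL.pd (hT : 0 < T) (H : PL T f fm fp) (i : Dir) :
    PL T (fun ε => pd T i (f ε)) (fun ε => pd T i (fm ε)) (fun ε => pd T i (fp ε)) := by
  induction H with
  | coef h => exact .coef (h.pd hT i)
  | add h h' h₁ h₂ =>
    exact (h₁.add h₂).congr (fun ε => (pd_add hT (h.sm hT ε).1 (h'.sm hT ε).1 i).symm)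
      (fun ε => (pd_add hT (h.sm hT ε).2.1 (h'.sm hT ε).2.1 i).symm)
      (fun ε => (pd_add hT (h.sm hT ε).2.2 (h'.sm hT ε).2.2 i).symm)
  | eps _ ih => simp only [pd_smul]; exact ih.eps
  | congr _ e₁ e₂ e₃ ih =>
    exact ih.congr (fun ε => (e₁ ε).pd i) (fun ε => (e₂ ε).pd i) (fun ε => (e₃ ε).pd i)

lemma PL.zero : PL T 0 0 0 := .coef (Lim.of_rap ClRap.zero)

lemma PL.const (c : ℝ) : PL T (fun _ _ _ _ => c) (fun _ _ _ _ => c) (fun _ _ _ _ => c) :=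
  .coef (Lim.of_xt (u := fun _ _ => c) contDiffOn_const)

lemma PL.const_mul (hT : 0 < T) (c : ℝ) (H : PL T f fm fp) :
    PL T (fun ε => c • f ε) (fun ε => c • fm ε) (fun ε => c • fp ε) :=
  (PL.const c).mul hT H

lemma PL.sub (hT : 0 < T) (H : PL T f fm fp) (H' : PL T g gm gp) :
    PL T (f - g) (fm - gm) (fp - gp) := by
  refine (H.add (H'.const_mul hT (-1))).congr ?_ ?_ ?_ <;> intro ε x t _ τ <;>
    simp [sub_eq_add_neg]

lemma PL.pow_eps (H : PL T f fm fp) (k : ℕ) :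
    PL T (fun ε => ε ^ k • f ε) (fun ε => ε ^ k • fm ε) (fun ε => ε ^ k • fp ε) := by
  induction k with
  | zero => simpa using H
  | succ k ih =>
    refine ih.eps.congr ?_ ?_ ?_ <;> intro ε x t _ τ <;> simp [pow_succ] <;> ring

lemma PL.sum {ι : Type*} (s : Finset ι) {F Fm Fp : ι → ℝ → ℝ → ℝ → ℝ → ℝ}
    (h : ∀ i ∈ s, PL T (F i) (Fm i) (Fp i)) :
    PL T (∑ i ∈ s, F i) (∑ i ∈ s, Fm i) (∑ i ∈ s, Fp i) := by
  classical
  induction s using Finset.induction_on with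
  | empty => simpa using PL.zero
  | insert i s hi ih =>
    rw [Finset.sum_insert hi, Finset.sum_insert hi, Finset.sum_insert hi]
    exact (h i (Finset.mem_insert_self i s)).add
      (ih fun j hj => h j (Finset.mem_insert_of_mem hj))

/-- The sum `∑_{k < M} ε^k c_k`. -/
def polySum (M : ℕ) (c : ℕ → ℝ → ℝ → ℝ → ℝ) (ε : ℝ) : ℝ → ℝ → ℝ → ℝ :=
  fun x t τ => ∑ k ∈ Finset.range M, ε ^ k * c k x t τ

lemma polySum_mono {M M' : ℕ} {c : ℕ → ℝ → ℝ → ℝ → ℝ} (h : ∀ k, M ≤ k → c k = 0) (hM : M ≤ M')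
    (ε : ℝ) : polySum M' c ε = polySum M c ε := by
  funext x t τ
  symm
  refine Finset.sum_subset (Finset.range_mono hM) fun k _ hk => ?_
  rw [h k (by simpa using hk)]
  simp

lemma polySum_add (M : ℕ) (c c' : ℕ → ℝ → ℝ → ℝ → ℝ) (ε : ℝ) :
    polySum M (c + c') ε = polySum M c ε + polySum M c' ε := by
  funext x t τ
  simp [polySum, mul_add, Finset.sum_add_distrib]

lemma polySum_shift (M : ℕ) (c : ℕ → ℝ → ℝ → ℝ → ℝ) (ε : ℝ) :
    polySum (M + 1) (fun k => Nat.casesOn k 0 c) ε = ε • polySum M c ε := by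
  funext x t τ
  simp only [polySum, Finset.sum_range_succ', Pi.smul_apply, smul_eq_mul, Finset.mul_sum]
  simp [pow_succ, mul_comm, mul_left_comm]

/-- The point is that the coefficients of the limits are the limits of the coefficients, so that
vanishing of a limit family to some order in `ε` passes to the individual coefficients. The
sequences are exactly zero from `M` on, which allows shifts of the index without boundary cases. -/
lemma PL.exists_coeff (hT : 0 < T) (H : PL T f fm fp) :
    ∃ (M : ℕ) (c cm cp : ℕ → ℝ → ℝ → ℝ → ℝ), (∀ k, Lim T (c k) (cm k) (cp k)) ∧
      (∀ k, M ≤ k → c k = 0) ∧ (∀ k, M ≤ k → cm k = 0) ∧ (∀ k, M ≤ k → cp k = 0) ∧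
      (∀ ε, EqD T (f ε) (polySum M c ε)) ∧ (∀ ε, EqD T (fm ε) (polySum M cm ε)) ∧
      ∀ ε, EqD T (fp ε) (polySum M cp ε) := by
  induction H with
  | @coef f fm fp h =>
    refine ⟨1, fun k => Nat.casesOn k f fun _ => 0, fun k => Nat.casesOn k fm fun _ => 0,
      fun k => Nat.casesOn k fp fun _ => 0, fun k => ?_, fun k hk => ?_, fun k hk => ?_,
      fun k hk => ?_, ?_, ?_, ?_⟩
    · cases k
      · exact h
      · exact Lim.of_rap ClRap.zero
    iterate 3 (focus (rcases k with _ | k; exacts [absurd hk (by omega), rfl]))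
    all_goals intro ε x t _ τ; simp [polySum]
  | add _ _ h₁ h₂ =>
    obtain ⟨M, c, cm, cp, hL, z, zm, zp, e, em, ep⟩ := h₁
    obtain ⟨M', c', cm', cp', hL', z', zm', zp', e', em', ep'⟩ := h₂
    have key : ∀ {a a' : ℕ → ℝ → ℝ → ℝ → ℝ}, (∀ k, M ≤ k → a k = 0) → (∀ k, M' ≤ k → a' k = 0) →
        ∀ ε, polySum (max M M') (a + a') ε = polySum M a ε + polySum M' a' ε := by
      intro a a' ha ha' ε
      rw [polySum_add, polySum_mono ha (le_max_left _ _), polySum_mono ha' (le_max_right _ _)]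
    refine ⟨max M M', c + c', cm + cm', cp + cp', fun k => (hL k).add hT (hL' k), ?_, ?_, ?_,
      fun ε => ?_, fun ε => ?_, fun ε => ?_⟩
    · intro k hk; simp [z k (by omega), z' k (by omega)]
    · intro k hk; simp [zm k (by omega), zm' k (by omega)]
    · intro k hk; simp [zp k (by omega), zp' k (by omega)]
    · rw [key z z']; exact (e ε).add (e' ε)
    · rw [key zm zm']; exact (em ε).add (em' ε)
    · rw [key zp zp']; exact (ep ε).add (ep' ε)
  | eps _ ih =>
    obtain ⟨M, c, cm, cp, hL, z, zm, zp, e, em, ep⟩ := ih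
    refine ⟨M + 1, fun k => Nat.casesOn k 0 c, fun k => Nat.casesOn k 0 cm,
      fun k => Nat.casesOn k 0 cp, fun k => ?_, ?_, ?_, ?_, fun ε => ?_, fun ε => ?_, fun ε => ?_⟩
    · cases k
      · exact Lim.of_rap ClRap.zero
      · exact hL _
    · rintro (_ | k) hk
      · omega
      · exact z k (by omega)
    · rintro (_ | k) hk
      · omega
      · exact zm k (by omega)
    · rintro (_ | k) hk
      · omega
      · exact zp k (by omega)
    · rw [polySum_shift]; exact (e ε).smul ε
    · rw [polySum_shift]; exact (em ε).smul ε
    · rw [polySum_shift]; exact (ep ε).smul ε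
  | congr _ e₁ e₂ e₃ ih =>
    obtain ⟨M, c, cm, cp, hL, z, zm, zp, e, em, ep⟩ := ih
    exact ⟨M, c, cm, cp, hL, z, zm, zp, fun ε => (e₁ ε).symm.trans (e ε),
      fun ε => (e₂ ε).symm.trans (em ε), fun ε => (e₃ ε).symm.trans (ep ε)⟩

end PL

end MCH

namespace MCH

/-! ### Expansion along the lines `x = φ(t) + ε τ` -/

variable {T : ℝ} {f g : ℝ → ℝ → ℝ → ℝ} {φ : ℝ → ℝ}

/-- The coefficients of the derivative in `s` of `∑ s^k c_k(φ(t) + s τ, t, τ)`. -/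
noncomputable def lineDer (c : ℕ → ℝ → ℝ → ℝ → ℝ) : ℕ → ℝ → ℝ → ℝ → ℝ :=
  fun k => (fun x t τ => ((k : ℝ) + 1) * c (k + 1) x t τ) + (fun _ _ τ => τ) * dX (c k)

lemma lineDer_zero {c : ℕ → ℝ → ℝ → ℝ → ℝ} {M : ℕ} (h : ∀ k, M ≤ k → c k = 0) :
    ∀ k, M ≤ k → lineDer c k = 0 := by
  intro k hk
  funext x t τ
  simp [lineDer, h k hk, h (k + 1) (by omega), dX]

lemma lineDer_sm (hT : 0 < T) {c : ℕ → ℝ → ℝ → ℝ → ℝ} (h : ∀ k, Sm T (c k)) (k : ℕ) :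
    Sm T (lineDer c k) :=
  ((h (k + 1)).smul _).add (Sm.tau.mul ((h k).pd hT Dir.x))

/-- Each differentiation along the line costs one index, since `c (k + 1)` enters; the factor `τ` is
absorbed by rapid decrease. -/
lemma lineDer_rap (hT : 0 < T) {S : ℝ → ℝ → ℝ → Prop} {c : ℕ → ℝ → ℝ → ℝ → ℝ} {n : ℕ}
    (h : ∀ k ≤ n + 1, ClRap T S (c k)) : ∀ k ≤ n, ClRap T S (lineDer c k) := by
  intro k hk
  refine ((h (k + 1) (by omega)).const_mul hT _).add hT ?_
  rw [mul_comm]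
  exact ClRap.mul_slow hT ((h k (by omega)).pd hT Dir.x) (ClSlow.tau hT)

lemma iterate_lineDer_zero {c : ℕ → ℝ → ℝ → ℝ → ℝ} {M : ℕ} (h : ∀ k, M ≤ k → c k = 0) (j : ℕ) :
    ∀ k, M ≤ k → (lineDer^[j] c) k = 0 := by
  induction j with
  | zero => exact h
  | succ j ih => rw [Function.iterate_succ_apply']; exact lineDer_zero ih

lemma iterate_lineDer_sm (hT : 0 < T) {c : ℕ → ℝ → ℝ → ℝ → ℝ} (h : ∀ k, Sm T (c k)) (j : ℕ) :
    ∀ k, Sm T ((lineDer^[j] c) k) := by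
  induction j with
  | zero => exact h
  | succ j ih => rw [Function.iterate_succ_apply']; exact lineDer_sm hT ih

lemma iterate_lineDer_rap (hT : 0 < T) {S : ℝ → ℝ → ℝ → Prop} {c : ℕ → ℝ → ℝ → ℝ → ℝ} {j n : ℕ}
    (h : ∀ k ≤ n + j, ClRap T S (c k)) : ∀ k ≤ n, ClRap T S ((lineDer^[j] c) k) := by
  induction j generalizing n with
  | zero => exact h
  | succ j ih =>
    rw [Function.iterate_succ_apply']
    exact lineDer_rap hT (ih (n := n + 1) fun k hk => h k (by omega))

lemma iterate_lineDer_congr {c c' : ℕ → ℝ → ℝ → ℝ → ℝ} {j n : ℕ} (h : ∀ k ≤ n + j, c k = c' k) :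
    ∀ k ≤ n, (lineDer^[j] c) k = (lineDer^[j] c') k := by
  induction j generalizing n with
  | zero => exact h
  | succ j ih =>
    rw [Function.iterate_succ_apply', Function.iterate_succ_apply']
    have := ih (n := n + 1) fun k hk => h k (by omega)
    intro k hk
    rw [lineDer, this k (by omega), this (k + 1) (by omega)]; rfl

lemma hasDerivAt_line (hT : 0 < T) {c : ℕ → ℝ → ℝ → ℝ → ℝ} {M : ℕ} (hc : ∀ k, Sm T (c k))
    (h : ∀ k, M ≤ k → c k = 0) {t : ℝ} (ht : t ∈ Icc 0 T) (a τ s : ℝ) :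
    HasDerivAt (fun s => polySum M c s (a + s * τ) t τ)
      (polySum M (lineDer c) s (a + s * τ) t τ) s := by
  have h1 : ∀ k, HasDerivAt (fun s => s ^ k * c k (a + s * τ) t τ)
      (k * s ^ (k - 1) * c k (a + s * τ) t τ + s ^ k * (τ * dX (c k) (a + s * τ) t τ)) s := by
    intro k
    have h2 := ((hc k).hasDeriv_x hT ht (a + s * τ) τ).comp s
      (((hasDerivAt_id s).mul_const τ).const_add a)
    rw [one_mul, mul_comm] at h2
    exact (hasDerivAt_pow k s).mul h2
  have h3 := HasDerivAt.fun_sum (u := Finset.range M) fun k _ => h1 k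
  refine h3.congr_deriv (Eq.symm ?_)
  have h5 : polySum M (lineDer c) s (a + s * τ) t τ =
      ∑ k ∈ Finset.range M, (s ^ k * (((k : ℝ) + 1) * c (k + 1) (a + s * τ) t τ) +
        s ^ k * (τ * dX (c k) (a + s * τ) t τ)) :=
    Finset.sum_congr rfl fun k _ => by simp only [lineDer, Pi.add_apply, Pi.mul_apply, mul_add]
  rw [h5, Finset.sum_add_distrib, Finset.sum_add_distrib]
  congr 1
  -- Shift of the index in `∑ k s^(k-1) c_k`: the term `k = 0` carries the factor zero, and the new
  -- top term vanishes because `c M = 0`.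
  have h4 := Finset.sum_range_succ (fun k : ℕ => (k : ℝ) * s ^ (k - 1) * c k (a + s * τ) t τ) M
  rw [Finset.sum_range_succ', h M le_rfl] at h4
  simp only [Pi.zero_apply, mul_zero, add_zero, Nat.cast_zero, zero_mul, Nat.cast_add,
    Nat.cast_one, Nat.add_sub_cancel] at h4
  rw [← h4]
  refine Finset.sum_congr rfl fun k _ => ?_
  ring

lemma iteratedDeriv_line (hT : 0 < T) {c : ℕ → ℝ → ℝ → ℝ → ℝ} {M : ℕ} (hc : ∀ k, Sm T (c k))
    (h : ∀ k, M ≤ k → c k = 0) {t : ℝ} (ht : t ∈ Icc 0 T) (a τ : ℝ) (j : ℕ) :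
    iteratedDeriv j (fun s => polySum M c s (a + s * τ) t τ) =
      fun s => polySum M (lineDer^[j] c) s (a + s * τ) t τ := by
  induction j with
  | zero => simp
  | succ j ih =>
    rw [iteratedDeriv_succ, ih, Function.iterate_succ_apply']
    funext s
    exact (hasDerivAt_line hT (iterate_lineDer_sm hT hc j) (iterate_lineDer_zero h j) ht a τ s).deriv

lemma polySum_at_zero {M : ℕ} {c : ℕ → ℝ → ℝ → ℝ → ℝ} (h : ∀ k, M ≤ k → c k = 0) :
    polySum M c 0 = c 0 := by
  funext x t τ
  cases M with
  | zero => simp [polySum, h 0 le_rfl]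
  | succ M => simp [polySum, Finset.sum_range_succ']

lemma iteratedDeriv_line_zero (hT : 0 < T) {c : ℕ → ℝ → ℝ → ℝ → ℝ} {M : ℕ} (hc : ∀ k, Sm T (c k))
    (h : ∀ k, M ≤ k → c k = 0) {t : ℝ} (ht : t ∈ Icc 0 T) (a τ : ℝ) (j : ℕ) :
    iteratedDeriv j (fun s => polySum M c s (a + s * τ) t τ) 0 = (lineDer^[j] c) 0 a t τ := by
  rw [iteratedDeriv_line hT hc h ht]
  simp [polySum_at_zero (iterate_lineDer_zero h j)]

lemma contDiff_line (hT : 0 < T) {c : ℕ → ℝ → ℝ → ℝ → ℝ} {M : ℕ} (hc : ∀ k, Sm T (c k))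
    (h : ∀ k, M ≤ k → c k = 0) {t : ℝ} (ht : t ∈ Icc 0 T) (a τ : ℝ) :
    ContDiff ℝ ∞ (fun s => polySum M c s (a + s * τ) t τ) := by
  rw [contDiff_infty]
  intro n
  refine contDiff_of_differentiable_iteratedDeriv fun m _ => ?_
  rw [iteratedDeriv_line hT hc h ht]
  exact fun s => (hasDerivAt_line hT (iterate_lineDer_sm hT hc m) (iterate_lineDer_zero h m) ht a τ
    s).differentiableAt

lemma PL.contDiff_line (hT : 0 < T) {F Fm Fp : ℝ → ℝ → ℝ → ℝ → ℝ} (H : PL T F Fm Fp) {t : ℝ}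
    (ht : t ∈ Icc 0 T) (a τ : ℝ) : ContDiff ℝ ∞ (fun s => F s (a + s * τ) t τ) := by
  obtain ⟨M, c, cm, cp, hL, z, -, -, e, -, -⟩ := H.exists_coeff hT
  have := MCH.contDiff_line hT (fun k => (hL k).sm hT) z ht a τ
  convert this using 2 with s
  exact e s _ t ht τ

/-- Iterated derivatives at `0` of a product with a power. -/
lemma iteratedDeriv_pow_mul {h : ℝ → ℝ} (hh : ContDiff ℝ ∞ h) (l : ℕ) :
    iteratedDeriv l (fun s => s ^ l * h s) 0 = l.factorial * h 0 := by
  have h1 : ContDiffAt ℝ l (fun s : ℝ => s ^ l) 0 := by fun_prop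
  have h2 : ContDiffAt ℝ l h 0 := (hh.of_le (by exact_mod_cast le_top)).contDiffAt
  have := iteratedDeriv_mul h1 h2
  change iteratedDeriv l ((fun s => s ^ l) * h) 0 = _
  rw [this, Finset.sum_eq_single l]
  · rw [iteratedDeriv_fun_pow_zero]; simp
  · intro i _ hi
    rw [iteratedDeriv_fun_pow_zero]; simp [hi]
  · simp

/-- A function whose first `n` derivatives vanish at `0`. -/
lemma abs_le_of_iterated_zero {F : ℕ → ℝ → ℝ} {n : ℕ} {C e : ℝ} (he : 0 ≤ e)
    (hd : ∀ j < n, ∀ s, HasDerivAt (F j) (F (j + 1) s) s) (h0 : ∀ j < n, F j 0 = 0)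
    (hC : ∀ s ∈ Icc 0 e, |F n s| ≤ C) : |F 0 e| ≤ C * e ^ n := by
  -- Descent on the order of the derivative by the mean value inequality; every step gains a factor
  -- `s`, and the `1 / n!` of Taylor's formula is given away.
  have key : ∀ m ≤ n, ∀ s ∈ Icc 0 e, |F (n - m) s| ≤ C * s ^ m := by
    intro m
    induction m with
    | zero => intro _ s hs; simpa using hC s hs
    | succ m ih =>
      intro hm s hs
      have hs0 : 0 ≤ s := hs.1
      have hj : n - (m + 1) + 1 = n - m := by omega
      have h2 := Convex.norm_image_sub_le_of_norm_hasDerivWithin_le (f := F (n - (m + 1)))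
        (f' := F (n - m)) (s := Icc 0 s) (x := 0) (y := s) (C := C * s ^ m)
        (fun y _ => by rw [← hj]; exact (hd _ (by omega) y).hasDerivWithinAt)
        (fun y hy => by
          have hC0 : 0 ≤ C := (abs_nonneg _).trans (hC s hs)
          refine (ih (by omega) y ⟨hy.1, hy.2.trans hs.2⟩).trans ?_
          have := hy.1
          gcongr
          exact hy.2)
        (convex_Icc _ _) ⟨le_rfl, hs0⟩ ⟨hs0, le_rfl⟩
      rw [h0 _ (by omega), sub_zero, sub_zero, Real.norm_eq_abs, Real.norm_eq_abs,
        abs_of_nonneg hs0] at h2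
      rw [pow_succ, ← mul_assoc]
      exact h2
  simpa using key n le_rfl e ⟨he, le_rfl⟩

/-! ### Curves in the domain -/

lemma Sm.hasDeriv_curve (hT : 0 < T) (hf : Sm T f) {X Z : ℝ → ℝ} {X' Z' t : ℝ} (ht : t ∈ Icc 0 T)
    (hX : HasDerivWithinAt X X' (Icc 0 T) t) (hZ : HasDerivWithinAt Z Z' (Icc 0 T) t) :
    HasDerivWithinAt (fun s => f (X s) s (Z s))
      (X' * dX f (X t) t (Z t) + dT T f (X t) t (Z t) + Z' * dTau f (X t) t (Z t))
      (Icc 0 T) t := by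
  have h := (hf.hasFDeriv (mem_dom (x := X t) (τ := Z t) ht)).comp_hasDerivWithinAt
    (s := Icc 0 T) (f := fun s : ℝ => (X s, s, Z s)) (f' := (X', 1, Z')) t
    (hX.prodMk ((hasDerivWithinAt_id t _).prodMk hZ)) (fun _ hs => mem_dom hs)
  have e : ((X', 1, Z') : ℝ × ℝ × ℝ) = X' • Dir.x.vec + Dir.t.vec + Z' • Dir.s.vec := by
    simp [Dir.vec]
  rw [e, map_add, map_add, map_smul, map_smul, ← hf.pd_eq hT _ ht, ← hf.pd_eq hT _ ht,
    ← hf.pd_eq hT _ ht] at h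
  exact h

lemma bounded_of_contDiffOn {u : ℝ → ℝ} (hu : ContDiffOn ℝ ∞ u (Icc 0 T)) :
    ∃ R, 0 ≤ R ∧ ∀ t ∈ Icc 0 T, |u t| ≤ R := by
  obtain ⟨R, hR⟩ := isCompact_Icc.exists_bound_of_continuousOn hu.continuousOn
  exact ⟨max R 0, le_max_right _ _, fun t ht => (hR t ht).trans (le_max_left _ _)⟩

/-- The half-space `τ ≥ 0` together with the points of `τ ≤ 0` to the left of the curve. -/
def Side (φ : ℝ → ℝ) : ℝ → ℝ → ℝ → Prop := fun x t τ => 0 ≤ τ ∨ (τ ≤ 0 ∧ x ≤ φ t)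

lemma contDiffOn_derivWithin (hT : 0 < T) {u : ℝ → ℝ} (hu : ContDiffOn ℝ ∞ u (Icc 0 T)) :
    ContDiffOn ℝ ∞ (derivWithin u (Icc 0 T)) (Icc 0 T) :=
  hu.derivWithin (uniqueDiffOn_Icc hT) (by simp)

lemma hasDerivWithinAt_of_contDiffOn {u : ℝ → ℝ} (hu : ContDiffOn ℝ ∞ u (Icc 0 T)) {t : ℝ}
    (ht : t ∈ Icc 0 T) : HasDerivWithinAt u (derivWithin u (Icc 0 T) t) (Icc 0 T) t :=
  (hu.differentiableOn (by simp) t ht).hasDerivWithinAt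

/-- At `x = φ(t)` both signs of `τ` belong to `Side φ`, thanks to the non-strict inequality there.
Restrictions to the curve form a family closed under derivatives: the `t`-derivative is the
restriction of `φ' ∂ₓf + ∂ₜf`. -/
lemma ClRap.restrict_curve (hT : 0 < T) (hφ : ContDiffOn ℝ ∞ φ (Icc 0 T))
    (hf : ClRap T (Side φ) f) : ClRap T All (emb fun t τ => f (φ t) t τ) := by
  refine Cl.of_family Rap.respects
    (fun a => ∃ f, ClRap T (Side φ) f ∧ a = emb fun t τ => f (φ t) t τ) ?_ ?_ ?_ ⟨f, hf, rfl⟩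
  · rintro a ⟨f, hf, rfl⟩
    refine ContDiffOn.comp (g := unc f) (f := fun p : ℝ × ℝ × ℝ => (φ p.2.1, p.2.1, p.2.2)) hf.1
      ?_ ?_
    · exact (Sm.of_t hφ).prodMk (by fun_prop)
    · rintro ⟨x, t, τ⟩ ⟨-, ht, -⟩
      exact mem_dom ht
  · rintro a ⟨f, hf, rfl⟩ n R
    obtain ⟨R', -, hR'⟩ := bounded_of_contDiffOn hφ
    obtain ⟨C, h0, hC⟩ := hf.base n R'
    exact ⟨C, h0, fun x t τ _ ht _ => hC (φ t) t τ (hR' t ht) ht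
      ((le_total 0 τ).imp_right fun h => ⟨h, le_rfl⟩)⟩
  · rintro a ⟨f, hf, rfl⟩ i
    cases i
    · refine ⟨_, ⟨_, ClRap.zero, rfl⟩, fun x t _ τ => ?_⟩
      simp [MCH.pd, dX, emb]
    · refine ⟨_, ⟨_, ((ClRap.mul_slow hT (hf.pd hT Dir.x)
        (ClSlow.of_t hT (contDiffOn_derivWithin hT hφ))).add hT (hf.pd hT Dir.t)), rfl⟩,
        fun x t ht τ => ?_⟩
      have := (hf.1.hasDeriv_curve hT ht (hasDerivWithinAt_of_contDiffOn hφ ht)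
        (hasDerivWithinAt_const t (Icc 0 T) τ)).derivWithin (uniqueDiffOn_Icc hT t ht)
      refine Eq.trans this ?_
      simp [MCH.pd, emb, mul_comm]
    · exact ⟨_, ⟨_, hf.pd hT Dir.s, rfl⟩, EqD.refl _⟩

/-- Derivatives of functions which vanish on one side of the curve. -/
lemma Der.zero_left (hT : 0 < T) (hφ : ContinuousOn φ (Icc 0 T)) (hf : Sm T f)
    (h : ∀ x, ∀ t ∈ Icc 0 T, ∀ τ, x ≤ φ t → f x t τ = 0) (hg : Der T f g) :
    ∀ x, ∀ t ∈ Icc 0 T, ∀ τ, x ≤ φ t → g x t τ = 0 := by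
  induction hg with
  | refl => exact h
  | @step i g hg ih =>
    have hlt : ∀ x, ∀ t ∈ Icc 0 T, ∀ τ, x < φ t → pd T i g x t τ = 0 := by
      intro x t ht τ hx
      cases i
      · have : (fun y => g y t τ) =ᶠ[𝓝 x] fun _ => 0 := by
          filter_upwards [gt_mem_nhds hx] with y hy
          exact ih y t ht τ hy.le
        exact this.deriv_eq.trans (deriv_const _ _)
      · have : (fun s => g x s τ) =ᶠ[𝓝[Icc 0 T] t] fun _ => 0 := by
          filter_upwards [(hφ t ht).eventually_const_lt hx, self_mem_nhdsWithin] with s hs hs'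
          exact ih x s hs' τ hs.le
        exact (this.derivWithin_eq (ih x t ht τ hx.le)).trans (by simp)
      · have : (fun s => g x t s) = fun _ => 0 := by
          funext s
          exact ih x t ht s hx.le
        change deriv (fun s => g x t s) τ = 0
        simp [this]
    -- At a point of the curve, nearby times or positions may leave the region where `g` vanishes;
    -- there the value is found as a limit from `x < φ(t)`, by continuity in `x`.
    intro x t ht τ hx
    rcases hx.lt_or_eq with hx | rfl
    · exact hlt x t ht τ hx
    · have hc : ContinuousAt (fun y => pd T i g y t τ) (φ t) :=
        (((hg.sm hT hf).pd hT i).hasDeriv_x hT ht (φ t) τ).continuousAt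
      have h1 : Tendsto (fun y => pd T i g y t τ) (𝓝[<] (φ t)) (𝓝 (pd T i g (φ t) t τ)) :=
        hc.tendsto.mono_left nhdsWithin_le_nhds
      have h2 : Tendsto (fun y => pd T i g y t τ) (𝓝[<] (φ t)) (𝓝 0) := by
        refine tendsto_const_nhds.congr' ?_
        filter_upwards [self_mem_nhdsWithin] with y hy
        exact (hlt y t ht τ hy).symm
      exact tendsto_nhds_unique h1 h2

lemma Der.exists_sub (hT : 0 < T) (hf : Sm T f) {fm : ℝ → ℝ → ℝ → ℝ} (hfm : Sm T fm)
    (hg : Der T f g) : ∃ g' gm, Der T (f - fm) g' ∧ Der T fm gm ∧ EqD T g (g' + gm) := by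
  induction hg with
  | refl => exact ⟨_, _, .refl, .refl, by rw [sub_add_cancel]; exact EqD.refl _⟩
  | step i _ ih =>
    obtain ⟨g', gm, h₁, h₂, e⟩ := ih
    exact ⟨_, _, h₁.step i, h₂.step i,
      (e.pd i).trans (pd_add hT (h₁.sm hT (hf.sub hfm)) (h₂.sm hT hfm) i)⟩

/-- For `τ ≥ 0` the limit is zero. For `τ ≤ 0` and `x ≤ φ(t)` the limit vanishes together with all
its derivatives, by `Der.zero_left`, so there the derivatives of `f` and of `f - fm` coincide. -/
lemma Lim.rap_side (hT : 0 < T) (hφ : ContinuousOn φ (Icc 0 T)) {fm fp : ℝ → ℝ → ℝ → ℝ}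
    (h : Lim T f fm fp) (hp : EqD T fp 0)
    (hm : ∀ x, ∀ t ∈ Icc 0 T, ∀ τ, x ≤ φ t → fm x t τ = 0) : ClRap T (Side φ) f := by
  refine ⟨h.sm hT, fun g hg => Rap.union (S := Pos) (S' := fun x t τ => τ ≤ 0 ∧ x ≤ φ t) ?_ ?_⟩
  · have : ClRap T Pos f := h.pos.congr Rap.respects fun x t ht τ => by
      simp [hp x t ht τ]
    exact this.2 g hg
  · obtain ⟨g', gm, h₁, h₂, e⟩ := hg.exists_sub hT (h.sm hT) h.xtm.sm
    intro n R
    obtain ⟨C, h0, hC⟩ := h.neg.2 g' h₁ n R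
    refine ⟨C, h0, fun x t τ hx ht hs => ?_⟩
    rw [e x t ht τ, Pi.add_apply, Pi.add_apply, Pi.add_apply,
      h₂.zero_left hT hφ h.xtm.sm hm x t ht τ hs.2, add_zero]
    exact hC x t τ hx ht hs.1

end MCH

namespace MCH

/-! ### The cubic expression of the equation -/

section Cubic

variable {R : Type*} [CommRing R]

/-- The left-hand side of the equation as a polynomial in the derivatives. -/
def cubic (A B wt wtxx w wx wxx wxxx : R) : R :=
  A * wt - wtxx + B * w ^ 2 * wx - 2 * wx * wxx - w * wxxx

/-- The difference quotient of `cubic` at `w` in the direction `z` with increment `d`. -/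
def cubicQuot (A B d w wx wxx wxxx zt ztxx z zx zxx zxxx : R) : R :=
  A * zt - ztxx + B * ((2 * w * z + d * z ^ 2) * (wx + d * zx) + w ^ 2 * zx)
    - 2 * (wx * zxx + zx * wxx + d * zx * zxx) - (w * zxxx + z * wxxx + d * z * zxxx)

lemma cubic_add (A B d wt wtxx w wx wxx wxxx zt ztxx z zx zxx zxxx : R) :
    cubic A B (wt + d * zt) (wtxx + d * ztxx) (w + d * z) (wx + d * zx) (wxx + d * zxx)
      (wxxx + d * zxxx) = cubic A B wt wtxx w wx wxx wxxx +
        d * cubicQuot A B d w wx wxx wxxx zt ztxx z zx zxx zxxx := by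
  simp only [cubic, cubicQuot]; ring

end Cubic

variable {T : ℝ}

/-- The families `ε ↦ f ε` of functions of `(x, t, τ)`. -/
abbrev Fam := ℝ → ℝ → ℝ → ℝ → ℝ

/-- Membership in the class `PL` with arbitrary limits. -/
def IsPL (T : ℝ) (F : Fam) : Prop := ∃ Fm Fp, PL T F Fm Fp

lemma PL.cubic (hT : 0 < T) {A B a b c d e f Am Bm am bm cm dm em fm Ap Bp ap bp cp dp ep fp : Fam}
    (hA : PL T A Am Ap) (hB : PL T B Bm Bp) (ha : PL T a am ap) (hb : PL T b bm bp)
    (hc : PL T c cm cp) (hd : PL T d dm dp) (he : PL T e em ep) (hf : PL T f fm fp) :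
    PL T (cubic A B a b c d e f) (MCH.cubic Am Bm am bm cm dm em fm)
      (MCH.cubic Ap Bp ap bp cp dp ep fp) := by
  have key : ∀ A B a b c d e f : Fam, MCH.cubic A B a b c d e f =
      A * a - b + B * (c * c) * d - (d + d) * e - c * f := by
    intros; simp only [MCH.cubic]; ring
  simp only [key]
  exact (((((hA.mul hT ha).sub hT hb).add ((hB.mul hT (hc.mul hT hc)).mul hT hd)).sub hT
    ((hd.add hd).mul hT he)).sub hT (hc.mul hT hf))

namespace IsPL

variable {F G : Fam}

lemma sm (hT : 0 < T) (h : IsPL T F) (ε : ℝ) : Sm T (F ε) := by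
  obtain ⟨_, _, h⟩ := h; exact (h.sm hT ε).1

lemma add (h : IsPL T F) (h' : IsPL T G) : IsPL T (F + G) := by
  obtain ⟨_, _, h⟩ := h; obtain ⟨_, _, h'⟩ := h'; exact ⟨_, _, h.add h'⟩

lemma sub (hT : 0 < T) (h : IsPL T F) (h' : IsPL T G) : IsPL T (F - G) := by
  obtain ⟨_, _, h⟩ := h; obtain ⟨_, _, h'⟩ := h'; exact ⟨_, _, h.sub hT h'⟩

lemma mul (hT : 0 < T) (h : IsPL T F) (h' : IsPL T G) : IsPL T (F * G) := by
  obtain ⟨_, _, h⟩ := h; obtain ⟨_, _, h'⟩ := h'; exact ⟨_, _, h.mul hT h'⟩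

lemma cubicQuot (hT : 0 < T) {A B δ a b c d a' b' c' d' e' f' : Fam} (hA : IsPL T A)
    (hB : IsPL T B) (hδ : IsPL T δ) (ha : IsPL T a) (hb : IsPL T b) (hc : IsPL T c)
    (hd : IsPL T d) (ha' : IsPL T a') (hb' : IsPL T b') (hc' : IsPL T c') (hd' : IsPL T d')
    (he' : IsPL T e') (hf' : IsPL T f') :
    IsPL T (cubicQuot A B δ a b c d a' b' c' d' e' f') := by
  have key : MCH.cubicQuot A B δ a b c d a' b' c' d' e' f' =
      A * a' - b' + B * (((a + a) * c' + δ * (c' * c')) * (b + δ * d') + a * a * d')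
        - ((b * e' + d' * c + δ * d' * e') + (b * e' + d' * c + δ * d' * e'))
        - (a * f' + c' * d + δ * c' * f') := by
    simp only [MCH.cubicQuot]; ring
  have h1 : IsPL T (b * e' + d' * c + δ * d' * e') :=
    ((hb.mul hT he').add (hd'.mul hT hc)).add ((hδ.mul hT hd').mul hT he')
  rw [key]
  exact (((((hA.mul hT ha').sub hT hb').add (hB.mul hT
    ((((((ha.add ha).mul hT hc').add (hδ.mul hT (hc'.mul hT hc'))).mul hT
      (hb.add (hδ.mul hT hd')))).add ((ha.mul hT ha).mul hT hd')))).sub hT (h1.add h1)).sub hT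
    (((ha.mul hT hf').add (hc'.mul hT hd)).add ((hδ.mul hT hc').mul hT hf')))

end IsPL

/-- The family `ε`. -/
def epsF : Fam := fun ε _ _ _ => ε

lemma PL.epsF_pow (l : ℕ) : PL T (MCH.epsF ^ l) (MCH.epsF ^ l) (MCH.epsF ^ l) := by
  refine ((PL.const 1).pow_eps l).congr ?_ ?_ ?_ <;> intro ε x t _ τ <;> simp [MCH.epsF]

/-- Families which differ by `ε^l H`: comparison of the derivatives of order `l` at `0`. -/
lemma iteratedDeriv_line_add (hT : 0 < T) {F G H : Fam} {l : ℕ} (hG : IsPL T G) (hH : IsPL T H)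
    (h : ∀ ε, EqD T (F ε) ((G + epsF ^ l * H) ε)) {t : ℝ} (ht : t ∈ Icc 0 T) (a τ : ℝ) :
    iteratedDeriv l (fun s => F s (a + s * τ) t τ) 0 =
      iteratedDeriv l (fun s => G s (a + s * τ) t τ) 0 + l.factorial * H 0 a t τ := by
  obtain ⟨_, _, hG⟩ := hG
  obtain ⟨_, _, hH⟩ := hH
  have e : (fun s => F s (a + s * τ) t τ) =
      (fun s => G s (a + s * τ) t τ) + fun s => s ^ l * H s (a + s * τ) t τ := by
    funext s
    rw [h s _ t ht τ]
    simp [epsF]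
  have h1 := hG.contDiff_line hT ht a τ
  have h2 := hH.contDiff_line hT ht a τ
  have h3 : ContDiff ℝ ∞ fun s => s ^ l * H s (a + s * τ) t τ := (contDiff_id.pow l).mul h2
  rw [e, iteratedDeriv_add (h1.of_le (by exact_mod_cast le_top)).contDiffAt
    (h3.of_le (by exact_mod_cast le_top)).contDiffAt, iteratedDeriv_pow_mul h2]
  simp

lemma iteratedDeriv_sum_pow (M : ℕ) (c : ℕ → ℝ) (hc : ∀ k, M ≤ k → c k = 0) (j : ℕ) :
    iteratedDeriv j (fun ε : ℝ => ∑ k ∈ Finset.range M, ε ^ k * c k) 0 = j.factorial * c j := by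
  rw [iteratedDeriv_fun_sum fun k _ => by fun_prop]
  have h : ∀ k, iteratedDeriv j (fun ε : ℝ => ε ^ k * c k) 0 =
      if j = k then (j.factorial : ℝ) * c j else 0 := by
    intro k
    rw [iteratedDeriv_mul_const_field (fun ε : ℝ => ε ^ k), iteratedDeriv_fun_pow_zero]
    split_ifs with h <;> simp [h]
  simp only [h]
  rw [Finset.sum_ite_eq]
  split_ifs with hj
  · rfl
  · rw [hc j (by simpa using hj), mul_zero]

/-! ### The equation after the substitution -/

/-- The data of the problem are smooth, and the main term is rapidly decreasing and solves the
equation of the leading order. -/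
structure Setup.Regular (P : Setup) : Prop where
  hT : 0 < P.T
  ha : ∀ k ≤ P.N, Smooth2 P.T (P.a k)
  hb : ∀ k ≤ P.N, Smooth2 P.T (P.b k)
  hφ : ContDiffOn ℝ ∞ P.φ (Icc 0 P.T)
  hv : ClRap P.T All (emb P.v0)
  hode : ∀ t ∈ Icc 0 P.T, ∀ τ, -(P.a 0 (P.φ t) t * P.dφ t * gtau P.v0 t τ)
    + P.dφ t * gtau (gtau (gtau P.v0)) t τ + P.b 0 (P.φ t) t * P.v0 t τ ^ 2 * gtau P.v0 t τ
    - 2 * gtau P.v0 t τ * gtau (gtau P.v0) t τ - P.v0 t τ * gtau (gtau (gtau P.v0)) t τ = 0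

namespace Setup

variable (P : Setup)

/-- The total derivative in `x` of a family, times `ε`. -/
noncomputable def tX (F : Fam) : Fam := fun ε => totX ε (F ε)

/-- The total derivative in `t` of a family, times `ε`. -/
noncomputable def tT (F : Fam) : Fam := fun ε => P.totT ε (F ε)

/-- The truncated coefficient `a` as a family. -/
noncomputable def aF : Fam := fun ε x t _ => P.aSum ε x t

/-- The truncated coefficient `b` as a family. -/
noncomputable def bF : Fam := fun ε x t _ => P.bSum ε x t

/-- The scaled equation for a family. -/
noncomputable def sF (F : Fam) : Fam := fun ε => P.scaledEqn ε (F ε)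

lemma sF_eq (F : Fam) : P.sF F = cubic P.aF P.bF (P.tT F) (P.tT (tX (tX F))) F (tX F) (tX (tX F))
    (tX (tX (tX F))) := by
  funext ε x t τ
  simp [sF, scaledEqn, cubic, aF, bF, tX, tT]

/-- The equation for a family of functions independent of `τ`. -/
noncomputable def eF (F : Fam) : Fam := cubic P.aF P.bF (fun ε => pd P.T Dir.t (F ε))
  (epsF ^ 2 * fun ε => pd P.T Dir.t (pd P.T Dir.x (pd P.T Dir.x (F ε)))) F
  (fun ε => pd P.T Dir.x (F ε)) (epsF ^ 2 * fun ε => pd P.T Dir.x (pd P.T Dir.x (F ε)))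
  (epsF ^ 2 * fun ε => pd P.T Dir.x (pd P.T Dir.x (pd P.T Dir.x (F ε))))

lemma eqn_eq (U : ℝ → ℝ → ℝ → ℝ) (ε x t τ : ℝ) :
    eqn P.T (P.aSum ε x t) (P.bSum ε x t) ε (U ε) x t = P.eF (fun ε x t _ => U ε x t) ε x t τ := by
  simp only [eqn, eF, cubic, aF, bF, epsF, pd, dX, dT, px, pt, Pi.add_apply, Pi.sub_apply,
    Pi.mul_apply, Pi.pow_apply, Pi.ofNat_apply]
  ring

/-- Without the fast variable every scaled total derivative is `ε` times an ordinary one. The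
overall factor `ε` shifts orders by one: transport equations up to order `N` control the scaled
coefficients up to order `N + 1`. -/
lemma scaledEqn_of_xt (ε : ℝ) (U : ℝ → ℝ → ℝ) (x t τ : ℝ) :
    P.scaledEqn ε (fun x t _ => U x t) x t τ =
      ε * eqn P.T (P.aSum ε x t) (P.bSum ε x t) ε U x t := by
  have hX : ∀ U : ℝ → ℝ → ℝ, totX ε (fun x t _ => U x t) = fun x t _ => ε * px U x t := by
    intro U; funext x t τ; simp [totX, dX, dTau, px]
  have hTt : ∀ U : ℝ → ℝ → ℝ, P.totT ε (fun x t _ => U x t) = fun x t _ => ε * pt P.T U x t := by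
    intro U; funext x t τ; simp [totT, dT, dTau, pt]
  have hpx : ∀ U : ℝ → ℝ → ℝ, px (fun x t => ε * U x t) = fun x t => ε * px U x t := by
    intro U; funext x t; simp [px]
  have hpt : ∀ U : ℝ → ℝ → ℝ, pt P.T (fun x t => ε * U x t) = fun x t => ε * pt P.T U x t := by
    intro U; funext x t; simp [pt, derivWithin_const_mul_field]
  simp only [scaledEqn, hX, hTt, hpx, hpt, eqn]
  ring

lemma scaledEqn_zero (ε : ℝ) : P.scaledEqn ε (0 : ℝ → ℝ → ℝ → ℝ) = 0 := by
  funext x t τ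
  refine (P.scaledEqn_of_xt ε (fun _ _ => 0) x t τ).trans ?_
  simp [eqn, px, pt]

variable {P} {F Fm Fp G : Fam}

lemma Regular.pl_aF (h : P.Regular) : PL P.T P.aF P.aF P.aF := by
  have := PL.sum (T := P.T) (Finset.range (P.N + 1)) fun k hk => (PL.coef (Lim.of_xt (h.ha k
    (by simpa [Nat.lt_succ_iff] using hk)))).pow_eps k
  refine this.congr ?_ ?_ ?_ <;> intro ε x t _ τ <;> simp [aF, aSum, Finset.sum_apply]

lemma Regular.pl_bF (h : P.Regular) : PL P.T P.bF P.bF P.bF := by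
  have := PL.sum (T := P.T) (Finset.range (P.N + 1)) fun k hk => (PL.coef (Lim.of_xt (h.hb k
    (by simpa [Nat.lt_succ_iff] using hk)))).pow_eps k
  refine this.congr ?_ ?_ ?_ <;> intro ε x t _ τ <;> simp [bF, bSum, Finset.sum_apply]

lemma Regular.pl_tX (h : P.Regular) (H : PL P.T F Fm Fp) : PL P.T (tX F) (tX Fm) (tX Fp) :=
  (H.pd h.hT Dir.x).eps.add (H.pd h.hT Dir.s)

lemma Regular.contDiffOn_dφ (h : P.Regular) : ContDiffOn ℝ ∞ P.dφ (Icc 0 P.T) :=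
  contDiffOn_derivWithin h.hT h.hφ

lemma Regular.pl_tT (h : P.Regular) (H : PL P.T F Fm Fp) : PL P.T (P.tT F) (P.tT Fm) (P.tT Fp) :=
  (H.pd h.hT Dir.t).eps.sub h.hT ((PL.coef (Lim.of_xt (smooth2_of_t h.contDiffOn_dφ))).mul h.hT
    (H.pd h.hT Dir.s))

/-- Limits pass through the equation, because `PL` is closed under products and derivatives. -/
lemma Regular.pl_sF (h : P.Regular) (H : PL P.T F Fm Fp) :
    PL P.T (P.sF F) (P.sF Fm) (P.sF Fp) := by
  simp only [sF_eq]
  have h1 := h.pl_tX H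
  have h2 := h.pl_tX h1
  exact PL.cubic h.hT h.pl_aF h.pl_bF (h.pl_tT H) (h.pl_tT h2) H h1 h2 (h.pl_tX h2)

lemma Regular.pl_eF (h : P.Regular) (H : PL P.T F Fm Fp) :
    PL P.T (P.eF F) (P.eF Fm) (P.eF Fp) := by
  have hT := h.hT
  have h1 := H.pd hT Dir.x
  have h2 := h1.pd hT Dir.x
  have hE := PL.epsF_pow (T := P.T) 2
  exact PL.cubic hT h.pl_aF h.pl_bF (H.pd hT Dir.t) (hE.mul hT (h2.pd hT Dir.t)) H h1
    (hE.mul hT h2) (hE.mul hT (h2.pd hT Dir.x))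

lemma pd_add_eps (hT : 0 < T) {F G : Fam} (hF : IsPL T F) (hG : IsPL T G) (l : ℕ) (i : Dir)
    (ε : ℝ) : EqD T (pd T i ((F + epsF ^ l * G) ε))
      (((fun ε => pd T i (F ε)) + epsF ^ l * fun ε => pd T i (G ε)) ε) := by
  have e : (F + epsF ^ l * G) ε = F ε + ε ^ l • G ε := by
    funext x t τ; simp [epsF]
  rw [e]
  refine (pd_add hT (hF.sm hT ε) ((hG.sm hT ε).smul _) i).trans ?_
  rw [pd_smul]
  intro x t _ τ
  simp [epsF]

lemma _root_.MCH.IsPL.pd (hT : 0 < T) {F : Fam} (hF : IsPL T F) (i : Dir) :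
    IsPL T (fun ε => MCH.pd T i (F ε)) := by
  obtain ⟨_, _, h⟩ := hF; exact ⟨_, _, h.pd hT i⟩

lemma Regular.isPL_tX (h : P.Regular) (H : IsPL P.T F) : IsPL P.T (tX F) := by
  obtain ⟨_, _, H⟩ := H; exact ⟨_, _, h.pl_tX H⟩

lemma Regular.isPL_tT (h : P.Regular) (H : IsPL P.T F) : IsPL P.T (P.tT F) := by
  obtain ⟨_, _, H⟩ := H; exact ⟨_, _, h.pl_tT H⟩

lemma Regular.isPL_sF (h : P.Regular) (H : IsPL P.T F) : IsPL P.T (P.sF F) := by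
  obtain ⟨_, _, H⟩ := H; exact ⟨_, _, h.pl_sF H⟩

lemma tX_congr (e : ∀ ε, EqD T (F ε) (G ε)) (ε : ℝ) : EqD T (tX F ε) (tX G ε) :=
  (((e ε).pd Dir.x).smul ε).add ((e ε).pd Dir.s)

lemma tT_congr (e : ∀ ε, EqD P.T (F ε) (G ε)) (ε : ℝ) : EqD P.T (P.tT F ε) (P.tT G ε) :=
  (((e ε).pd Dir.t).smul ε).sub (((EqD.refl fun _ t _ => P.dφ t)).mul ((e ε).pd Dir.s))

lemma Regular.tX_add (h : P.Regular) (hF : IsPL P.T F) (hG : IsPL P.T G) (l : ℕ) (ε : ℝ) :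
    EqD P.T (tX (F + epsF ^ l * G) ε) ((tX F + epsF ^ l * tX G) ε) := by
  intro x t ht τ
  have h1 := pd_add_eps h.hT hF hG l Dir.x ε x t ht τ
  have h2 := pd_add_eps h.hT hF hG l Dir.s ε x t ht τ
  simp only [pd, Pi.add_apply, Pi.mul_apply] at h1 h2
  simp only [tX, totX, Pi.add_apply, Pi.mul_apply, h1, h2]
  ring

lemma Regular.tT_add (h : P.Regular) (hF : IsPL P.T F) (hG : IsPL P.T G) (l : ℕ) (ε : ℝ) :
    EqD P.T (P.tT (F + epsF ^ l * G) ε) ((P.tT F + epsF ^ l * P.tT G) ε) := by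
  intro x t ht τ
  have h1 := pd_add_eps h.hT hF hG l Dir.t ε x t ht τ
  have h2 := pd_add_eps h.hT hF hG l Dir.s ε x t ht τ
  simp only [pd, Pi.add_apply, Pi.mul_apply] at h1 h2
  simp only [tT, totT, Pi.add_apply, Pi.mul_apply, h1, h2]
  ring

/-- The quotient `(sF (F + ε^l G) - sF F) / ε^l`. -/
noncomputable def sQuot (P : Setup) (l : ℕ) (F G : Fam) : Fam :=
  cubicQuot P.aF P.bF (epsF ^ l) F (tX F) (tX (tX F)) (tX (tX (tX F))) (P.tT G)
    (P.tT (tX (tX G))) G (tX G) (tX (tX G)) (tX (tX (tX G)))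

lemma cubic_congr {A B a b c d e f a' b' c' d' e' f' : Fam} {ε x t τ : ℝ}
    (ha : a ε x t τ = a' ε x t τ) (hb : b ε x t τ = b' ε x t τ) (hc : c ε x t τ = c' ε x t τ)
    (hd : d ε x t τ = d' ε x t τ) (he : e ε x t τ = e' ε x t τ) (hf : f ε x t τ = f' ε x t τ) :
    cubic A B a b c d e f ε x t τ = cubic A B a' b' c' d' e' f' ε x t τ := by
  simp [cubic, ha, hb, hc, hd, he, hf]

/-- The total derivatives are linear, so the algebraic identity `cubic_add` applies. The quotient is
again polynomial in `ε`; its value at `ε = 0` is what the order `ε^l` sees of the perturbation. -/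
lemma Regular.sF_add (h : P.Regular) (hF : IsPL P.T F) (hG : IsPL P.T G) (l : ℕ) (ε : ℝ) :
    EqD P.T (P.sF (F + epsF ^ l * G) ε) ((P.sF F + epsF ^ l * P.sQuot l F G) ε) := by
  have e1 := fun ε => h.tX_add hF hG l ε
  have hF1 := h.isPL_tX hF
  have hG1 := h.isPL_tX hG
  have hF2 := h.isPL_tX hF1
  have hG2 := h.isPL_tX hG1
  have e2 := fun ε => (tX_congr e1 ε).trans (h.tX_add hF1 hG1 l ε)
  have e3 := fun ε => (tX_congr e2 ε).trans (h.tX_add hF2 hG2 l ε)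
  have e4 := fun ε => h.tT_add hF hG l ε
  have e5 := fun ε => (tT_congr e2 ε).trans (h.tT_add hF2 hG2 l ε)
  intro x t ht τ
  rw [sF_eq, sF_eq, sQuot, ← cubic_add]
  exact cubic_congr (e4 ε x t ht τ) (e5 ε x t ht τ) rfl (e1 ε x t ht τ) (e2 ε x t ht τ)
    (e3 ε x t ht τ)

lemma Regular.isPL_sQuot (h : P.Regular) (hF : IsPL P.T F) (hG : IsPL P.T G) (l : ℕ) :
    IsPL P.T (P.sQuot l F G) := by
  have hF1 := h.isPL_tX hF
  have hG1 := h.isPL_tX hG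
  have hF2 := h.isPL_tX hF1
  have hG2 := h.isPL_tX hG1
  exact IsPL.cubicQuot h.hT ⟨_, _, h.pl_aF⟩ ⟨_, _, h.pl_bF⟩ ⟨_, _, PL.epsF_pow l⟩ hF hF1 hF2
    (h.isPL_tX hF2) (h.isPL_tT hG) (h.isPL_tT hG2) hG hG1 hG2 (h.isPL_tX hG2)

/-- The quotient `(eF (F + ε^l G) - eF F) / ε^l`. -/
noncomputable def eQuot (P : Setup) (l : ℕ) (F G : Fam) : Fam :=
  cubicQuot P.aF P.bF (epsF ^ l) F (fun ε => pd P.T Dir.x (F ε))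
    (epsF ^ 2 * fun ε => pd P.T Dir.x (pd P.T Dir.x (F ε)))
    (epsF ^ 2 * fun ε => pd P.T Dir.x (pd P.T Dir.x (pd P.T Dir.x (F ε))))
    (fun ε => pd P.T Dir.t (G ε))
    (epsF ^ 2 * fun ε => pd P.T Dir.t (pd P.T Dir.x (pd P.T Dir.x (G ε)))) G
    (fun ε => pd P.T Dir.x (G ε)) (epsF ^ 2 * fun ε => pd P.T Dir.x (pd P.T Dir.x (G ε)))
    (epsF ^ 2 * fun ε => pd P.T Dir.x (pd P.T Dir.x (pd P.T Dir.x (G ε))))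

lemma Regular.eF_add (h : P.Regular) (hF : IsPL P.T F) (hG : IsPL P.T G) (l : ℕ) (ε : ℝ) :
    EqD P.T (P.eF (F + epsF ^ l * G) ε) ((P.eF F + epsF ^ l * P.eQuot l F G) ε) := by
  have hT := h.hT
  have hF1 := hF.pd hT Dir.x
  have hG1 := hG.pd hT Dir.x
  have hF2 := hF1.pd hT Dir.x
  have hG2 := hG1.pd hT Dir.x
  have e1 := fun ε => pd_add_eps hT hF hG l Dir.x ε
  have e2 := fun ε => ((e1 ε).pd Dir.x).trans (pd_add_eps hT hF1 hG1 l Dir.x ε)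
  have e3 := fun ε => ((e2 ε).pd Dir.x).trans (pd_add_eps hT hF2 hG2 l Dir.x ε)
  have e4 := fun ε => pd_add_eps hT hF hG l Dir.t ε
  have e5 := fun ε => ((e2 ε).pd Dir.t).trans (pd_add_eps hT hF2 hG2 l Dir.t ε)
  intro x t ht τ
  rw [eF, eF, eQuot, ← cubic_add]
  have key : ∀ {A B C : Fam}, A ε x t τ = (B + epsF ^ l * C) ε x t τ →
      (epsF ^ 2 * A) ε x t τ = (epsF ^ 2 * B + epsF ^ l * (epsF ^ 2 * C)) ε x t τ := by
    intro A B C hA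
    simp only [Pi.mul_apply, Pi.add_apply] at hA ⊢
    rw [hA]; ring
  exact cubic_congr (e4 ε x t ht τ) (key (e5 ε x t ht τ)) rfl (e1 ε x t ht τ)
    (key (e2 ε x t ht τ)) (key (e3 ε x t ht τ))

lemma Regular.isPL_eQuot (h : P.Regular) (hF : IsPL P.T F) (hG : IsPL P.T G) (l : ℕ) :
    IsPL P.T (P.eQuot l F G) := by
  have hT := h.hT
  have hF1 := hF.pd hT Dir.x
  have hG1 := hG.pd hT Dir.x
  have hF2 := hF1.pd hT Dir.x
  have hG2 := hG1.pd hT Dir.x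
  have hE : IsPL P.T (epsF ^ 2) := ⟨_, _, PL.epsF_pow 2⟩
  exact IsPL.cubicQuot hT ⟨_, _, h.pl_aF⟩ ⟨_, _, h.pl_bF⟩ ⟨_, _, PL.epsF_pow l⟩ hF hF1
    (hE.mul hT hF2) (hE.mul hT (hF2.pd hT Dir.x)) (hG.pd hT Dir.t) (hE.mul hT (hG2.pd hT Dir.t))
    hG hG1 (hE.mul hT hG2) (hE.mul hT (hG2.pd hT Dir.x))

end Setup

end MCH

namespace MCH

namespace Setup

/-! ### The approximations -/

variable {P : Setup} {Q : Terms} {n : ℕ}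

/-- The ingredients of the indices `1 ≤ j < n` have been constructed. -/
def Admissible (P : Setup) (Q : Terms) (n : ℕ) : Prop :=
  ∀ j, 1 ≤ j → j < n → P.SolvesLinear Q j (Q.η j) (Q.ψ j) ∧ P.SolvesTransport Q j

lemma Admissible.mono {m : ℕ} (h : P.Admissible Q n) (hm : m ≤ n) : P.Admissible Q m :=
  fun j h₁ h₂ => h j h₁ (h₂.trans_le hm)

/-- The sum `∑_{i < n} ε^i V_i`. -/
noncomputable def W (P : Setup) (Q : Terms) (n : ℕ) : Fam :=
  fun ε x t τ => ∑ i ∈ Finset.range n, ε ^ i * P.V Q i x t τ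

/-- The sum `∑_{1 ≤ i < n} ε^i u_i⁻`. -/
noncomputable def U (Q : Terms) (n : ℕ) : ℝ → ℝ → ℝ → ℝ :=
  fun ε x t => ∑ i ∈ Finset.Ico 1 n, ε ^ i * Q.u i x t

lemma V_zero (P : Setup) (Q : Terms) : P.V Q 0 = emb P.v0 := by
  funext x t τ; simp [V, emb]

/-- Since `η_j → 1` and `ψ_j → 0`, the limit of `V_j` at `-∞` is `u_j⁻`; at `+∞` everything decays.
-/
lemma Regular.lim_V (h : P.Regular) (hQ : P.Admissible Q n) {j : ℕ} (hj : j < n) :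
    Lim P.T (P.V Q j) (fun x t _ => if j = 0 then 0 else Q.u j x t) 0 := by
  rcases Nat.eq_zero_or_pos j with rfl | hpos
  · rw [V_zero]
    simpa using! Lim.of_rap h.hv
  · obtain ⟨⟨hη, hη1, hψ, -⟩, hu, -, -⟩ := hQ j hpos hj
    have h1 : Lim P.T (emb (Q.η j)) (fun _ _ _ => 1) 0 :=
      ⟨XT.of_xt (u := fun _ _ => 1) contDiffOn_const, .zero, hη.neg h.hT hη1, by
        rw [sub_zero]; exact hη.pos h.hT⟩
    refine (((Lim.of_xt hu).mul h.hT h1).add h.hT (Lim.of_rap (hψ.all h.hT))).congr ?_ ?_ ?_ <;>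
      intro x t _ τ <;> simp [V, emb, hpos.ne']

lemma Regular.pl_W (h : P.Regular) (hQ : P.Admissible Q n) :
    PL P.T (P.W Q n) (fun ε x t _ => U Q n ε x t) 0 := by
  have := PL.sum (T := P.T) (Finset.range n) fun i hi =>
    (PL.coef (h.lim_V hQ (Finset.mem_range.1 hi))).pow_eps i
  refine this.congr ?_ ?_ ?_ <;> intro ε x t _ τ
  · simp [W, Finset.sum_apply]
  · simp only [Finset.sum_apply, U, Pi.smul_apply, smul_eq_mul]
    symm
    rw [Finset.sum_congr rfl (g := fun i => ε ^ i * if i = 0 then 0 else Q.u i x t)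
      fun i hi => by rw [if_neg (by have := (Finset.mem_Ico.1 hi).1; omega)]]
    refine Finset.sum_subset (fun i hi => ?_) fun i hi hi' => ?_
    · simp only [Finset.mem_Ico, Finset.mem_range] at hi ⊢; omega
    · have : i = 0 := by simp only [Finset.mem_Ico, Finset.mem_range] at hi hi'; omega
      simp [this]
  · simp [Finset.sum_apply]

lemma pl_U (hQ : P.Admissible Q n) : PL P.T (fun ε x t _ => U Q n ε x t)
    (fun ε x t _ => U Q n ε x t) (fun ε x t _ => U Q n ε x t) := by
  refine (PL.sum (T := P.T) (Finset.Ico 1 n) fun i hi => (PL.coef (Lim.of_xt (hQ i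
    (Finset.mem_Ico.1 hi).1 (Finset.mem_Ico.1 hi).2).2.1)).pow_eps i).congr ?_ ?_ ?_ <;>
    intro ε x t _ τ <;> simp [U, Finset.sum_apply]

lemma aSum_zero (x t : ℝ) : P.aSum 0 x t = P.a 0 x t := by
  simp [aSum, Finset.sum_range_succ']

lemma bSum_zero (x t : ℝ) : P.bSum 0 x t = P.b 0 x t := by
  simp [bSum, Finset.sum_range_succ']

lemma U_zero (x t : ℝ) : U Q n 0 x t = 0 := by
  refine Finset.sum_eq_zero fun i hi => ?_
  have := (Finset.mem_Ico.1 hi).1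
  rw [zero_pow (by omega), zero_mul]

/-- The tail `∑_{k ≤ i < n} ε^(i-k) G_i` of a sum. -/
def tail (G : ℕ → ℝ → ℝ → ℝ → ℝ) (k n : ℕ) : Fam :=
  fun ε x t τ => ∑ i ∈ Finset.Ico k n, ε ^ (i - k) * G i x t τ

lemma tail_zero (G : ℕ → ℝ → ℝ → ℝ → ℝ) {k n : ℕ} (hk : k < n) : tail G k n 0 = G k := by
  funext x t τ
  rw [tail, Finset.sum_eq_single k]
  · simp
  · intro i hi hik
    have := (Finset.mem_Ico.1 hi).1
    rw [zero_pow (by omega), zero_mul]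
  · intro h
    exact absurd (Finset.mem_Ico.2 ⟨le_rfl, hk⟩) h

lemma isPL_tail {T : ℝ} {G : ℕ → ℝ → ℝ → ℝ → ℝ} {k n : ℕ}
    (h : ∀ i, k ≤ i → i < n → ∃ fm fp, Lim T (G i) fm fp) : IsPL T (tail G k n) := by
  choose! fm fp hL using h
  have := PL.sum (T := T) (Finset.Ico k n) fun i hi =>
    (PL.coef (hL i (Finset.mem_Ico.1 hi).1 (Finset.mem_Ico.1 hi).2)).pow_eps (i - k)
  exact ⟨_, _, this.congr (fun ε x t _ τ => by simp [tail, Finset.sum_apply])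
    (fun ε => EqD.refl _) (fun ε => EqD.refl _)⟩

lemma tail_split (G : ℕ → ℝ → ℝ → ℝ → ℝ) {m k n : ℕ} (hmk : m ≤ k) (hk : k ≤ n) :
    (fun ε x t τ => ∑ i ∈ Finset.Ico m n, ε ^ i * G i x t τ : Fam) =
      (fun ε x t τ => ∑ i ∈ Finset.Ico m k, ε ^ i * G i x t τ : Fam) + epsF ^ k * tail G k n := by
  funext ε x t τ
  simp only [Pi.add_apply, Pi.mul_apply, Pi.pow_apply, epsF, tail]
  rw [← Finset.sum_Ico_consecutive _ hmk hk, Finset.mul_sum]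
  congr 1
  refine Finset.sum_congr rfl fun i hi => ?_
  rw [← mul_assoc, ← pow_add]
  congr 2
  have := (Finset.mem_Ico.1 hi).1
  omega

/-- The transport equations annihilate the expansion of the regular part. -/
lemma Regular.iteratedDeriv_transport (h : P.Regular) (hQ : P.Admissible Q n) {k : ℕ} (hk : k < n)
    {x t : ℝ} (ht : t ∈ Icc 0 P.T) (hx : x ≤ P.φ t) :
    iteratedDeriv k (fun ε => eqn P.T (P.aSum ε x t) (P.bSum ε x t) ε (U Q n ε) x t) 0 = 0 := by
  rcases Nat.eq_zero_or_pos k with rfl | hpos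
  · have : U Q n 0 = fun _ _ => 0 := by funext x t; exact U_zero x t
    simp [eqn, this, px, pt]
  · obtain ⟨-, hu, htr, -⟩ := hQ k hpos hk
    have hL : ∀ i, 1 ≤ i → i < n → ∃ fm fp, Lim P.T (fun x t _ => Q.u i x t) fm fp :=
      fun i h₁ h₂ => ⟨_, _, Lim.of_xt (hQ i h₁ h₂).2.1⟩
    have hZ : IsPL P.T (tail (fun i x t _ => Q.u i x t) k n) :=
      isPL_tail fun i hi => hL i (hpos.trans_le hi)
    have hU : IsPL P.T (fun ε x t _ => U Q k ε x t) := ⟨_, _, pl_U (hQ.mono hk.le)⟩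
    have hsplit := tail_split (fun i x t _ => Q.u i x t) (m := 1) hpos hk.le
    have hadd := h.eF_add hU hZ k
    change _ = ((fun ε x t _ => U Q k ε x t) + _ : Fam) at hsplit
    rw [← hsplit] at hadd
    have hdiv := iteratedDeriv_line_add h.hT (F := P.eF fun ε x t _ => U Q n ε x t)
      (by obtain ⟨_, _, hU⟩ := hU; exact ⟨_, _, h.pl_eF hU⟩) (h.isPL_eQuot hU hZ k) hadd ht x 0
    have e : ∀ j, (fun ε => eqn P.T (P.aSum ε x t) (P.bSum ε x t) ε (U Q j ε) x t) =
        fun ε => P.eF (fun ε x t _ => U Q j ε x t) ε (x + ε * 0) t 0 := by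
      intro j; funext ε; rw [mul_zero, add_zero]; exact P.eqn_eq _ ε x t 0
    rw [e, hdiv, ← e]
    -- At `ε = 0` only `a₀ ∂ₜ` survives: the partial sum `U Q k` vanishes there, the other linear
    -- term carries `ε²`, and the terms nonlinear in the tail carry `ε^k` with `k ≥ 1`.
    have hq : P.eQuot k (fun ε x t _ => U Q k ε x t) (tail (fun i x t _ => Q.u i x t) k n) 0 x t 0
        = P.a 0 x t * pt P.T (Q.u k) x t := by
      have h0 : (tail (fun i x t _ => Q.u i x t) k n) 0 = fun x t _ => Q.u k x t := tail_zero _ hk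
      simp [eQuot, cubicQuot, epsF, h0, U_zero, aF, aSum_zero, hpos.ne', pd, dT, pt]
    have hf := htr t ht x hx
    rw [hq, hf, fMinus]
    have : (k.factorial : ℝ) ≠ 0 := by positivity
    change iteratedDeriv k (fun ε => eqn P.T (P.aSum ε x t) (P.bSum ε x t) ε (U Q k ε) x t) 0 +
      k.factorial * -(iteratedDeriv k
        (fun ε => eqn P.T (P.aSum ε x t) (P.bSum ε x t) ε (U Q k ε) x t) 0 / k.factorial) = 0
    field_simp
    ring

/-- The coefficients of the scaled equation for the partial sums. -/
lemma Regular.exists_coeff (h : P.Regular) (hQ : P.Admissible Q n) :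
    ∃ (M : ℕ) (c : ℕ → ℝ → ℝ → ℝ → ℝ), (∀ k, ∃ cm cp, Lim P.T (c k) cm cp) ∧
      (∀ k, M ≤ k → c k = 0) ∧ (∀ k ≤ n, ClRap P.T (Side P.φ) (c k)) ∧
      ∀ ε, EqD P.T (P.sF (P.W Q n) ε) (polySum M c ε) := by
  obtain ⟨M, c, cm, cp, hL, z, zm, zp, e, em, ep⟩ := (h.pl_sF (h.pl_W hQ)).exists_coeff h.hT
  refine ⟨M, c, fun k => ⟨_, _, hL k⟩, z, fun k hk => ?_, e⟩
  refine (hL k).rap_side h.hT h.hφ.continuousOn ?_ ?_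
  -- The limit at `+∞`: zero solves the equation for every `ε`, so all coefficients of this
  -- polynomial in `ε` vanish.
  · intro x t ht τ
    have h1 := iteratedDeriv_sum_pow M (fun k => cp k x t τ) (fun k hk => by simp [zp k hk]) k
    have h2 : (fun ε : ℝ => ∑ k ∈ Finset.range M, ε ^ k * cp k x t τ) = fun _ => 0 := by
      funext ε
      have := ep ε x t ht τ
      rw [polySum] at this
      rw [← this]
      change P.scaledEqn ε 0 x t τ = 0
      rw [scaledEqn_zero]; rfl
    rw [h2, iteratedDeriv_fun_const_zero] at h1
    have : (k.factorial : ℝ) ≠ 0 := by positivity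
    simpa [this] using h1.symm
  · intro x t ht τ hx
    have h1 := iteratedDeriv_sum_pow M (fun k => cm k x t τ) (fun k hk => by simp [zm k hk]) k
    set E : ℝ → ℝ := fun ε => eqn P.T (P.aSum ε x t) (P.bSum ε x t) ε (U Q n ε) x t with hE
    have h2 : (fun ε : ℝ => ∑ k ∈ Finset.range M, ε ^ k * cm k x t τ) = fun ε => ε * E ε := by
      funext ε
      have := em ε x t ht τ
      rw [polySum] at this
      rw [← this]
      exact P.scaledEqn_of_xt ε (U Q n ε) x t τ
    rw [h2] at h1
    -- In the Leibniz rule only the derivative of `E` of order `k - 1` remains. The transport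
    -- equations cover the orders below `n`, which is why `k ≤ n` is reached; for `k = 0` the factor
    -- `ε` alone suffices.
    have h3 : iteratedDeriv k (fun ε => ε * E ε) 0 = 0 := by
      have hEs : ContDiff ℝ ∞ E := by
        have hU : IsPL P.T (P.eF fun ε x t _ => U Q n ε x t) :=
          ⟨_, _, h.pl_eF (pl_U hQ)⟩
        obtain ⟨_, _, hU⟩ := hU
        convert hU.contDiff_line h.hT ht x 0 using 2 with ε
        rw [mul_zero, add_zero]
        exact P.eqn_eq _ ε x t 0
      have hmul := iteratedDeriv_mul (n := k) (x := (0 : ℝ)) (f := fun ε : ℝ => ε) (g := E)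
        contDiff_id.contDiffAt (hEs.of_le (by exact_mod_cast le_top)).contDiffAt
      refine Eq.trans hmul (Finset.sum_eq_zero fun i _ => ?_)
      rw [iteratedDeriv_fun_id_zero]
      split_ifs with hi
      · subst hi
        rcases Nat.eq_zero_or_pos k with rfl | hpos
        · simp
        · rw [h.iteratedDeriv_transport hQ (by omega) ht hx, mul_zero]
      · simp
    rw [h3] at h1
    have : (k.factorial : ℝ) ≠ 0 := by positivity
    simpa [this] using h1.symm

/-- Up to the factor `-1 / n!`, `𝓕_n` is the derivative of order `n` at `s = 0` along `x = φ(t) + s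
τ`. It involves only `c_0, …, c_n`, exactly those known to decrease rapidly on `Side`. -/
lemma Regular.rap_F (h : P.Regular) (hQ : P.Admissible Q n) : ClRap P.T All (emb (P.F Q n)) := by
  obtain ⟨M, c, hL, z, hc, e⟩ := h.exists_coeff hQ
  have hs : ∀ k, Sm P.T (c k) := fun k => by
    obtain ⟨_, _, hL⟩ := hL k
    exact hL.sm h.hT
  have h1 := (iterate_lineDer_rap h.hT (c := c) (j := n) (n := 0)
    (by simpa using hc) 0 le_rfl).restrict_curve h.hT h.hφ
  refine (h1.const_mul h.hT (-(1 / n.factorial : ℝ))).congr Rap.respects fun x t ht τ => ?_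
  have h2 : (fun ε => P.sF (P.W Q n) ε (P.φ t + ε * τ) t τ) =
      fun ε => polySum M c ε (P.φ t + ε * τ) t τ := by
    funext ε; exact e ε _ t ht τ
  have h3 := iteratedDeriv_line_zero h.hT hs z ht (P.φ t) τ n
  rw [← h2] at h3
  change _ = -(iteratedDeriv n (fun ε => P.sF (P.W Q n) ε (P.φ t + ε * τ) t τ) 0 / n.factorial)
  rw [h3]
  simp only [emb]
  ring

/-! ### The equations of the successive orders -/

lemma linOp_eq {v : ℝ → ℝ → ℝ} {t : ℝ} (hv0 : ContDiff ℝ ∞ (P.v0 t)) (hv : ContDiff ℝ ∞ (v t))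
    (τ : ℝ) :
    P.linOp v t τ = -(P.a 0 (P.φ t) t * P.dφ t * gtau v t τ) + P.dφ t * gtau (gtau (gtau v)) t τ
      + P.b 0 (P.φ t) t * (2 * P.v0 t τ * v t τ * gtau P.v0 t τ + P.v0 t τ ^ 2 * gtau v t τ)
      - 2 * (gtau P.v0 t τ * gtau (gtau v) t τ + gtau v t τ * gtau (gtau P.v0) t τ)
      - (P.v0 t τ * gtau (gtau (gtau v)) t τ + v t τ * gtau (gtau (gtau P.v0)) t τ) := by
  have key : ∀ {w : ℝ → ℝ → ℝ}, ContDiff ℝ ∞ (w t) →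
      HasDerivAt (w t) (gtau w t τ) τ ∧ HasDerivAt (gtau w t) (gtau (gtau w) t τ) τ := fun hw =>
    ⟨(hw.differentiable (by simp) τ).hasDerivAt,
      ((hw.iterate_deriv 1).differentiable (by simp) τ).hasDerivAt⟩
  have h1 : gtau (fun t τ => P.v0 t τ ^ 2 * v t τ) t τ =
      2 * P.v0 t τ * gtau P.v0 t τ * v t τ + P.v0 t τ ^ 2 * gtau v t τ := by
    refine (((key hv0).1.pow 2).mul (key hv).1).deriv.trans ?_
    simp
  have h2 : gtau (fun t τ => gtau P.v0 t τ * gtau v t τ) t τ =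
      gtau (gtau P.v0) t τ * gtau v t τ + gtau P.v0 t τ * gtau (gtau v) t τ :=
    ((key hv0).2.mul (key hv).2).deriv
  rw [linOp, h1, h2]
  ring

lemma totX_zero (f : ℝ → ℝ → ℝ → ℝ) : totX 0 f = dTau f := by
  funext x t τ; simp [totX]

lemma W_eq (n : ℕ) : P.W Q n = fun ε x t τ => ∑ i ∈ Finset.Ico 0 n, ε ^ i * P.V Q i x t τ := by
  simp only [← Finset.range_eq_Ico]; rfl

lemma W_zero (hn : 0 < n) : P.W Q n 0 = emb P.v0 := by
  rw [W_eq, ← V_zero P Q, ← tail_zero (P.V Q) hn]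
  funext x t τ
  simp [tail]

/-- At order `l` the terms with `i < l` contribute `-l! 𝓕_l` by definition of `𝓕_l`; the others
contribute `l!` times the linearization at `v₀` applied to `V_l` on the curve. There `u_l⁻ = ν_l`,
so `V_l = ν_l η_l + ψ_l` and the linear equation makes the two cancel. Order zero is the equation of
the main term. -/
lemma Regular.iteratedDeriv_scaled (h : P.Regular) (hQ : P.Admissible Q n) {l : ℕ} (hl : l < n)
    {t : ℝ} (ht : t ∈ Icc 0 P.T) (τ : ℝ) :
    iteratedDeriv l (fun ε => P.sF (P.W Q n) ε (P.φ t + ε * τ) t τ) 0 = 0 := by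
  rcases Nat.eq_zero_or_pos l with rfl | hpos
  · rw [iteratedDeriv_zero, zero_mul, add_zero]
    have h1 := h.hode t ht τ
    simp only [sF, scaledEqn, W_zero hl, totX_zero, totT, aSum_zero, bSum_zero]
    simp only [dTau, emb, gtau] at h1 ⊢
    linear_combination h1
  · obtain ⟨⟨hη, hη1, hψ, hlin⟩, hu, -, hν⟩ := hQ l hpos hl
    have hW : IsPL P.T (P.W Q l) := ⟨_, _, h.pl_W (hQ.mono hl.le)⟩
    have hZ : IsPL P.T (tail (P.V Q) l n) := isPL_tail fun i _ hi => ⟨_, _, h.lim_V hQ hi⟩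
    have hadd := h.sF_add hW hZ l
    have hsplit := tail_split (P.V Q) (m := 0) (Nat.zero_le l) hl.le
    rw [← W_eq, ← W_eq] at hsplit
    rw [← hsplit] at hadd
    rw [iteratedDeriv_line_add h.hT (h.isPL_sF hW) (h.isPL_sQuot hW hZ l) hadd ht (P.φ t) τ]
    have hF : iteratedDeriv l (fun ε => P.sF (P.W Q l) ε (P.φ t + ε * τ) t τ) 0 =
        -(l.factorial * P.F Q l t τ) := by
      have : P.F Q l t τ = -(iteratedDeriv l (fun ε => P.sF (P.W Q l) ε (P.φ t + ε * τ) t τ) 0 /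
        l.factorial) := rfl
      have h0 : (l.factorial : ℝ) ≠ 0 := by positivity
      rw [this, mul_neg, neg_neg, mul_div_cancel₀ _ h0]
    have hq : P.sQuot l (P.W Q l) (tail (P.V Q) l n) 0 (P.φ t) t τ = P.F Q l t τ := by
      rw [← hlin t ht τ, linOp_eq ((h.hv.1.contDiff_slice 0 ht))
        ((contDiff_const.mul ((Sm.of_ts hη.1).contDiff_slice 0 ht)).add
          ((Sm.of_ts hψ.1.1).contDiff_slice 0 ht)) τ]
      have hV : P.V Q l (P.φ t) t = fun s => P.ν Q l t * Q.η l t s + Q.ψ l t s := by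
        funext s
        simp [V, hpos.ne', hν t ht]
      simp only [sQuot, cubicQuot, tX, tT, aF, bF, epsF, Pi.add_apply, Pi.sub_apply, Pi.mul_apply,
        Pi.pow_apply, Pi.ofNat_apply, W_zero hpos, tail_zero _ hl, totX_zero, totT, aSum_zero,
        bSum_zero, zero_pow hpos.ne']
      simp only [dTau, emb, gtau, hV]
      ring
    rw [hF, hq]
    ring

end Setup

end MCH

namespace MCH

/-! ### Uniform estimates for polynomial families -/

variable {T : ℝ} {F G Fm Fp : Fam} {S : ℝ → ℝ → ℝ → Prop} {m : ℕ}

/-- `(1 + |τ|)^m |F|` is bounded on `S`, uniformly in `ε ∈ [0, 1]` and locally uniformly in `x`. -/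
def UnifBound (T : ℝ) (m : ℕ) (S : ℝ → ℝ → ℝ → Prop) (F : Fam) : Prop :=
  ∀ R : ℝ, ∃ C : ℝ, 0 ≤ C ∧ ∀ ε ∈ Icc (0 : ℝ) 1, ∀ x t τ, |x| ≤ R → t ∈ Icc 0 T → S x t τ →
    (1 + |τ|) ^ m * |F ε x t τ| ≤ C

lemma UnifBound.add (hF : UnifBound T m S F) (hG : UnifBound T m S G) :
    UnifBound T m S (F + G) := by
  intro R
  obtain ⟨C, h0, hC⟩ := hF R
  obtain ⟨C', h0', hC'⟩ := hG R
  refine ⟨C + C', by positivity, fun ε hε x t τ hx ht hs => ?_⟩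
  calc (1 + |τ|) ^ m * |F ε x t τ + G ε x t τ|
      ≤ (1 + |τ|) ^ m * (|F ε x t τ| + |G ε x t τ|) := by
        gcongr; exact abs_add_le _ _
    _ ≤ C + C' := by
        rw [mul_add]; exact add_le_add (hC ε hε x t τ hx ht hs) (hC' ε hε x t τ hx ht hs)

lemma UnifBound.eps (hF : UnifBound T m S F) : UnifBound T m S (fun ε => ε • F ε) := by
  intro R
  obtain ⟨C, h0, hC⟩ := hF R
  refine ⟨C, h0, fun ε hε x t τ hx ht hs => ?_⟩
  refine le_trans ?_ (hC ε hε x t τ hx ht hs)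
  simp only [Pi.smul_apply, smul_eq_mul, abs_mul]
  gcongr
  exact mul_le_of_le_one_left (abs_nonneg _) (by rw [abs_of_nonneg hε.1]; exact hε.2)

lemma UnifBound.congr (hF : UnifBound T m S F) (h : ∀ ε, EqD T (F ε) (G ε)) :
    UnifBound T m S G := by
  intro R
  obtain ⟨C, h0, hC⟩ := hF R
  exact ⟨C, h0, fun ε hε x t τ hx ht hs => by
    rw [← h ε x t ht τ]; exact hC ε hε x t τ hx ht hs⟩

lemma Rap.unifBound {f : ℝ → ℝ → ℝ → ℝ} (h : Rap T S f) : UnifBound T m S (fun _ => f) := by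
  intro R
  obtain ⟨C, h0, hC⟩ := h m R
  exact ⟨C, h0, fun ε _ x t τ hx ht hs => hC x t τ hx ht hs⟩

lemma XT.unifBound {f : ℝ → ℝ → ℝ → ℝ} (h : XT T f) : UnifBound T 0 S (fun _ => f) := by
  obtain ⟨u, hu, he⟩ := h
  intro R
  obtain ⟨C, h0, hC⟩ := (Sm.of_xt hu).bounded R 0
  refine ⟨C, h0, fun ε _ x t τ hx ht _ => ?_⟩
  dsimp only
  rw [he x t ht τ]
  simpa using hC x t 0 hx ht (by simp)

lemma PL.unifBound_neg (H : PL T F Fm Fp) (m : ℕ) : UnifBound T m Neg (F - Fm) := by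
  induction H with
  | coef h => exact h.neg.base.unifBound
  | add _ _ h₁ h₂ => rw [add_sub_add_comm]; exact h₁.add h₂
  | eps _ ih => exact ih.eps.congr fun ε x t _ τ => by simp [mul_sub]
  | congr _ e₁ e₂ _ ih => exact ih.congr fun ε => (e₁ ε).sub (e₂ ε)

lemma PL.unifBound_pos (H : PL T F Fm Fp) (m : ℕ) : UnifBound T m Pos (F - Fp) := by
  induction H with
  | coef h => exact h.pos.base.unifBound
  | add _ _ h₁ h₂ => rw [add_sub_add_comm]; exact h₁.add h₂
  | eps _ ih => exact ih.eps.congr fun ε x t _ τ => by simp [mul_sub]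
  | congr _ e₁ _ e₃ ih => exact ih.congr fun ε => (e₁ ε).sub (e₃ ε)

lemma UnifBound.pos_neg (h : UnifBound T m Pos F) (h' : UnifBound T m Neg F) :
    UnifBound T m All F := by
  intro R
  obtain ⟨C, h0, hC⟩ := h R
  obtain ⟨C', h0', hC'⟩ := h' R
  refine ⟨C + C', by positivity, fun ε hε x t τ hx ht _ => ?_⟩
  rcases le_total 0 τ with hs | hs
  · linarith [hC ε hε x t τ hx ht hs]
  · linarith [hC' ε hε x t τ hx ht hs]

lemma PL.unifBound (H : PL T F Fm Fp) : UnifBound T 0 All F := by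
  have h : UnifBound T 0 All Fm ∧ UnifBound T 0 All Fp := by
    induction H with
    | coef h => exact ⟨h.xtm.unifBound, h.xtp.unifBound⟩
    | add _ _ h₁ h₂ => exact ⟨h₁.1.add h₂.1, h₁.2.add h₂.2⟩
    | eps _ ih => exact ⟨ih.1.eps, ih.2.eps⟩
    | congr _ _ e₂ e₃ ih => exact ⟨ih.1.congr e₂, ih.2.congr e₃⟩
  have key : ∀ {S} {G : Fam}, UnifBound T 0 All G → UnifBound T 0 S G := by
    intro S G hG R
    obtain ⟨C, h0, hC⟩ := hG R
    exact ⟨C, h0, fun ε hε x t τ hx ht _ => hC ε hε x t τ hx ht trivial⟩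
  refine UnifBound.pos_neg ?_ ?_
  · simpa using (H.unifBound_pos 0).add (key h.2)
  · simpa using (H.unifBound_neg 0).add (key h.1)

lemma XT.pd_s {f : ℝ → ℝ → ℝ → ℝ} (h : XT T f) : EqD T (MCH.pd T Dir.s f) 0 := by
  obtain ⟨u, hu, he⟩ := h
  refine (he.pd Dir.s).trans fun x t _ τ => ?_
  simp [MCH.pd, dTau]

/-- Both limits are independent of `τ`, so `∂_τ` annihilates them. -/
lemma Lim.rap_dTau (hT : 0 < T) {f fm fp : ℝ → ℝ → ℝ → ℝ} (h : Lim T f fm fp) :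
    ClRap T All (MCH.pd T Dir.s f) := by
  have h' := (h.pd hT Dir.s).congr (EqD.refl _) h.xtm.pd_s h.xtp.pd_s
  have h1 := h'.pos
  have h2 := h'.neg
  rw [sub_zero] at h1 h2
  exact h1.pos_neg h2

lemma PL.unifBound_dTau (hT : 0 < T) (H : PL T F Fm Fp) (m : ℕ) :
    UnifBound T m All (fun ε => MCH.pd T Dir.s (F ε)) := by
  induction H with
  | coef h => exact (h.rap_dTau hT).base.unifBound
  | add h h' h₁ h₂ =>
    exact (h₁.add h₂).congr fun ε => (pd_add hT (h.sm hT ε).1 (h'.sm hT ε).1 _).symm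
  | eps _ ih => simp only [pd_smul]; exact ih.eps
  | congr _ e₁ _ _ ih => exact ih.congr fun ε => (e₁ ε).pd _

/-! ### The substitution `τ = (x - φ(t))/ε` -/

section Subst

variable {f : ℝ → ℝ → ℝ → ℝ}

lemma Sm.hasDeriv_curve_x (hT : 0 < T) (hf : Sm T f) {Z : ℝ → ℝ} {Z' t x : ℝ} (ht : t ∈ Icc 0 T)
    (hZ : HasDerivAt Z Z' x) :
    HasDerivAt (fun y => f y t (Z y)) (dX f x t (Z x) + Z' * dTau f x t (Z x)) x := by
  have h := (hf.hasFDeriv (mem_dom (x := x) (τ := Z x) ht)).comp_hasDerivWithinAt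
    (s := univ) (f := fun y : ℝ => (y, t, Z y)) (f' := (1, 0, Z')) x
    (((hasDerivAt_id x).prodMk ((hasDerivAt_const x t).prodMk hZ)).hasDerivWithinAt)
    (fun _ _ => mem_dom ht)
  have e : ((1, 0, Z') : ℝ × ℝ × ℝ) = Dir.x.vec + Z' • Dir.s.vec := by
    simp [Dir.vec]
  rw [e, map_add, map_smul, ← hf.pd_eq hT _ ht, ← hf.pd_eq hT _ ht] at h
  exact h.hasDerivAt univ_mem

end Subst

namespace Setup

variable {P : Setup} {Q : Terms}

/-- The function `W(x, t, (x - φ(t))/ε)`. -/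
noncomputable def subst (P : Setup) (ε : ℝ) (w : ℝ → ℝ → ℝ → ℝ) : ℝ → ℝ → ℝ :=
  fun x t => w x t ((x - P.φ t) / ε)

variable {w : ℝ → ℝ → ℝ → ℝ} {ε : ℝ}

lemma px_subst (h : P.Regular) (hw : Sm P.T w) {t : ℝ} (ht : t ∈ Icc 0 P.T) (hε : ε ≠ 0) (x : ℝ) :
    px (P.subst ε w) x t = ε⁻¹ * P.subst ε (totX ε w) x t := by
  refine (hw.hasDeriv_curve_x h.hT ht (((hasDerivAt_id x).sub_const (P.φ t)).div_const ε)
    ).deriv.trans ?_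
  simp only [subst, totX]
  field_simp
  simp

lemma pt_subst (h : P.Regular) (hw : Sm P.T w) {t : ℝ} (ht : t ∈ Icc 0 P.T) (hε : ε ≠ 0) (x : ℝ) :
    pt P.T (P.subst ε w) x t = ε⁻¹ * P.subst ε (P.totT ε w) x t := by
  refine ((hw.hasDeriv_curve h.hT ht (hasDerivWithinAt_const t _ x)
    (((hasDerivWithinAt_of_contDiffOn h.hφ ht).const_sub x).div_const ε)
    ).derivWithin (uniqueDiffOn_Icc h.hT t ht)).trans ?_
  simp only [subst, totT, dφ]
  field_simp
  ring

lemma sm_totX (h : P.Regular) (hw : Sm P.T w) (ε : ℝ) : Sm P.T (totX ε w) :=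
  ((hw.pd h.hT Dir.x).smul ε).add (hw.pd h.hT Dir.s)

lemma px_congr {T : ℝ} {u v : ℝ → ℝ → ℝ} (h : ∀ x, ∀ t ∈ Icc 0 T, u x t = v x t) :
    ∀ x, ∀ t ∈ Icc 0 T, px u x t = px v x t := by
  intro x t ht
  exact congrArg (fun F : ℝ → ℝ => deriv F x) (funext fun y => h y t ht)

lemma px_const_mul (c : ℝ) (u : ℝ → ℝ → ℝ) : px (fun x t => c * u x t) = fun x t => c * px u x t := by
  funext x t; simp [px]

lemma pt_const_mul (T c : ℝ) (u : ℝ → ℝ → ℝ) :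
    pt T (fun x t => c * u x t) = fun x t => c * pt T u x t := by
  funext x t; simp [pt, derivWithin_const_mul_field]

/-- Each derivative of the substituted function costs `ε⁻¹`; in the dispersive terms `ε²` meets
`ε⁻³`, and one factor `ε` clears all denominators. The errors of the truncated coefficients are kept
as separate terms. -/
lemma eqn_subst (h : P.Regular) (hw : Sm P.T w) {t : ℝ} (ht : t ∈ Icc 0 P.T) (hε : ε ≠ 0)
    (A B x : ℝ) : ε * eqn P.T A B ε (P.subst ε w) x t =
      P.scaledEqn ε w x t ((x - P.φ t) / ε)
        + (A - P.aSum ε x t) * P.totT ε w x t ((x - P.φ t) / ε)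
        + (B - P.bSum ε x t) * (w x t ((x - P.φ t) / ε) ^ 2 * totX ε w x t ((x - P.φ t) / ε)) := by
  have hw1 := sm_totX h hw ε
  have hw2 := sm_totX h hw1 ε
  have e1 : ∀ x, ∀ t ∈ Icc 0 P.T, px (P.subst ε w) x t = ε⁻¹ * P.subst ε (totX ε w) x t :=
    fun x t ht => px_subst h hw ht hε x
  have e2 : ∀ x, ∀ t ∈ Icc 0 P.T, px (px (P.subst ε w)) x t =
      ε⁻¹ * (ε⁻¹ * P.subst ε (totX ε (totX ε w)) x t) := by
    intro x t ht
    rw [px_congr e1 x t ht, px_const_mul]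
    dsimp only
    rw [px_subst h hw1 ht hε]
  have e3 : px (px (px (P.subst ε w))) x t =
      ε⁻¹ * (ε⁻¹ * (ε⁻¹ * P.subst ε (totX ε (totX ε (totX ε w))) x t)) := by
    rw [px_congr e2 x t ht, px_const_mul, px_const_mul]
    dsimp only
    rw [px_subst h hw2 ht hε]
  have e4 : pt P.T (px (px (P.subst ε w))) x t =
      ε⁻¹ * (ε⁻¹ * (ε⁻¹ * P.subst ε (P.totT ε (totX ε (totX ε w))) x t)) := by
    have : pt P.T (px (px (P.subst ε w))) x t = pt P.T (fun x t =>
        ε⁻¹ * (ε⁻¹ * P.subst ε (totX ε (totX ε w)) x t)) x t :=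
      derivWithin_congr (fun s hs => e2 x s hs) (e2 x t ht)
    rw [this, pt_const_mul, pt_const_mul]
    dsimp only
    rw [pt_subst h hw2 ht hε]
  rw [eqn, e4, e3, e2 x t ht, e1 x t ht, pt_subst h hw ht hε, scaledEqn]
  simp only [subst]
  field_simp
  ring

/-! ### The discrepancy near the curve -/

/-- Taylor's formula in `s` along the segment from `φ(t)` to `x`, with `τ` kept fixed. Decay in `τ`
is available on the entire segment, not only at its end, because the segment never enters the region
`τ < 0`, `x > φ(t)`. -/
lemma Regular.scaledEqn_bound (h : P.Regular) (hQ : P.Admissible Q (P.N + 1)) (m : ℕ) (R : ℝ) :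
    ∃ C : ℝ, 0 ≤ C ∧ ∀ ε ∈ Ioc (0 : ℝ) 1, ∀ x t, |x| ≤ R → t ∈ Icc 0 P.T →
      |P.scaledEqn ε (P.W Q (P.N + 1) ε) x t ((x - P.φ t) / ε)| ≤
        C * (ε ^ (P.N + 2) + ε ^ (P.N + 1) / (1 + |(x - P.φ t) / ε|) ^ m) := by
  obtain ⟨M, c, hL, z, hc, e⟩ := h.exists_coeff hQ
  have hT := h.hT
  have hs : ∀ k, Sm P.T (c k) := fun k => by
    obtain ⟨_, _, hL⟩ := hL k
    exact hL.sm hT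
  have hbd : ∀ k, ∃ C : ℝ, 0 ≤ C ∧ ∀ x t τ, |x| ≤ R → t ∈ Icc 0 P.T → |c k x t τ| ≤ C := by
    intro k
    obtain ⟨_, _, hL⟩ := hL k
    obtain ⟨C, h0, hC⟩ := (PL.coef hL).unifBound R
    exact ⟨C, h0, fun x t τ hx ht => by
      simpa using hC 0 ⟨le_rfl, zero_le_one⟩ x t τ hx ht trivial⟩
  choose B hB0 hB using hbd
  -- The coefficients beyond `N + 1` are split off: no decay is known for them, but they carry
  -- `ε^(N+2)`. The derivatives of order at most `N` at `s = 0` do not see this cut.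
  set c' : ℕ → ℝ → ℝ → ℝ → ℝ := fun k => if k ≤ P.N + 1 then c k else 0 with hc'
  have hs' : ∀ k, Sm P.T (c' k) := fun k => by
    simp only [hc']; split_ifs; exacts [hs k, Sm.const 0]
  have z' : ∀ k, M ≤ k → c' k = 0 := fun k hk => by
    simp only [hc']; split_ifs; exacts [z k hk, rfl]
  have hrap : ∀ k, ClRap P.T (Side P.φ) (c' k) := fun k => by
    simp only [hc']; split_ifs with hk; exacts [hc k hk, ClRap.zero]
  obtain ⟨R', h0', hR'⟩ := bounded_of_contDiffOn h.hφ
  -- The radius `max R R'` contains both ends `φ(t)` and `x` of the segment, hence all of it,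
  -- however large `|τ|` is.
  have hbd2 : ∀ k, ∃ C : ℝ, 0 ≤ C ∧ ∀ x t τ, |x| ≤ max R R' → t ∈ Icc 0 P.T → Side P.φ x t τ →
      (1 + |τ|) ^ m * |(lineDer^[P.N + 1] c') k x t τ| ≤ C := fun k =>
    (iterate_lineDer_rap hT (c := c') (j := P.N + 1) (n := k) (fun k _ => hrap k) k le_rfl).base
      m (max R R')
  choose B' hB0' hB' using hbd2
  refine ⟨∑ k ∈ Finset.range M, B k + ∑ k ∈ Finset.range M, B' k,
    add_nonneg (Finset.sum_nonneg fun k _ => hB0 k) (Finset.sum_nonneg fun k _ => hB0' k),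
    fun ε hε x t hx ht => ?_⟩
  have hε0 : 0 < ε := hε.1
  set τ := (x - P.φ t) / ε with hτ
  have hxτ : P.φ t + ε * τ = x := by rw [hτ]; field_simp; ring
  have hw : 0 < (1 + |τ|) ^ m := by positivity
  have h1 : P.scaledEqn ε (P.W Q (P.N + 1) ε) x t τ =
      polySum M c' ε (P.φ t + ε * τ) t τ + polySum M (c - c') ε x t τ := by
    rw [hxτ]
    refine (e ε x t ht τ).trans ?_
    have := congrFun (congrFun (congrFun (polySum_add M c' (c - c') ε) x) t) τ
    rw [add_sub_cancel] at this
    exact this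
  have h2 : |polySum M (c - c') ε x t τ| ≤ (∑ k ∈ Finset.range M, B k) * ε ^ (P.N + 2) := by
    rw [Finset.sum_mul]
    refine (Finset.abs_sum_le_sum_abs _ _).trans (Finset.sum_le_sum fun k _ => ?_)
    rcases le_or_gt k (P.N + 1) with hk | hk
    · simp only [Pi.sub_apply, hc', if_pos hk, sub_self, mul_zero, abs_zero]
      have := hB0 k
      positivity
    · simp only [Pi.sub_apply, hc', if_neg hk.not_ge, sub_zero, Pi.zero_apply, abs_mul, abs_pow,
        abs_of_pos hε0]
      rw [mul_comm]
      exact mul_le_mul (hB k x t τ hx ht) (pow_le_pow_of_le_one hε0.le hε.2 (by omega))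
        (by positivity) (hB0 k)
  have h3 : |polySum M c' ε (P.φ t + ε * τ) t τ| ≤
      ((∑ k ∈ Finset.range M, B' k) / (1 + |τ|) ^ m) * ε ^ (P.N + 1) := by
    refine abs_le_of_iterated_zero (n := P.N + 1)
      (F := fun j s => polySum M (lineDer^[j] c') s (P.φ t + s * τ) t τ) hε0.le ?_ ?_ ?_
    · intro j _ s
      rw [Function.iterate_succ_apply']
      exact hasDerivAt_line hT (iterate_lineDer_sm hT hs' j) (iterate_lineDer_zero z' j) ht _ τ s
    · intro j hj
      have h4 := h.iteratedDeriv_scaled hQ hj ht τ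
      have h5 : (fun ε => P.sF (P.W Q (P.N + 1)) ε (P.φ t + ε * τ) t τ) =
          fun ε => polySum M c ε (P.φ t + ε * τ) t τ := by
        funext ε; exact e ε _ t ht τ
      rw [h5, iteratedDeriv_line_zero hT hs z ht] at h4
      have h6 := iterate_lineDer_congr (c := c') (c' := c) (j := j) (n := 0)
        (fun k hk => if_pos (by omega)) 0 le_rfl
      simp only [polySum_at_zero (iterate_lineDer_zero z' j), zero_mul, add_zero]
      rw [h6, h4]
    · intro s hsm
      rw [Finset.sum_div]
      refine (Finset.abs_sum_le_sum_abs _ _).trans (Finset.sum_le_sum fun k _ => ?_)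
      rw [abs_mul, abs_pow, abs_of_nonneg hsm.1, le_div_iff₀ hw]
      -- For `τ ≤ 0 ≤ s` the point `φ(t) + s τ` lies on the left of the curve, where the limits of
      -- the coefficients vanish.
      have hside : Side P.φ (P.φ t + s * τ) t τ := by
        rcases le_total 0 τ with h0 | h0
        · exact Or.inl h0
        · exact Or.inr ⟨h0, by nlinarith [mul_nonpos_of_nonneg_of_nonpos hsm.1 h0]⟩
      have habs : |P.φ t + s * τ| ≤ max R R' := by
        have hφ := hR' t ht
        rw [abs_le] at hx hφ ⊢
        have a1 := le_max_left R R'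
        have a2 := le_max_right R R'
        rcases le_total 0 τ with h0 | h0
        · have b1 : 0 ≤ s * τ := mul_nonneg hsm.1 h0
          have b2 : s * τ ≤ ε * τ := mul_le_mul_of_nonneg_right hsm.2 h0
          constructor <;> linarith
        · have b1 : s * τ ≤ 0 := mul_nonpos_of_nonneg_of_nonpos hsm.1 h0
          have b2 : ε * τ ≤ s * τ := mul_le_mul_of_nonpos_right hsm.2 h0
          constructor <;> linarith
      have h7 := hB' k _ t τ habs ht hside
      have h8 : s ^ k ≤ 1 := pow_le_one₀ hsm.1 (hsm.2.trans hε.2)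
      calc s ^ k * |(lineDer^[P.N + 1] c') k (P.φ t + s * τ) t τ| * (1 + |τ|) ^ m
          ≤ 1 * |(lineDer^[P.N + 1] c') k (P.φ t + s * τ) t τ| * (1 + |τ|) ^ m := by gcongr
        _ ≤ B' k := by rw [one_mul, mul_comm]; exact h7
  rw [h1]
  refine (abs_add_le _ _).trans ((add_le_add h3 h2).trans ?_)
  have p1 : 0 ≤ (∑ k ∈ Finset.range M, B k) * (ε ^ (P.N + 1) / (1 + |τ|) ^ m) :=
    mul_nonneg (Finset.sum_nonneg fun k _ => hB0 k) (by positivity)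
  have p2 : 0 ≤ (∑ k ∈ Finset.range M, B' k) * ε ^ (P.N + 2) :=
    mul_nonneg (Finset.sum_nonneg fun k _ => hB0' k) (by positivity)
  have p3 : ((∑ k ∈ Finset.range M, B' k) / (1 + |τ|) ^ m) * ε ^ (P.N + 1) =
      (∑ k ∈ Finset.range M, B' k) * (ε ^ (P.N + 1) / (1 + |τ|) ^ m) := by ring
  rw [p3]
  nlinarith

end Setup

end MCH

namespace MCH

/-! ### Accuracy of the approximation -/

lemma BigOOn.bound {T : ℝ} {M : ℕ} {Ψ : ℝ → ℝ → ℝ → ℝ} (h : BigOOn (strip T) M Ψ) (R : ℝ) :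
    ∃ C ε₀ : ℝ, 0 ≤ C ∧ 0 < ε₀ ∧ ∀ ε ∈ Ioo 0 ε₀, ∀ x t, |x| ≤ R → t ∈ Icc 0 T →
      |Ψ x t ε| ≤ C * ε ^ M := by
  obtain ⟨C, ε₀, h0, hC⟩ := h (Icc (-R) R ×ˢ Icc 0 T) (isCompact_Icc.prod isCompact_Icc)
    (prod_mono (subset_univ _) subset_rfl)
  refine ⟨max C 0, ε₀, le_max_right _ _, h0, fun ε hε x t hx ht => ?_⟩
  refine (hC ε hε (x, t) ⟨abs_le.1 hx, ht⟩).trans ?_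
  have := hε.1
  gcongr
  exact le_max_left _ _

lemma exists_bound_fst {K : Set (ℝ × ℝ)} (hK : IsCompact K) : ∃ R : ℝ, ∀ z ∈ K, |z.1| ≤ R :=
  hK.exists_bound_of_continuousOn (f := fun z : ℝ × ℝ => z.1) (by fun_prop)

/-! Locality of the equation. -/

section Local

variable {T : ℝ} {u v : ℝ → ℝ → ℝ} {x t : ℝ}

lemma tendsto_strip_x (ht : t ∈ Icc 0 T) :
    Tendsto (fun y : ℝ => (y, t)) (𝓝 x) (𝓝[strip T] (x, t)) :=
  tendsto_nhdsWithin_iff.2 ⟨(by fun_prop : Continuous fun y : ℝ => (y, t)).tendsto x,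
    Eventually.of_forall fun _ => ⟨trivial, ht⟩⟩

lemma tendsto_strip_t : Tendsto (fun s : ℝ => (x, s)) (𝓝[Icc 0 T] t) (𝓝[strip T] (x, t)) :=
  tendsto_nhdsWithin_iff.2 ⟨((by fun_prop : Continuous fun s : ℝ => (x, s)).tendsto t).mono_left
    nhdsWithin_le_nhds, eventually_nhdsWithin_of_forall fun _ hs => ⟨trivial, hs⟩⟩

lemma eventually_px (h : ∀ᶠ z in 𝓝[strip T] (x, t), u z.1 z.2 = v z.1 z.2) :
    ∀ᶠ z in 𝓝[strip T] (x, t), px u z.1 z.2 = px v z.1 z.2 := by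
  filter_upwards [eventually_eventually_nhdsWithin.2 h, self_mem_nhdsWithin] with z hz hzT
  exact EventuallyEq.deriv_eq ((tendsto_strip_x (x := z.1) hzT.2).eventually hz)

/-- Agreement near the point relative to the strip is inherited by each `x`-derivative, hence also
by the mixed derivative `u_xxt`; time derivatives are taken within the strip. -/
lemma eqn_congr_eventually (ht : t ∈ Icc 0 T)
    (h : ∀ᶠ z in 𝓝[strip T] (x, t), u z.1 z.2 = v z.1 z.2) (A B ε : ℝ) :
    eqn T A B ε u x t = eqn T A B ε v x t := by
  have hmem : (x, t) ∈ strip T := ⟨trivial, ht⟩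
  have hpt : ∀ {u v : ℝ → ℝ → ℝ}, (∀ᶠ z in 𝓝[strip T] (x, t), u z.1 z.2 = v z.1 z.2) →
      pt T u x t = pt T v x t := fun {u v} h =>
    EventuallyEq.derivWithin_eq (tendsto_strip_t.eventually h) (h.self_of_nhdsWithin hmem)
  have h1 := eventually_px h
  have h2 := eventually_px h1
  have h3 := eventually_px h2
  have e0 := h.self_of_nhdsWithin hmem
  have e1 := h1.self_of_nhdsWithin hmem
  have e2 := h2.self_of_nhdsWithin hmem
  have e3 := h3.self_of_nhdsWithin hmem
  dsimp only at e0 e1 e2 e3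
  rw [eqn, eqn, hpt h, hpt h2, e0, e1, e2, e3]

end Local

/-! ### The discrepancy near the curve, on its two sides, and on compact sets -/

namespace Setup

variable {P : Setup} {Q : Terms} {a b : ℝ → ℝ → ℝ → ℝ}

/-- The errors of `a` and `b` are `O(ε^(N+1))` and multiply scaled total derivatives of `W`. These
are of size `ε + (1 + |τ|)^(-m)`, since the undamped part is `∂_τ W`, which decays. Dividing by `ε`
then produces the same two terms as the bound for the scaled equation. -/
lemma Regular.near_bound (h : P.Regular) (hQ : P.Admissible Q (P.N + 1))
    (haO : BigOOn (strip P.T) (P.N + 1) (fun x t ε => a x t ε - P.aSum ε x t))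
    (hbO : BigOOn (strip P.T) (P.N + 1) (fun x t ε => b x t ε - P.bSum ε x t)) (m : ℕ) (R : ℝ) :
    ∃ C ε₀ : ℝ, 0 ≤ C ∧ 0 < ε₀ ∧ ∀ ε ∈ Ioo 0 ε₀, ∀ x t, |x| ≤ R → t ∈ Icc 0 P.T →
      |eqn P.T (a x t ε) (b x t ε) ε (P.Y Q ε) x t| ≤
        C * (ε ^ (P.N + 1) + ε ^ P.N / (1 + |(x - P.φ t) / ε|) ^ m) := by
  obtain ⟨Ca, ea, hCa0, hea, hCa⟩ := haO.bound R
  obtain ⟨Cb, eb, hCb0, heb, hCb⟩ := hbO.bound R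
  obtain ⟨C₁, hC₁0, hC₁⟩ := h.scaledEqn_bound hQ m R
  have hW := h.pl_W hQ
  obtain ⟨Cw, hCw0, hCw⟩ := hW.unifBound R
  obtain ⟨Cx, hCx0, hCx⟩ := (hW.pd h.hT Dir.x).unifBound R
  obtain ⟨Ct, hCt0, hCt⟩ := (hW.pd h.hT Dir.t).unifBound R
  obtain ⟨Cs, hCs0, hCs⟩ := hW.unifBound_dTau h.hT m R
  obtain ⟨D, hD0, hD⟩ := bounded_of_contDiffOn h.contDiffOn_dφ
  refine ⟨C₁ + Ca * (Ct + D * Cs) + Cb * (Cw ^ 2 * (Cx + Cs)), min 1 (min ea eb), by positivity,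
    by positivity, fun ε hε x t hx ht => ?_⟩
  have hε0 : 0 < ε := hε.1
  have hε1 : ε < 1 := hε.2.trans_le (min_le_left _ _)
  have hεa : ε ∈ Ioo 0 ea := ⟨hε0, hε.2.trans_le ((min_le_right _ _).trans (min_le_left _ _))⟩
  have hεb : ε ∈ Ioo 0 eb := ⟨hε0, hε.2.trans_le ((min_le_right _ _).trans (min_le_right _ _))⟩
  have hεI : ε ∈ Icc (0 : ℝ) 1 := ⟨hε0.le, hε1.le⟩
  have key := eqn_subst h (hW.sm h.hT ε).1 ht hε0.ne' (a x t ε) (b x t ε) x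
  set τ := (x - P.φ t) / ε with hτ
  set e : ℝ := 1 / (1 + |τ|) ^ m with he
  have hpos : 0 < (1 + |τ|) ^ m := by positivity
  have he0 : 0 ≤ e := by positivity
  have b1 := hC₁ ε ⟨hε0, hε1.le⟩ x t hx ht
  have b2 : |P.W Q (P.N + 1) ε x t τ| ≤ Cw := by simpa using hCw ε hεI x t τ hx ht trivial
  have b3 : |dX (P.W Q (P.N + 1) ε) x t τ| ≤ Cx := by simpa using! hCx ε hεI x t τ hx ht trivial
  have b4 : |dT P.T (P.W Q (P.N + 1) ε) x t τ| ≤ Ct := by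
    simpa using! hCt ε hεI x t τ hx ht trivial
  have b5 : |dTau (P.W Q (P.N + 1) ε) x t τ| ≤ Cs * e := by
    rw [he, mul_one_div, le_div_iff₀ hpos, mul_comm]
    exact hCs ε hεI x t τ hx ht trivial
  have b6 : |P.totT ε (P.W Q (P.N + 1) ε) x t τ| ≤ (Ct + D * Cs) * (ε + e) := by
    calc |ε * dT P.T (P.W Q (P.N + 1) ε) x t τ - P.dφ t * dTau (P.W Q (P.N + 1) ε) x t τ|
        ≤ ε * |dT P.T (P.W Q (P.N + 1) ε) x t τ| + |P.dφ t| * |dTau (P.W Q (P.N + 1) ε) x t τ| := by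
          refine (abs_sub _ _).trans ?_
          rw [abs_mul, abs_mul, abs_of_pos hε0]
      _ ≤ ε * Ct + D * (Cs * e) := by
          gcongr
          exact hD t ht
      _ ≤ (Ct + D * Cs) * (ε + e) := by
          have : 0 ≤ Ct * e := by positivity
          have : 0 ≤ D * Cs * ε := by positivity
          nlinarith
  have b7 : |totX ε (P.W Q (P.N + 1) ε) x t τ| ≤ (Cx + Cs) * (ε + e) := by
    calc |ε * dX (P.W Q (P.N + 1) ε) x t τ + dTau (P.W Q (P.N + 1) ε) x t τ|
        ≤ ε * |dX (P.W Q (P.N + 1) ε) x t τ| + |dTau (P.W Q (P.N + 1) ε) x t τ| := by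
          refine (abs_add_le _ _).trans ?_
          rw [abs_mul, abs_of_pos hε0]
      _ ≤ ε * Cx + Cs * e := by gcongr
      _ ≤ (Cx + Cs) * (ε + e) := by
          have : 0 ≤ Cx * e := by positivity
          have : 0 ≤ Cs * ε := by positivity
          nlinarith
  have b8 : |(a x t ε - P.aSum ε x t) * P.totT ε (P.W Q (P.N + 1) ε) x t τ| ≤
      Ca * ε ^ (P.N + 1) * ((Ct + D * Cs) * (ε + e)) := by
    rw [abs_mul]
    exact mul_le_mul (hCa ε hεa x t hx ht) b6 (abs_nonneg _) (by positivity)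
  have b9 : |(b x t ε - P.bSum ε x t) * (P.W Q (P.N + 1) ε x t τ ^ 2 *
      totX ε (P.W Q (P.N + 1) ε) x t τ)| ≤
      Cb * ε ^ (P.N + 1) * (Cw ^ 2 * ((Cx + Cs) * (ε + e))) := by
    rw [abs_mul, abs_mul, abs_pow]
    gcongr
    exact hCb ε hεb x t hx ht
  have hY : P.Y Q ε = P.subst ε (P.W Q (P.N + 1) ε) := rfl
  have hmul : ε * |eqn P.T (a x t ε) (b x t ε) ε (P.Y Q ε) x t| ≤
      ε * ((C₁ + Ca * (Ct + D * Cs) + Cb * (Cw ^ 2 * (Cx + Cs))) *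
        (ε ^ (P.N + 1) + ε ^ P.N / (1 + |τ|) ^ m)) := by
    have hleft : ε * |eqn P.T (a x t ε) (b x t ε) ε (P.Y Q ε) x t| =
        |ε * eqn P.T (a x t ε) (b x t ε) ε (P.Y Q ε) x t| := by
      rw [abs_mul, abs_of_pos hε0]
    rw [hleft, hY, key]
    refine (abs_add_le _ _).trans ?_
    refine (add_le_add ((abs_add_le _ _).trans (add_le_add b1 b8)) b9).trans (le_of_eq ?_)
    rw [he]
    field_simp
    ring
  exact le_of_mul_le_mul_left hmul hε0

lemma YMinus_eq (ε : ℝ) : P.YMinus Q ε = U Q (P.N + 1) ε := by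
  funext x t
  refine Finset.sum_congr ?_ fun _ _ => rfl
  ext i
  simp only [Finset.mem_Icc, Finset.mem_Ico]
  omega

/-- Without the fast variable nothing is lost by division by `ε`: the coefficients of orders up to
`N` vanish by the transport equations, and the errors of `a` and `b` multiply bounded derivatives.
-/
lemma Regular.left_bound (h : P.Regular) (hQ : P.Admissible Q (P.N + 1))
    (haO : BigOOn (strip P.T) (P.N + 1) (fun x t ε => a x t ε - P.aSum ε x t))
    (hbO : BigOOn (strip P.T) (P.N + 1) (fun x t ε => b x t ε - P.bSum ε x t)) (R : ℝ) :
    ∃ C ε₀ : ℝ, 0 ≤ C ∧ 0 < ε₀ ∧ ∀ ε ∈ Ioo 0 ε₀, ∀ x t, |x| ≤ R → t ∈ Icc 0 P.T → x ≤ P.φ t →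
      |eqn P.T (a x t ε) (b x t ε) ε (P.YMinus Q ε) x t| ≤ C * ε ^ (P.N + 1) := by
  obtain ⟨Ca, ea, hCa0, hea, hCa⟩ := haO.bound R
  obtain ⟨Cb, eb, hCb0, heb, hCb⟩ := hbO.bound R
  have hU := pl_U hQ
  obtain ⟨Cw, hCw0, hCw⟩ := hU.unifBound R
  obtain ⟨Cx, hCx0, hCx⟩ := (hU.pd h.hT Dir.x).unifBound R
  obtain ⟨Ct, hCt0, hCt⟩ := (hU.pd h.hT Dir.t).unifBound R
  obtain ⟨M, c, cm, cp, hL, z, -, -, e, -, -⟩ := (h.pl_eF hU).exists_coeff h.hT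
  have hbd : ∀ k, ∃ C : ℝ, 0 ≤ C ∧ ∀ x t τ, |x| ≤ R → t ∈ Icc 0 P.T → |c k x t τ| ≤ C := by
    intro k
    obtain ⟨C, h0, hC⟩ := (PL.coef (hL k)).unifBound R
    exact ⟨C, h0, fun x t τ hx ht => by
      simpa using hC 0 ⟨le_rfl, zero_le_one⟩ x t τ hx ht trivial⟩
  choose B hB0 hB using hbd
  refine ⟨∑ k ∈ Finset.range M, B k + Ca * Ct + Cb * (Cw ^ 2 * Cx), min 1 (min ea eb),
    by have := Finset.sum_nonneg fun k (_ : k ∈ Finset.range M) => hB0 k; positivity,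
    by positivity, fun ε hε x t hx ht hxφ => ?_⟩
  have hε0 : 0 < ε := hε.1
  have hε1 : ε < 1 := hε.2.trans_le (min_le_left _ _)
  have hεa : ε ∈ Ioo 0 ea := ⟨hε0, hε.2.trans_le ((min_le_right _ _).trans (min_le_left _ _))⟩
  have hεb : ε ∈ Ioo 0 eb := ⟨hε0, hε.2.trans_le ((min_le_right _ _).trans (min_le_right _ _))⟩
  have hεI : ε ∈ Icc (0 : ℝ) 1 := ⟨hε0.le, hε1.le⟩
  have b2 : |U Q (P.N + 1) ε x t| ≤ Cw := by simpa using hCw ε hεI x t 0 hx ht trivial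
  have b3 : |px (U Q (P.N + 1) ε) x t| ≤ Cx := by simpa using! hCx ε hεI x t 0 hx ht trivial
  have b4 : |pt P.T (U Q (P.N + 1) ε) x t| ≤ Ct := by simpa using! hCt ε hεI x t 0 hx ht trivial
  have hE : ∀ ε, eqn P.T (P.aSum ε x t) (P.bSum ε x t) ε (U Q (P.N + 1) ε) x t =
      ∑ k ∈ Finset.range M, ε ^ k * c k x t 0 := fun ε => by
    rw [P.eqn_eq _ ε x t 0]
    exact e ε x t ht 0
  have hc : ∀ k ≤ P.N, c k x t 0 = 0 := by
    intro k hk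
    have h1 := iteratedDeriv_sum_pow M (fun k => c k x t 0) (fun k hk => by simp [z k hk]) k
    have h2 := h.iteratedDeriv_transport hQ (k := k) (by omega) ht hxφ
    simp only [hE] at h2
    rw [h2] at h1
    have : (k.factorial : ℝ) ≠ 0 := by positivity
    simpa [this] using h1.symm
  have b1 : |eqn P.T (P.aSum ε x t) (P.bSum ε x t) ε (U Q (P.N + 1) ε) x t| ≤
      (∑ k ∈ Finset.range M, B k) * ε ^ (P.N + 1) := by
    rw [hE, Finset.sum_mul]
    refine (Finset.abs_sum_le_sum_abs _ _).trans (Finset.sum_le_sum fun k _ => ?_)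
    rcases le_or_gt k P.N with hk | hk
    · rw [hc k hk, mul_zero, abs_zero]
      have := hB0 k
      positivity
    · rw [abs_mul, abs_pow, abs_of_pos hε0, mul_comm]
      exact mul_le_mul (hB k x t 0 hx ht) (pow_le_pow_of_le_one hε0.le hε1.le (by omega))
        (by positivity) (hB0 k)
  have hsplit : eqn P.T (a x t ε) (b x t ε) ε (P.YMinus Q ε) x t =
      eqn P.T (P.aSum ε x t) (P.bSum ε x t) ε (U Q (P.N + 1) ε) x t
        + (a x t ε - P.aSum ε x t) * pt P.T (U Q (P.N + 1) ε) x t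
        + (b x t ε - P.bSum ε x t) *
          (U Q (P.N + 1) ε x t ^ 2 * px (U Q (P.N + 1) ε) x t) := by
    rw [YMinus_eq, eqn, eqn]; ring
  have b8 : |(a x t ε - P.aSum ε x t) * pt P.T (U Q (P.N + 1) ε) x t| ≤
      Ca * ε ^ (P.N + 1) * Ct := by
    rw [abs_mul]
    exact mul_le_mul (hCa ε hεa x t hx ht) b4 (abs_nonneg _) (by positivity)
  have b9 : |(b x t ε - P.bSum ε x t) * (U Q (P.N + 1) ε x t ^ 2 *
      px (U Q (P.N + 1) ε) x t)| ≤ Cb * ε ^ (P.N + 1) * (Cw ^ 2 * Cx) := by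
    rw [abs_mul, abs_mul, abs_pow]
    gcongr
    exact hCb ε hεb x t hx ht
  rw [hsplit]
  refine (abs_add_le _ _).trans ?_
  refine (add_le_add ((abs_add_le _ _).trans (add_le_add b1 b8)) b9).trans (le_of_eq ?_)
  ring

lemma eqn_zero (T A B ε x t : ℝ) : eqn T A B ε (fun _ _ => 0) x t = 0 := by
  simp [eqn, px, pt]

/-- The left piece is used for `x ≤ φ(t) - μ`, inside the region where the transport equations hold;
the right piece solves the equation exactly. -/
lemma Regular.discrepancy_bound (h : P.Regular) (hQ : P.Admissible Q (P.N + 1))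
    (haO : BigOOn (strip P.T) (P.N + 1) (fun x t ε => a x t ε - P.aSum ε x t))
    (hbO : BigOOn (strip P.T) (P.N + 1) (fun x t ε => b x t ε - P.bSum ε x t)) {μ : ℝ} (hμ : 0 < μ)
    (m : ℕ) {K : Set (ℝ × ℝ)} (hK : IsCompact K) (hKT : K ⊆ strip P.T) :
    ∃ C ε₀ : ℝ, 0 ≤ C ∧ 0 < ε₀ ∧ ∀ ε ∈ Ioo 0 ε₀, ∀ z ∈ K,
      |P.discrepancy a b Q μ z.1 z.2 ε| ≤
        C * (ε ^ (P.N + 1) + ε ^ P.N / (1 + |(z.1 - P.φ z.2) / ε|) ^ m) := by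
  obtain ⟨R, hR⟩ := exists_bound_fst hK
  obtain ⟨C, e, hC0, he, hC⟩ := h.near_bound hQ haO hbO m R
  obtain ⟨C', e', hC0', he', hC'⟩ := h.left_bound hQ haO hbO R
  refine ⟨C + C', min e e', by positivity, by positivity, fun ε hε z hz => ?_⟩
  have hε0 : 0 < ε := hε.1
  have h1 : 0 ≤ ε ^ (P.N + 1) := by positivity
  have h2 : 0 ≤ ε ^ P.N / (1 + |(z.1 - P.φ z.2) / ε|) ^ m := by positivity
  have ht : z.2 ∈ Icc 0 P.T := (hKT hz).2
  rw [discrepancy, piece]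
  split_ifs with hl hr
  · refine (hC' ε ⟨hε0, hε.2.trans_le (min_le_right _ _)⟩ z.1 z.2 (hR z hz) ht
      (by linarith)).trans ?_
    nlinarith [mul_nonneg hC0' h2, mul_nonneg hC0 h1, mul_nonneg hC0 h2]
  · rw [eqn_zero, abs_zero]
    positivity
  · refine (hC ε ⟨hε0, hε.2.trans_le (min_le_left _ _)⟩ z.1 z.2 (hR z hz) ht).trans ?_
    gcongr
    linarith

/-- Away from `|x - φ(t)| = μ` the choice of the piece is locally constant, by continuity of `φ`. -/
lemma Regular.eqn_uN (h : P.Regular) {μ ε x t : ℝ} (hμ : 0 < μ) (ht : t ∈ Icc 0 P.T)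
    (hx : |x - P.φ t| ≠ μ) (A B : ℝ) :
    eqn P.T A B ε (fun x t => P.uN Q μ x t ε) x t = eqn P.T A B ε (P.piece Q μ ε x t) x t := by
  refine eqn_congr_eventually ht ?_ A B ε
  have hc : Tendsto (fun z : ℝ × ℝ => z.1 - P.φ z.2) (𝓝[strip P.T] (x, t)) (𝓝 (x - P.φ t)) := by
    have h1 : Tendsto (fun z : ℝ × ℝ => z.2) (𝓝[strip P.T] (x, t)) (𝓝[Icc 0 P.T] t) :=
      tendsto_nhdsWithin_iff.2 ⟨(continuous_snd.tendsto (x, t)).mono_left nhdsWithin_le_nhds,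
        eventually_nhdsWithin_of_forall fun _ hz => hz.2⟩
    exact ((continuous_fst.tendsto (x, t)).mono_left nhdsWithin_le_nhds).sub
      ((h.hφ.continuousOn t ht).tendsto.comp h1)
  have key : ∀ᶠ z in 𝓝[strip P.T] (x, t), P.piece Q μ ε z.1 z.2 = P.piece Q μ ε x t := by
    rcases lt_trichotomy (x - P.φ t) (-μ) with h1 | h1 | h1
    · filter_upwards [hc.eventually_lt_const h1] with z hz
      rw [piece, piece, if_pos (by linarith), if_pos (by linarith)]
    · exact absurd (by rw [h1, abs_neg, abs_of_pos hμ]) hx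
    · rcases lt_trichotomy (x - P.φ t) μ with h2 | h2 | h2
      · filter_upwards [hc.eventually_lt_const h2, hc.eventually_const_lt h1] with z hz hz'
        rw [piece, piece, if_neg (by linarith), if_neg (by linarith), if_neg (by linarith),
          if_neg (by linarith)]
      · exact absurd (by rw [h2, abs_of_pos hμ]) hx
      · filter_upwards [hc.eventually_const_lt h2] with z hz
        rw [piece, piece, if_neg (by linarith), if_pos (by linarith), if_neg (by linarith),
          if_pos (by linarith)]
  filter_upwards [key] with z hz
  rw [uN, hz]

/-- For `|x - φ(t)| < μ` the expansion is exact. Elsewhere `|τ| ≥ μ / ε`, and `W` differs from its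
limit, `Y⁻` or `0`, by `O((1 + |τ|)^(-(N+1)))`, which is `O(ε^(N+1))`. -/
lemma Regular.solitonLike (h : P.Regular) (hQ : P.Admissible Q (P.N + 1)) {μ : ℝ} (hμ : 0 < μ)
    (hne : P.v0 0 0 ≠ 0) :
    SolitonLikeExpansion P.T P.N P.φ (fun _ _ _ => 0) (P.V Q) (P.uN Q μ) := by
  have hT := h.hT
  refine ⟨h.hφ, fun _ _ => contDiffOn_const, ⟨(Lim.of_rap (P.V_zero Q ▸ h.hv)).inG hT, ?_⟩,
    ⟨0, 0, 0, ⟨le_rfl, hT.le⟩, by simpa [V] using hne⟩,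
    fun j _ hj => (h.lim_V hQ (Nat.lt_succ_iff.2 hj)).inG hT, ?_⟩
  · intro K hK hKT
    rw [V_zero]
    simpa using h.hv.base.tendsto_of_bound tendsto_abs_atBot_atTop
      (Eventually.of_forall fun _ _ _ => trivial) 0 hK hKT
  · intro K hK hKT
    obtain ⟨R, hR⟩ := exists_bound_fst hK
    obtain ⟨C, hC0, hC⟩ := (h.pl_W hQ).unifBound_neg (P.N + 1) R
    obtain ⟨C', hC0', hC'⟩ := (h.pl_W hQ).unifBound_pos (P.N + 1) R
    have hb : ∀ {ε y D : ℝ}, 0 < ε → μ ≤ |y| → 0 ≤ D → ∀ {v : ℝ},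
        (1 + |y / ε|) ^ (P.N + 1) * |v| ≤ D → |v| ≤ D / μ ^ (P.N + 1) * ε ^ (P.N + 1) := by
      intro ε y D hε hy hD v hv
      have h1 : μ / ε ≤ 1 + |y / ε| := by
        rw [abs_div, abs_of_pos hε]
        have : μ / ε ≤ |y| / ε := by gcongr
        linarith
      have h2 : (μ / ε) ^ (P.N + 1) * |v| ≤ D :=
        le_trans (by gcongr) hv
      have h3 : 0 < (μ / ε) ^ (P.N + 1) := by positivity
      rw [mul_comm, ← le_div_iff₀ h3] at h2
      refine h2.trans (le_of_eq ?_)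
      rw [div_pow]
      field_simp
    refine ⟨(C + C') / μ ^ (P.N + 1), 1, one_pos, fun ε hε z hz => ?_⟩
    have hεI : ε ∈ Icc (0 : ℝ) 1 := ⟨hε.1.le, hε.2.le⟩
    have ht : z.2 ∈ Icc 0 P.T := (hKT hz).2
    have hW : ∑ j ∈ Finset.range (P.N + 1), ε ^ j * (0 + P.V Q j z.1 z.2 ((z.1 - P.φ z.2) / ε)) =
        P.W Q (P.N + 1) ε z.1 z.2 ((z.1 - P.φ z.2) / ε) := by simp [W]
    dsimp only
    rw [hW, uN, piece]
    have hle : ∀ {D : ℝ}, D ≤ C + C' →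
        D / μ ^ (P.N + 1) * ε ^ (P.N + 1) ≤ (C + C') / μ ^ (P.N + 1) * ε ^ (P.N + 1) := by
      intro D hD
      have := hε.1
      gcongr
    split_ifs with hl hr
    · have hneg : (z.1 - P.φ z.2) / ε ≤ 0 := div_nonpos_of_nonpos_of_nonneg (by linarith) hε.1.le
      have h1 := hC ε hεI z.1 z.2 _ (hR z hz) ht hneg
      rw [YMinus_eq, abs_sub_comm]
      exact (hb hε.1 (by rw [abs_of_nonpos (by linarith)]; linarith) hC0 h1).trans
        (hle (by linarith))
    · have hpos : 0 ≤ (z.1 - P.φ z.2) / ε := div_nonneg (by linarith) hε.1.le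
      have h1 := hC' ε hεI z.1 z.2 _ (hR z hz) ht hpos
      rw [sub_zero] at h1
      rw [zero_sub, abs_neg]
      exact (hb hε.1 (by rw [abs_of_nonneg (by linarith)]; linarith) hC0' h1).trans
        (hle (by linarith))
    · have : P.Y Q ε z.1 z.2 = P.W Q (P.N + 1) ε z.1 z.2 ((z.1 - P.φ z.2) / ε) := rfl
      rw [this, sub_self, abs_zero]
      have := hε.1
      positivity

/-- On a compact set off the curve `|x - φ(t)| ≥ δ > 0`, so a single power of decay, `m = 1`,
supplies the missing factor `ε`. -/
lemma Regular.bigO_off_curve (h : P.Regular) (hQ : P.Admissible Q (P.N + 1))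
    (haO : BigOOn (strip P.T) (P.N + 1) (fun x t ε => a x t ε - P.aSum ε x t))
    (hbO : BigOOn (strip P.T) (P.N + 1) (fun x t ε => b x t ε - P.bSum ε x t)) {μ : ℝ}
    (hμ : 0 < μ) :
    BigOOn {z ∈ strip P.T | z.1 ≠ P.φ z.2} (P.N + 1) (P.discrepancy a b Q μ) := by
  intro K hK hKT
  obtain ⟨C, e, hC0, he, hC⟩ := h.discrepancy_bound hQ haO hbO hμ 1 hK fun z hz => (hKT hz).1
  have hcont : ContinuousOn (fun z : ℝ × ℝ => |z.1 - P.φ z.2|) K :=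
    (continuousOn_fst.sub (h.hφ.continuousOn.comp continuousOn_snd
      fun z hz => (hKT hz).1.2)).abs
  obtain ⟨δ, hδ, hδK⟩ := hK.exists_forall_le' hcont (a := 0)
    fun z hz => abs_pos.2 (sub_ne_zero.2 (hKT hz).2)
  refine ⟨C * (1 + 1 / δ), e, he, fun ε hε z hz => (hC ε hε z hz).trans ?_⟩
  have hε0 : 0 < ε := hε.1
  rw [mul_assoc]
  gcongr
  have h1 : δ / ε ≤ (1 + |(z.1 - P.φ z.2) / ε|) ^ 1 := by
    rw [pow_one, abs_div, abs_of_pos hε0]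
    have : δ / ε ≤ |z.1 - P.φ z.2| / ε := by gcongr; exact hδK z hz
    linarith
  have h2 : ε ^ P.N / (1 + |(z.1 - P.φ z.2) / ε|) ^ 1 ≤ ε ^ P.N / (δ / ε) := by gcongr
  have h3 : ε ^ P.N / (δ / ε) = 1 / δ * ε ^ (P.N + 1) := by
    rw [pow_succ]; field_simp
  rw [add_mul, one_mul, ← h3]
  linarith

lemma Regular.bigO_strip (h : P.Regular) (hQ : P.Admissible Q (P.N + 1))
    (haO : BigOOn (strip P.T) (P.N + 1) (fun x t ε => a x t ε - P.aSum ε x t))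
    (hbO : BigOOn (strip P.T) (P.N + 1) (fun x t ε => b x t ε - P.bSum ε x t)) {μ : ℝ}
    (hμ : 0 < μ) : BigOOn (strip P.T) P.N (P.discrepancy a b Q μ) := by
  intro K hK hKT
  obtain ⟨C, e, hC0, he, hC⟩ := h.discrepancy_bound hQ haO hbO hμ 0 hK hKT
  refine ⟨C * 2, min e 1, by positivity, fun ε hε z hz =>
    (hC ε ⟨hε.1, hε.2.trans_le (min_le_left _ _)⟩ z hz).trans ?_⟩
  have hε0 : 0 < ε := hε.1
  have hε1 : ε ≤ 1 := (hε.2.trans_le (min_le_right _ _)).le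
  rw [mul_assoc]
  gcongr
  have : ε ^ (P.N + 1) ≤ ε ^ P.N := pow_le_pow_of_le_one hε0.le hε1 (by omega)
  rw [pow_zero, div_one]
  linarith

end Setup

end MCH

namespace MCH

/-! ### Functions of the hyperbolic tangent -/

lemma hasDerivAt_tanh (z : ℝ) : HasDerivAt Real.tanh (1 - Real.tanh z ^ 2) z := by
  have hc : Real.cosh z ≠ 0 := (Real.cosh_pos z).ne'
  have h := (Real.hasDerivAt_sinh z).div (Real.hasDerivAt_cosh z) hc
  have e : Real.tanh = Real.sinh / Real.cosh := by
    funext w; exact Real.tanh_eq_sinh_div_cosh w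
  rw [e]
  refine h.congr_deriv ?_
  simp only [Pi.div_apply]
  field_simp

lemma contDiff_tanh : ContDiff ℝ ∞ Real.tanh := by
  have e : Real.tanh = fun z => Real.sinh z / Real.cosh z := by
    funext w; exact Real.tanh_eq_sinh_div_cosh w
  rw [e]
  exact Real.contDiff_sinh.div Real.contDiff_cosh fun z => (Real.cosh_pos z).ne'

/-- The function `1 - tanh² = cosh⁻²`. -/
noncomputable def sechSq (z : ℝ) : ℝ := 1 - Real.tanh z ^ 2

lemma sechSq_eq (z : ℝ) : sechSq z = (Real.cosh z ^ 2)⁻¹ := by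
  have hc : Real.cosh z ≠ 0 := (Real.cosh_pos z).ne'
  rw [sechSq, Real.tanh_eq_sinh_div_cosh]
  field_simp
  linarith [Real.cosh_sq z]

lemma sechSq_pos (z : ℝ) : 0 < sechSq z := by
  rw [sechSq_eq]; have := Real.cosh_pos z; positivity

lemma sechSq_le_one (z : ℝ) : sechSq z ≤ 1 := by
  rw [sechSq]; nlinarith [sq_nonneg (Real.tanh z)]

lemma hasDerivAt_sechSq (z : ℝ) : HasDerivAt sechSq (-2 * Real.tanh z * sechSq z) z := by
  have h := ((hasDerivAt_tanh z).pow 2).const_sub 1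
  refine (h.congr_of_eventuallyEq (f₁ := sechSq) (Eventually.of_forall fun w => rfl)).congr_deriv ?_
  simp [sechSq]

lemma sechSq_le_exp (z : ℝ) : sechSq z ≤ 4 * Real.exp (-(2 * |z|)) := by
  have h : Real.exp |z| / 2 ≤ Real.cosh z := by
    rw [← Real.cosh_abs, Real.cosh_eq]; linarith [Real.exp_pos (-|z|)]
  have hp := Real.exp_pos |z|
  rw [sechSq_eq, show -(2 * |z|) = -(|z| + |z|) by ring, Real.exp_neg, Real.exp_add,
    ← one_div, ← div_eq_mul_inv, div_le_div_iff₀ (by have := Real.cosh_pos z; positivity) (by positivity)]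
  nlinarith

lemma weight_mul_exp_le (n : ℕ) (z : ℝ) :
    (1 + |z|) ^ n * Real.exp (-|z|) ≤ n.factorial * Real.exp 1 := by
  have h := Real.pow_div_factorial_le_exp (1 + |z|) (by positivity) n
  rw [div_le_iff₀ (by positivity), Real.exp_add] at h
  have h2 : Real.exp (-|z|) * Real.exp |z| = 1 := by rw [← Real.exp_add]; simp
  calc (1 + |z|) ^ n * Real.exp (-|z|)
      ≤ (Real.exp 1 * Real.exp |z| * n.factorial) * Real.exp (-|z|) := by gcongr
    _ = n.factorial * Real.exp 1 * (Real.exp (-|z|) * Real.exp |z|) := by ring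
    _ = _ := by rw [h2, mul_one]

lemma weight_mul_sechSq_le (n : ℕ) :
    ∃ C : ℝ, 0 ≤ C ∧ ∀ z, (1 + |z|) ^ n * sechSq z ≤ C := by
  refine ⟨4 * (n.factorial * Real.exp 1), by positivity, fun z => ?_⟩
  have h : Real.exp (-(2 * |z|)) ≤ Real.exp (-|z|) :=
    Real.exp_le_exp.2 (by linarith [abs_nonneg z])
  calc (1 + |z|) ^ n * sechSq z ≤ (1 + |z|) ^ n * (4 * Real.exp (-|z|)) := by
        gcongr; exact (sechSq_le_exp z).trans (by gcongr)
    _ = 4 * ((1 + |z|) ^ n * Real.exp (-|z|)) := by ring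
    _ ≤ _ := mul_le_mul_of_nonneg_left (weight_mul_exp_le n z) (by norm_num)

/-- The algebra generated by `tanh` and `(1 + cosh⁻²)⁻¹`. -/
inductive TanhAlg : (ℝ → ℝ) → Prop
  | const (c : ℝ) : TanhAlg fun _ => c
  | tanh : TanhAlg Real.tanh
  | inv : TanhAlg fun z => (1 + sechSq z)⁻¹
  | add {f g : ℝ → ℝ} : TanhAlg f → TanhAlg g → TanhAlg (f + g)
  | mul {f g : ℝ → ℝ} : TanhAlg f → TanhAlg g → TanhAlg (f * g)

namespace TanhAlg

variable {f g : ℝ → ℝ} {T : ℝ}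

lemma neg (hf : TanhAlg f) : TanhAlg (-f) := by
  have := (const (-1)).mul hf
  convert this using 1
  funext z; simp

lemma sub (hf : TanhAlg f) (hg : TanhAlg g) : TanhAlg (f - g) := by
  rw [sub_eq_add_neg]; exact hf.add hg.neg

lemma smul (c : ℝ) (hf : TanhAlg f) : TanhAlg (fun z => c * f z) := (const c).mul hf

lemma sech : TanhAlg sechSq := by
  have := (const 1).sub (tanh.mul tanh)
  convert this using 1
  funext z; simp [sechSq, sq]

lemma bounded (hf : TanhAlg f) : ∃ C : ℝ, 0 ≤ C ∧ ∀ z, |f z| ≤ C := by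
  induction hf with
  | const c => exact ⟨|c|, abs_nonneg c, fun _ => le_rfl⟩
  | tanh => exact ⟨1, zero_le_one, fun z => (Real.abs_tanh_lt_one z).le⟩
  | inv =>
    refine ⟨1, zero_le_one, fun z => ?_⟩
    have := sechSq_pos z
    rw [abs_of_pos (by positivity)]
    exact inv_le_one_of_one_le₀ (by linarith)
  | add _ _ h₁ h₂ =>
    obtain ⟨C, h0, h⟩ := h₁
    obtain ⟨C', h0', h'⟩ := h₂
    exact ⟨C + C', by positivity, fun z => (abs_add_le _ _).trans (add_le_add (h z) (h' z))⟩
  | mul _ _ h₁ h₂ =>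
    obtain ⟨C, h0, h⟩ := h₁
    obtain ⟨C', h0', h'⟩ := h₂
    refine ⟨C * C', by positivity, fun z => ?_⟩
    rw [Pi.mul_apply, abs_mul]
    exact mul_le_mul (h z) (h' z) (abs_nonneg _) h0

/-- The generator `(1 + S)⁻¹` is present because `1 + S` is the leading coefficient of the
linearized operator; its derivative `2 tanh · S (1 + S)⁻²` stays in the algebra. -/
lemma hasDerivAt (hf : TanhAlg f) : ∃ f', TanhAlg f' ∧ ∀ z, HasDerivAt f (f' z) z := by
  induction hf with
  | const c => exact ⟨_, const 0, fun z => hasDerivAt_const z c⟩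
  | tanh => exact ⟨_, sech, hasDerivAt_tanh⟩
  | inv =>
    refine ⟨_, ((smul 2 tanh).mul sech).mul (inv.mul inv), fun z => ?_⟩
    have hp := sechSq_pos z
    have h := ((hasDerivAt_sechSq z).const_add 1).inv (by positivity)
    refine h.congr_deriv ?_
    simp only [Pi.mul_apply]
    field_simp
  | add _ _ h₁ h₂ =>
    obtain ⟨f', h, e⟩ := h₁
    obtain ⟨g', h', e'⟩ := h₂
    exact ⟨_, h.add h', fun z => (e z).add (e' z)⟩
  | mul hf hg h₁ h₂ =>
    obtain ⟨f', h, e⟩ := h₁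
    obtain ⟨g', h', e'⟩ := h₂
    exact ⟨_, (h.mul hg).add (hf.mul h'), fun z => (e z).mul (e' z)⟩

lemma contDiff (hf : TanhAlg f) : ContDiff ℝ ∞ f := by
  induction hf with
  | const c => exact contDiff_const
  | tanh => exact contDiff_tanh
  | inv =>
    refine ContDiff.inv ?_ fun z => (by have := sechSq_pos z; positivity : 1 + sechSq z ≠ 0)
    exact contDiff_const.add (contDiff_const.sub (contDiff_tanh.pow 2))
  | add _ _ h₁ h₂ => exact h₁.add h₂
  | mul _ _ h₁ h₂ => exact h₁.mul h₂

lemma clSlow {S : ℝ → ℝ → ℝ → Prop} (hf : TanhAlg f) : ClSlow T S (fun _ _ z => f z) := by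
  refine Cl.of_family Slow.respects (fun a => ∃ f, TanhAlg f ∧ a = fun _ _ z => f z)
    ?_ ?_ ?_ ⟨f, hf, rfl⟩
  · rintro a ⟨f, hf, rfl⟩
    exact Sm.of_s hf.contDiff
  · rintro a ⟨f, hf, rfl⟩ R
    obtain ⟨C, h0, h⟩ := hf.bounded
    exact ⟨0, C, h0, fun x t τ _ _ _ => by simpa using h τ⟩
  · rintro a ⟨f, hf, rfl⟩ i
    obtain ⟨f', hf', h⟩ := hf.hasDerivAt
    cases i
    · exact ⟨_, ⟨_, const 0, rfl⟩, fun x t _ τ => by simp [pd, dX]⟩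
    · exact ⟨_, ⟨_, const 0, rfl⟩, fun x t _ τ => by simp [pd, dT]⟩
    · exact ⟨_, ⟨_, hf', rfl⟩, fun x t _ τ => (h τ).deriv⟩

end TanhAlg

lemma clRap_sechSq {T : ℝ} : ClRap T All (fun _ _ z => sechSq z) := by
  have key : ClRap T All (fun _ _ z => sechSq z * 1) := by
    -- Closedness of the family: `(S f)' = S (f' - 2 tanh · f)`.
    refine Cl.of_family Rap.respects (fun a => ∃ f, TanhAlg f ∧ a = fun _ _ z => sechSq z * f z)
      ?_ ?_ ?_ ⟨_, .const 1, rfl⟩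
    · rintro a ⟨f, hf, rfl⟩
      exact Sm.of_s (TanhAlg.sech.mul hf).contDiff
    · rintro a ⟨f, hf, rfl⟩ n R
      obtain ⟨C, h0, h⟩ := hf.bounded
      obtain ⟨C', h0', h'⟩ := weight_mul_sechSq_le n
      refine ⟨C' * C, by positivity, fun x t τ _ _ _ => ?_⟩
      rw [abs_mul, abs_of_pos (sechSq_pos τ), ← mul_assoc]
      exact mul_le_mul (h' τ) (h τ) (abs_nonneg _) h0'
    · rintro a ⟨f, hf, rfl⟩ i
      obtain ⟨f', hf', h⟩ := hf.hasDerivAt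
      cases i
      · exact ⟨_, ⟨_, .const 0, rfl⟩, fun x t _ τ => by simp [pd, dX]⟩
      · exact ⟨_, ⟨_, .const 0, rfl⟩, fun x t _ τ => by simp [pd, dT]⟩
      · refine ⟨_, ⟨_, hf'.add ((TanhAlg.smul (-2) .tanh).mul hf), rfl⟩, fun x t _ τ => ?_⟩
        have := ((hasDerivAt_sechSq τ).mul (h τ)).deriv
        refine this.trans ?_
        simp only [Pi.add_apply, Pi.mul_apply]
        ring
  simpa using key

lemma TanhAlg.clRap {T : ℝ} (hT : 0 < T) {f : ℝ → ℝ} (hf : TanhAlg f) :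
    ClRap T All (fun _ _ z => sechSq z * f z) :=
  clRap_sechSq.mul_slow hT hf.clSlow

/-! ### Affine changes of the fast variable -/

variable {T : ℝ} {f : ℝ → ℝ → ℝ → ℝ} {S S' : ℝ → ℝ → ℝ → Prop} {α β : ℝ → ℝ}

/-- A bounded range of `τ` costs nothing, by compactness. This is needed because the shift `C₀`
moves the half-lines. -/
lemma ClRap.extend (hT : 0 < T) (hf : ClRap T S f) {R' : ℝ}
    (h : ∀ x, ∀ t ∈ Icc 0 T, ∀ τ, S' x t τ → S x t τ ∨ |τ| ≤ R') : ClRap T S' f := by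
  refine ⟨hf.1, fun g hg n R => ?_⟩
  obtain ⟨C, h0, hC⟩ := hf.2 g hg n R
  obtain ⟨C', h0', hC'⟩ := (hg.sm hT hf.1).bounded R R'
  refine ⟨C + (1 + |R'|) ^ n * C', by positivity, fun x t τ hx ht hs => ?_⟩
  rcases h x t ht τ hs with h1 | h1
  · have := hC x t τ hx ht h1
    have : 0 ≤ (1 + |R'|) ^ n * C' := by positivity
    linarith
  · have h2 := hC' x t τ hx ht h1
    have : (1 + |τ|) ^ n * |g x t τ| ≤ (1 + |R'|) ^ n * C' :=
      mul_le_mul (pow_le_pow_left₀ (by positivity) (by linarith [le_abs_self R']) n) h2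
        (abs_nonneg _) (by positivity)
    linarith

/-- The function `f(x, t, α(t) τ + β(t))`. -/
noncomputable def affComp (α β : ℝ → ℝ) (f : ℝ → ℝ → ℝ → ℝ) : ℝ → ℝ → ℝ → ℝ :=
  fun x t τ => f x t (α t * τ + β t)

lemma Sm.affComp (hf : Sm T f) (hα : ContDiffOn ℝ ∞ α (Icc 0 T))
    (hβ : ContDiffOn ℝ ∞ β (Icc 0 T)) : Sm T (affComp α β f) := by
  have h : Sm T (fun _ t τ => α t * τ + β t) := ((Sm.of_t hα).mul Sm.tau).add (Sm.of_t hβ)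
  refine ContDiffOn.comp (g := unc f)
    (f := fun p : ℝ × ℝ × ℝ => (p.1, p.2.1, α p.2.1 * p.2.2 + β p.2.1)) hf ?_ ?_
  · exact contDiffOn_fst.prodMk ((contDiffOn_fst.comp contDiffOn_snd (mapsTo_univ _ _)).prodMk h)
  · intro p hp
    simpa [dom] using hp

/-- Sums of products of derivatives of `f` after an affine change of variable with slowly growing
functions. -/
inductive AffSpan (T : ℝ) (α β : ℝ → ℝ) (f : ℝ → ℝ → ℝ → ℝ) : (ℝ → ℝ → ℝ → ℝ) → Prop
  | mul {g h : ℝ → ℝ → ℝ → ℝ} : Der T f g → ClSlow T All h → AffSpan T α β f (affComp α β g * h)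
  | add {a b : ℝ → ℝ → ℝ → ℝ} :
      AffSpan T α β f a → AffSpan T α β f b → AffSpan T α β f (a + b)

lemma pd_affComp (hT : 0 < T) (hf : Sm T f) (hα : ContDiffOn ℝ ∞ α (Icc 0 T))
    (hβ : ContDiffOn ℝ ∞ β (Icc 0 T)) (i : Dir) : ∃ i', ∃ h : ℝ → ℝ → ℝ → ℝ, ∃ h', ClSlow T All h ∧ ClSlow T All h' ∧
    EqD T (pd T i (affComp α β f)) (affComp α β (pd T i' f) * h + affComp α β (pd T Dir.s f) * h') := by
  cases i
  · exact ⟨Dir.x, _, _, ClSlow.const hT 1, ClSlow.const hT 0, fun x t ht τ => by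
      simp [pd, affComp, dX]⟩
  · refine ⟨Dir.t, _, _, ClSlow.const hT 1, ((ClSlow.of_t hT (contDiffOn_derivWithin hT hα)).mul hT
      (ClSlow.tau hT)).add hT (ClSlow.of_t hT (contDiffOn_derivWithin hT hβ)), fun x t ht τ => ?_⟩
    have h := hf.hasDeriv_curve hT ht (hasDerivWithinAt_const t (Icc 0 T) x)
      (((hasDerivWithinAt_of_contDiffOn hα ht).mul_const τ).add
        (hasDerivWithinAt_of_contDiffOn hβ ht))
    have := h.derivWithin (uniqueDiffOn_Icc hT t ht)
    refine this.trans ?_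
    simp only [affComp, Pi.add_apply, Pi.mul_apply, pd]
    ring
  · refine ⟨Dir.s, _, _, ClSlow.of_t hT hα, ClSlow.const hT 0, fun x t ht τ => ?_⟩
    have h := (hf.hasDeriv_s hT ht x (α t * τ + β t)).comp τ
      (((hasDerivAt_id τ).const_mul (α t)).add_const (β t))
    refine h.deriv.trans ?_
    simp [affComp, pd]

/-- Derivatives in `t` produce the factor `α' τ + β'`; it grows only linearly, so the sums in
`AffSpan` stay rapidly decreasing. -/
lemma ClRap.affComp (hT : 0 < T) (hf : ClRap T S f) (hα : ContDiffOn ℝ ∞ α (Icc 0 T))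
    (hβ : ContDiffOn ℝ ∞ β (Icc 0 T)) (hpos : ∀ t ∈ Icc 0 T, 0 < α t)
    (hS : ∀ x, ∀ t ∈ Icc 0 T, ∀ τ, S' x t τ → S x t (α t * τ + β t)) :
    ClRap T S' (affComp α β f) := by
  have hbase : ∀ g, Rap T S g → Rap T S' (MCH.affComp α β g) := by
    intro g hg n R
    obtain ⟨R₁, h₁, hR₁⟩ := bounded_of_contDiffOn hβ
    obtain ⟨R₂, h₂, hR₂⟩ := bounded_of_contDiffOn (hα.inv fun t ht => (hpos t ht).ne')
    obtain ⟨C, h0, hC⟩ := hg n R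
    -- The constant compares the weights: `τ = (z - β) / α` gives `|τ| ≤ R₂ (|z| + R₁)`, where `R₂`
    -- bounds `1 / α` and `R₁` bounds `β`.
    refine ⟨(1 + R₂ * (1 + R₁)) ^ n * C, by positivity, fun x t τ hx ht hs => ?_⟩
    have h3 := hC x t _ hx ht (hS x t ht τ hs)
    set z := α t * τ + β t with hz
    have h4 : |τ| ≤ R₂ * (|z| + R₁) := by
      have e : τ = (α t)⁻¹ * (z - β t) := by
        have := (hpos t ht).ne'
        rw [hz]; field_simp; ring
      rw [e, abs_mul]
      have h5 := hR₂ t ht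
      simp only [Pi.inv_apply] at h5
      have h6 : |z - β t| ≤ |z| + R₁ := (abs_sub _ _).trans (by linarith [hR₁ t ht])
      exact mul_le_mul h5 h6 (abs_nonneg _) h₂
    have h5 : 1 + |τ| ≤ (1 + R₂ * (1 + R₁)) * (1 + |z|) := by
      nlinarith [abs_nonneg z, mul_nonneg h₂ h₁, mul_nonneg (mul_nonneg h₂ h₁) (abs_nonneg z)]
    calc (1 + |τ|) ^ n * |MCH.affComp α β g x t τ|
        ≤ ((1 + R₂ * (1 + R₁)) * (1 + |z|)) ^ n * |g x t z| := by
          exact mul_le_mul_of_nonneg_right (pow_le_pow_left₀ (by positivity) h5 n) (abs_nonneg _)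
      _ = (1 + R₂ * (1 + R₁)) ^ n * ((1 + |z|) ^ n * |g x t z|) := by rw [mul_pow]; ring
      _ ≤ _ := by gcongr
  have h1 : ClRap T S' (MCH.affComp α β f * fun _ _ _ => 1) := by
    refine Cl.of_family Rap.respects (AffSpan T α β f) ?_ ?_ ?_
      (AffSpan.mul Der.refl (ClSlow.const hT 1))
    · intro a ha
      induction ha with
      | mul h₁ h₂ => exact ((h₁.sm hT hf.1).affComp hα hβ).mul h₂.1
      | add _ _ h₁ h₂ => exact h₁.add h₂
    · intro a ha
      induction ha with
      | mul h₁ h₂ => exact (hbase _ (hf.2 _ h₁)).mul_slow (h₂.of_all).base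
      | add _ _ h₁ h₂ => exact h₁.add h₂
    · intro a ha i
      suffices h : (∃ a', AffSpan T α β f a' ∧ EqD T (pd T i a) a') ∧ Sm T a from h.1
      induction ha with
      | @mul g h h₁ h₂ =>
        have hg := h₁.sm hT hf.1
        refine ⟨?_, (hg.affComp hα hβ).mul h₂.1⟩
        obtain ⟨i', k, k', hk, hk', e⟩ := pd_affComp hT hg hα hβ i
        refine ⟨_, (AffSpan.mul (h₁.step i') (hk.mul hT h₂)).add ((AffSpan.mul (h₁.step Dir.s)
          (hk'.mul hT h₂)).add (AffSpan.mul h₁ (h₂.pd hT i))),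
          (pd_mul hT (hg.affComp hα hβ) h₂.1 i).trans fun x t ht τ => ?_⟩
        have := e x t ht τ
        simp only [Pi.add_apply, Pi.mul_apply] at this ⊢
        rw [this]; ring
      | add h₁ h₂ ih₁ ih₂ =>
        obtain ⟨⟨a₁, ha₁, he₁⟩, s₁⟩ := ih₁
        obtain ⟨⟨a₂, ha₂, he₂⟩, s₂⟩ := ih₂
        exact ⟨⟨_, ha₁.add ha₂, (pd_add hT s₁ s₂ i).trans (he₁.add he₂)⟩, s₁.add s₂⟩
  exact h1.congr Rap.respects fun x t _ τ => by simp

end MCH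

/-! ### The soliton profile and the linear operator in the normalized variable -/

namespace MCH

lemma hasDerivAt_sechSq_deriv (z : ℝ) : HasDerivAt (fun z => -2 * Real.tanh z * sechSq z)
    (4 * sechSq z - 6 * sechSq z ^ 2) z := by
  refine (((hasDerivAt_tanh z).const_mul (-2)).mul (hasDerivAt_sechSq z)).congr_deriv ?_
  simp only [sechSq]; ring

lemma hasDerivAt_sechSq_deriv2 (z : ℝ) : HasDerivAt (fun z => 4 * sechSq z - 6 * sechSq z ^ 2)
    ((4 - 12 * sechSq z) * (-2 * Real.tanh z * sechSq z)) z := by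
  have h := hasDerivAt_sechSq z
  refine ((h.const_mul 4).sub ((h.pow 2).const_mul 6)).congr_deriv ?_
  norm_num; ring

lemma gtau_affine {v : ℝ → ℝ → ℝ} {g g' : ℝ → ℝ} {t A k c : ℝ}
    (hv : v t = fun τ => A * g (k * τ + c)) (hg : ∀ z, HasDerivAt g (g' z) z) :
    gtau v t = fun τ => A * k * g' (k * τ + c) := by
  funext τ
  rw [gtau, hv]
  have h := ((hg (k * τ + c)).comp τ (((hasDerivAt_id τ).const_mul k).add_const c)).const_mul A
  refine h.deriv.trans ?_
  ring

namespace Setup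

variable {P : Setup}

/-- The hypotheses on the coefficients, the phase function and the shift. -/
structure Data (P : Setup) : Prop where
  hT : 0 < P.T
  ha : ∀ k ≤ P.N, Smooth2 P.T (P.a k)
  hb : ∀ k ≤ P.N, Smooth2 P.T (P.b k)
  hab : ∀ x : ℝ, ∀ t ∈ Icc 0 P.T, P.a 0 x t * P.b 0 x t ≠ 0
  hφ : ContDiffOn ℝ ∞ P.φ (Icc 0 P.T)
  hφ' : ∀ t ∈ Icc 0 P.T, HasDerivWithinAt P.φ (6 * (P.a 0 (P.φ t) t / P.b 0 (P.φ t) t))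
    (Icc 0 P.T) t
  hpos : ∀ t ∈ Icc 0 P.T, 0 < P.a 0 (P.φ t) t
  hC₀ : ContDiffOn ℝ ∞ P.C₀ (Icc 0 P.T)

/-- The inverse width `√a₀ / 2` of the soliton. -/
noncomputable def κ (P : Setup) (t : ℝ) : ℝ := Real.sqrt (P.a 0 (P.φ t) t) / 2

namespace Data

variable (h : P.Data) {t : ℝ}
include h

lemma contDiffOn_curve {u : ℝ → ℝ → ℝ} (hu : Smooth2 P.T u) :
    ContDiffOn ℝ ∞ (fun t => u (P.φ t) t) (Icc 0 P.T) :=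
  ContDiffOn.comp (g := fun p : ℝ × ℝ => u p.1 p.2) (f := fun t => (P.φ t, t)) hu
    (h.hφ.prodMk contDiffOn_id) fun t ht => by simpa [strip] using ht

lemma dφ_eq (ht : t ∈ Icc 0 P.T) : P.dφ t = 6 * (P.a 0 (P.φ t) t / P.b 0 (P.φ t) t) :=
  (h.hφ' t ht).derivWithin (uniqueDiffOn_Icc h.hT t ht)

lemma κ_pos (ht : t ∈ Icc 0 P.T) : 0 < P.κ t :=
  half_pos (Real.sqrt_pos.2 (h.hpos t ht))

lemma contDiffOn_κ : ContDiffOn ℝ ∞ P.κ (Icc 0 P.T) :=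
  ((h.contDiffOn_curve (h.ha 0 (Nat.zero_le _))).sqrt fun t ht => (h.hpos t ht).ne').div_const 2

lemma contDiffOn_dφ : ContDiffOn ℝ ∞ P.dφ (Icc 0 P.T) := contDiffOn_derivWithin h.hT h.hφ

lemma a_eq (ht : t ∈ Icc 0 P.T) : P.a 0 (P.φ t) t = 4 * P.κ t ^ 2 := by
  rw [κ, div_pow, Real.sq_sqrt (h.hpos t ht).le]; ring

/-- The prescribed speed enters here. This relation eliminates `b₀` both from the equation of the
main term and from its linearization. -/
lemma b_mul_dφ (ht : t ∈ Icc 0 P.T) : P.b 0 (P.φ t) t * P.dφ t = 24 * P.κ t ^ 2 := by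
  have hb : P.b 0 (P.φ t) t ≠ 0 := right_ne_zero_of_mul (h.hab (P.φ t) t ht)
  rw [h.dφ_eq ht, ← mul_div_assoc, mul_div_cancel₀ _ hb, h.a_eq ht]; ring

lemma dφ_ne (ht : t ∈ Icc 0 P.T) : P.dφ t ≠ 0 := by
  have := h.b_mul_dφ ht
  have hk := h.κ_pos ht
  intro h0
  rw [h0, mul_zero] at this
  exact absurd this.symm (by positivity)

lemma v0_eq (ht : t ∈ Icc 0 P.T) :
    P.v0 t = fun τ => -P.dφ t * sechSq (P.κ t * τ + P.C₀ t) := by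
  funext τ
  rw [v0, sechSq_eq, h.dφ_eq ht, κ]
  ring_nf

lemma gtau_v0 (ht : t ∈ Icc 0 P.T) : gtau P.v0 t = fun τ => -P.dφ t * P.κ t *
    (-2 * Real.tanh (P.κ t * τ + P.C₀ t) * sechSq (P.κ t * τ + P.C₀ t)) :=
  gtau_affine (g' := fun z => -2 * Real.tanh z * sechSq z) (h.v0_eq ht) hasDerivAt_sechSq

lemma gtau2_v0 (ht : t ∈ Icc 0 P.T) : gtau (gtau P.v0) t = fun τ => -P.dφ t * P.κ t * P.κ t *
    (4 * sechSq (P.κ t * τ + P.C₀ t) - 6 * sechSq (P.κ t * τ + P.C₀ t) ^ 2) :=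
  gtau_affine (g := fun z => -2 * Real.tanh z * sechSq z)
    (g' := fun z => 4 * sechSq z - 6 * sechSq z ^ 2) (h.gtau_v0 ht) hasDerivAt_sechSq_deriv

lemma gtau3_v0 (ht : t ∈ Icc 0 P.T) : gtau (gtau (gtau P.v0)) t =
    fun τ => -P.dφ t * P.κ t * P.κ t * P.κ t * ((4 - 12 * sechSq (P.κ t * τ + P.C₀ t)) *
      (-2 * Real.tanh (P.κ t * τ + P.C₀ t) * sechSq (P.κ t * τ + P.C₀ t))) :=
  gtau_affine (g := fun z => 4 * sechSq z - 6 * sechSq z ^ 2)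
    (g' := fun z => (4 - 12 * sechSq z) * (-2 * Real.tanh z * sechSq z))
    (h.gtau2_v0 ht) hasDerivAt_sechSq_deriv2

lemma clRap_affine {f : ℝ → ℝ → ℝ → ℝ} (hf : ClRap P.T All f) :
    ClRap P.T All (affComp P.κ P.C₀ f) :=
  hf.affComp h.hT h.contDiffOn_κ h.hC₀ (fun _ ht => h.κ_pos ht) fun _ _ _ _ _ => trivial

lemma clRap_v0 : ClRap P.T All (emb P.v0) := by
  refine ((h.clRap_affine clRap_sechSq).mul_slow h.hT
    (ClSlow.of_t h.hT h.contDiffOn_dφ.neg)).congr Rap.respects fun x t ht τ => ?_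
  simp only [emb, h.v0_eq ht, Pi.mul_apply, affComp]
  ring

lemma regular : P.Regular where
  hT := h.hT
  ha := h.ha
  hb := h.hb
  hφ := h.hφ
  hv := h.clRap_v0
  hode := by
    intro t ht τ
    rw [h.gtau_v0 ht, h.gtau2_v0 ht, h.gtau3_v0 ht, h.v0_eq ht, h.a_eq ht]
    have hb := h.b_mul_dφ ht
    set z := P.κ t * τ + P.C₀ t
    simp only
    linear_combination (2 * P.dφ t ^ 2 * P.κ t * sechSq z ^ 3 * Real.tanh z) * hb

lemma v0_ne : P.v0 0 0 ≠ 0 := by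
  have ht : (0 : ℝ) ∈ Icc 0 P.T := ⟨le_rfl, h.hT.le⟩
  rw [h.v0_eq ht]
  exact mul_ne_zero (neg_ne_zero.2 (h.dφ_ne ht)) (sechSq_pos _).ne'

/-- The bracket is the expanded derivative of `((1 + S) g')' + (-4 + 4 S + 18 S²) g`; all dependence
on `t` is in the prefactor, so one fundamental system serves for all times. -/
lemma linOp_affine {v : ℝ → ℝ → ℝ} {g g₁ g₂ g₃ : ℝ → ℝ} (ht : t ∈ Icc 0 P.T)
    (hv : v t = fun τ => g (P.κ t * τ + P.C₀ t)) (hs : ContDiff ℝ ∞ (v t))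
    (h₁ : ∀ z, HasDerivAt g (g₁ z) z) (h₂ : ∀ z, HasDerivAt g₁ (g₂ z) z)
    (h₃ : ∀ z, HasDerivAt g₂ (g₃ z) z) {τ z : ℝ} (hz : z = P.κ t * τ + P.C₀ t) :
    P.linOp v t τ = P.κ t ^ 3 * P.dφ t * ((1 + sechSq z) * g₃ z
      + 2 * (-2 * Real.tanh z * sechSq z) * g₂ z
      + (-4 + 8 * sechSq z + 12 * sechSq z ^ 2) * g₁ z
      + (4 + 36 * sechSq z) * (-2 * Real.tanh z * sechSq z) * g z) := by
  have hv' : v t = fun τ => 1 * g (P.κ t * τ + P.C₀ t) := by simpa using hv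
  have e₁ := gtau_affine hv' h₁
  have e₂ := gtau_affine e₁ h₂
  have e₃ := gtau_affine e₂ h₃
  rw [linOp_eq (h.clRap_v0.1.contDiff_slice 0 ht) hs, e₁, e₂, e₃, hv, h.gtau_v0 ht, h.gtau2_v0 ht,
    h.gtau3_v0 ht, h.v0_eq ht, h.a_eq ht]
  have hb := h.b_mul_dφ ht
  simp only [← hz]
  linear_combination (2 * P.dφ t * P.κ t * sechSq z * (-2 * Real.tanh z * sechSq z) * g z
    + P.dφ t * P.κ t * sechSq z ^ 2 * g₁ z) * hb

end Data

end Setup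

end MCH

namespace MCH

/-! ### Smoothness of functions of `(t, z)` from bounds for partial derivatives -/

variable {T : ℝ}

/-- The increment is split into a step in `t`, treated by the mean value inequality and the joint
continuity of `ft`, and a step in `z` at the fixed time, where differentiability at one point
suffices. -/
lemma hasFDerivWithinAt_of_partial {f ft fz : ℝ → ℝ → ℝ}
    (ht : ∀ t ∈ Icc 0 T, ∀ z, HasDerivWithinAt (fun s => f s z) (ft t z) (Icc 0 T) t)
    (hz : ∀ t ∈ Icc 0 T, ∀ z, HasDerivAt (f t) (fz t z) z)
    (hc : ContinuousOn (fun p : ℝ × ℝ => ft p.1 p.2) (Icc 0 T ×ˢ univ))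
    {p : ℝ × ℝ} (hp : p ∈ Icc 0 T ×ˢ (univ : Set ℝ)) :
    HasFDerivWithinAt (fun p : ℝ × ℝ => f p.1 p.2)
      (ft p.1 p.2 • ContinuousLinearMap.fst ℝ ℝ ℝ + fz p.1 p.2 • ContinuousLinearMap.snd ℝ ℝ ℝ)
      (Icc 0 T ×ˢ univ) p := by
  obtain ⟨t, z⟩ := p
  have ht0 : t ∈ Icc 0 T := hp.1
  refine HasFDerivWithinAt.of_isLittleO (Asymptotics.isLittleO_iff.2 fun c hc0 => ?_)
  have hc2 : 0 < c / 2 := half_pos hc0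
  have h1 : ∀ᶠ q : ℝ × ℝ in 𝓝[Icc 0 T ×ˢ univ] (t, z),
      ‖f t q.2 - f t z - (q.2 - z) • fz t z‖ ≤ c / 2 * ‖q.2 - z‖ := by
    have := (Asymptotics.isLittleO_iff.1 (hasDerivAt_iff_isLittleO.1 (hz t ht0 z))) hc2
    exact ((continuous_snd.tendsto (t, z)).mono_left nhdsWithin_le_nhds).eventually this
  obtain ⟨δ, hδ, hδ'⟩ := Metric.continuousWithinAt_iff.1 (hc (t, z) hp) (c / 2) hc2
  have h2 : ∀ᶠ q : ℝ × ℝ in 𝓝[Icc 0 T ×ˢ univ] (t, z), q ∈ Metric.ball (t, z) δ :=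
    nhdsWithin_le_nhds (Metric.ball_mem_nhds _ hδ)
  filter_upwards [h1, h2, self_mem_nhdsWithin] with q hq1 hq2 hq3
  obtain ⟨s, w⟩ := q
  simp only [Metric.mem_ball, Prod.dist_eq, max_lt_iff] at hq2 hq1
  have h3 : ‖(f s w - ft t z * s) - (f t w - ft t z * t)‖ ≤ c / 2 * ‖s - t‖ := by
    refine Convex.norm_image_sub_le_of_norm_hasDerivWithin_le (s := Icc 0 T ∩ Metric.ball t δ)
      (f := fun s => f s w - ft t z * s) (f' := fun s => ft s w - ft t z) ?_ ?_
      ((convex_Icc 0 T).inter (convex_ball t δ)) ⟨ht0, Metric.mem_ball_self hδ⟩ ⟨hq3.1, hq2.1⟩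
    · intro s' hs'
      refine (((ht s' hs'.1 w).mono inter_subset_left).sub
        ((hasDerivWithinAt_id s' _).const_mul (ft t z))).congr_deriv (by ring)
    · intro s' hs'
      have := @hδ' (s', w) ⟨hs'.1, trivial⟩
        (by rw [Prod.dist_eq]; exact max_lt hs'.2 hq2.2)
      exact this.le
  have h4 : ‖s - t‖ ≤ ‖(s, w) - (t, z)‖ := norm_fst_le ((s, w) - (t, z))
  have h5 : ‖w - z‖ ≤ ‖(s, w) - (t, z)‖ := norm_snd_le ((s, w) - (t, z))
  have e : f s w - f t z - (ft t z • ContinuousLinearMap.fst ℝ ℝ ℝ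
      + fz t z • ContinuousLinearMap.snd ℝ ℝ ℝ) ((s, w) - (t, z)) =
      ((f s w - ft t z * s) - (f t w - ft t z * t)) + (f t w - f t z - (w - z) • fz t z) := by
    simp; ring
  simp only
  rw [e]
  refine (norm_add_le _ _).trans ?_
  calc _ ≤ c / 2 * ‖s - t‖ + c / 2 * ‖w - z‖ := add_le_add h3 hq1
    _ ≤ c / 2 * ‖(s, w) - (t, z)‖ + c / 2 * ‖(s, w) - (t, z)‖ := by gcongr
    _ = c * ‖(s, w) - (t, z)‖ := by ring

/-- Local bounds for the `t`-derivative make each member Lipschitz in `t`, hence jointly continuous.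
So the partial derivatives, again members, are jointly continuous, the function is `C¹`, and
induction gives `C^∞`. -/
lemma sm_of_family (hT : 0 < T) (A : (ℝ → ℝ → ℝ) → Prop)
    (hb : ∀ a, A a → ∀ R, ∃ C : ℝ, ∀ t ∈ Icc 0 T, ∀ z, |z| ≤ R → |a t z| ≤ C)
    (ht : ∀ a, A a → ∃ a', A a' ∧
      ∀ t ∈ Icc 0 T, ∀ z, HasDerivWithinAt (fun s => a s z) (a' t z) (Icc 0 T) t)
    (hz : ∀ a, A a → ∃ a', A a' ∧ ∀ t ∈ Icc 0 T, ∀ z, HasDerivAt (a t) (a' t z) z)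
    {f : ℝ → ℝ → ℝ} (hf : A f) : Sm T (emb f) := by
  have hcont : ∀ a, A a → ContinuousOn (fun p : ℝ × ℝ => a p.1 p.2) (Icc 0 T ×ˢ univ) := by
    rintro a ha ⟨t, z⟩ hp
    obtain ⟨a₁, ha₁, h₁⟩ := ht a ha
    have h1 : ∀ q ∈ Icc 0 T ×ˢ Metric.ball z 1,
        ‖a q.1 q.2 - a t z‖ ≤ (Classical.choose (hb a₁ ha₁ (|z| + 1))) * ‖q.1 - t‖
          + ‖a t q.2 - a t z‖ := by
      rintro ⟨s, w⟩ hq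
      have hC := Classical.choose_spec (hb a₁ ha₁ (|z| + 1))
      have hw : |w| ≤ |z| + 1 := by
        have := hq.2
        rw [Metric.mem_ball, Real.dist_eq] at this
        have := abs_sub_abs_le_abs_sub w z
        linarith
      have := Convex.norm_image_sub_le_of_norm_hasDerivWithin_le (fun s hs => h₁ s hs w)
        (fun s hs => hC s hs w hw) (convex_Icc 0 T) hp.1 hq.1
      calc ‖a s w - a t z‖ = ‖(a s w - a t w) + (a t w - a t z)‖ := by congr 1; ring
        _ ≤ _ := (norm_add_le _ _).trans (by gcongr)
    obtain ⟨a₂, ha₂, h₂⟩ := hz a ha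
    rw [ContinuousWithinAt, tendsto_iff_norm_sub_tendsto_zero]
    refine squeeze_zero' (Eventually.of_forall fun _ => norm_nonneg _)
      (g := fun q : ℝ × ℝ => (Classical.choose (hb a₁ ha₁ (|z| + 1))) * ‖q.1 - t‖
          + ‖a t q.2 - a t z‖) ?_ ?_
    · have : ∀ᶠ q : ℝ × ℝ in 𝓝[Icc 0 T ×ˢ univ] (t, z), q.2 ∈ Metric.ball z 1 :=
        ((continuous_snd.tendsto (t, z)).mono_left nhdsWithin_le_nhds).eventually
          (Metric.ball_mem_nhds z one_pos)
      filter_upwards [this, self_mem_nhdsWithin] with q h1' h2'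
      exact h1 q ⟨h2'.1, h1'⟩
    · have hcz : ContinuousAt (fun q : ℝ × ℝ => a t q.2) (t, z) :=
        ContinuousAt.comp (g := a t) (f := Prod.snd) (h₂ t hp.1 z).continuousAt continuousAt_snd
      have : ContinuousAt (fun q : ℝ × ℝ => (Classical.choose (hb a₁ ha₁ (|z| + 1))) * ‖q.1 - t‖
          + ‖a t q.2 - a t z‖) (t, z) := by
        refine ContinuousAt.add (by fun_prop) (ContinuousAt.norm (hcz.sub continuousAt_const))
      simpa using this.tendsto.mono_left nhdsWithin_le_nhds
  refine Sm.of_ts ?_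
  rw [contDiffOn_infty]
  intro n
  induction n generalizing f with
  | zero => exact contDiffOn_zero.2 (hcont f hf)
  | succ n ih =>
    obtain ⟨a₁, ha₁, h₁⟩ := ht f hf
    obtain ⟨a₂, ha₂, h₂⟩ := hz f hf
    have := (contDiffOn_succ_iff_hasFDerivWithinAt_of_uniqueDiffOn (𝕜 := ℝ) (n := n)
      (f := fun p : ℝ × ℝ => f p.1 p.2)
      ((uniqueDiffOn_Icc hT).prod uniqueDiffOn_univ)).2 ⟨by simp, _, ?_,
        fun p hp => hasFDerivWithinAt_of_partial h₁ h₂ (hcont _ ha₁) hp⟩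
    · exact_mod_cast this
    · exact ((ih ha₁).smul contDiffOn_const).add ((ih ha₂).smul contDiffOn_const)

/-! ### Integrals depending on a parameter -/

/-- Dominated convergence for difference quotients, which the mean value inequality bounds by the
majorant of the derivative. Slopes within the interval also cover the one-sided derivatives at its
ends. -/
lemma hasDerivWithinAt_integral {μ : Measure ℝ} {h h' : ℝ → ℝ → ℝ} {bound : ℝ → ℝ}
    (hint : ∀ t ∈ Icc 0 T, Integrable (h t) μ)
    (hd : ∀ t ∈ Icc 0 T, ∀ ζ, HasDerivWithinAt (fun s => h s ζ) (h' t ζ) (Icc 0 T) t)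
    (hb : ∀ᵐ ζ ∂μ, ∀ t ∈ Icc 0 T, |h' t ζ| ≤ bound ζ) (hbound : Integrable bound μ)
    {t : ℝ} (ht : t ∈ Icc 0 T) :
    HasDerivWithinAt (fun t => ∫ ζ, h t ζ ∂μ) (∫ ζ, h' t ζ ∂μ) (Icc 0 T) t := by
  rw [hasDerivWithinAt_iff_tendsto_slope]
  have hmem : ∀ᶠ s in 𝓝[Icc 0 T \ {t}] t, s ∈ Icc 0 T \ {t} := self_mem_nhdsWithin
  have key : Tendsto (fun s => ∫ ζ, slope (fun s => h s ζ) t s ∂μ) (𝓝[Icc 0 T \ {t}] t)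
      (𝓝 (∫ ζ, h' t ζ ∂μ)) := by
    refine tendsto_integral_filter_of_dominated_convergence bound ?_ ?_ hbound ?_
    · filter_upwards [hmem] with s hs
      simp only [slope_def_field]
      exact (((hint s hs.1).sub (hint t ht)).div_const _).aestronglyMeasurable
    · filter_upwards [hmem] with s hs
      filter_upwards [hb] with ζ hζ
      have := Convex.norm_image_sub_le_of_norm_hasDerivWithin_le (fun s hs => hd s hs ζ)
        hζ (convex_Icc 0 T) ht hs.1
      have hne : 0 < ‖s - t‖ := norm_pos_iff.2 (sub_ne_zero.2 hs.2)
      rw [slope_def_field, norm_div]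
      exact (div_le_iff₀ hne).2 this
    · exact Eventually.of_forall fun ζ => hasDerivWithinAt_iff_tendsto_slope.1 (hd t ht ζ)
  refine key.congr' ?_
  filter_upwards [hmem] with s hs
  simp only [slope_def_field]
  rw [integral_div, integral_sub (hint s hs.1) (hint t ht)]

/-- Primitives with respect to the second variable. -/
noncomputable def prim (h : ℝ → ℝ → ℝ) : ℝ → ℝ → ℝ := fun t z => ∫ ζ in (0 : ℝ)..z, h t ζ

lemma continuous_slice {h : ℝ → ℝ → ℝ} (hh : Sm T (emb h)) {t : ℝ} (ht : t ∈ Icc 0 T) :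
    Continuous (h t) := (hh.contDiff_slice 0 ht).continuous

lemma hasDerivAt_prim {h : ℝ → ℝ → ℝ} (hh : Sm T (emb h)) {t : ℝ} (ht : t ∈ Icc 0 T) (z : ℝ) :
    HasDerivAt (prim h t) (h t z) z :=
  ((continuous_slice hh ht).integral_hasStrictDerivAt 0 z).hasDerivAt

lemma hasDerivWithinAt_prim (hT : 0 < T) {h : ℝ → ℝ → ℝ} (hh : Sm T (emb h)) {t : ℝ}
    (ht : t ∈ Icc 0 T) (z : ℝ) :
    HasDerivWithinAt (fun s => prim h s z) (prim (gt T h) t z) (Icc 0 T) t := by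
  have hh' : Sm T (emb (gt T h)) := hh.pd hT Dir.t
  have key : ∀ a b : ℝ, HasDerivWithinAt (fun s => ∫ ζ in Ioc a b, h s ζ)
      (∫ ζ in Ioc a b, gt T h t ζ) (Icc 0 T) t := by
    intro a b
    obtain ⟨C, h0, hC⟩ := hh'.bounded 0 (max |a| |b|)
    refine hasDerivWithinAt_integral (bound := fun _ => C) (fun s hs => ?_)
      (fun s hs ζ => hh.hasDeriv_t hT hs 0 ζ) ?_ (integrable_const C) ht
    · exact ((continuous_slice hh hs).integrableOn_Icc).mono_set Ioc_subset_Icc_self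
    · refine (ae_restrict_mem measurableSet_Ioc).mono fun ζ hζ s hs => ?_
      exact hC 0 s ζ (by simp) hs (abs_le_max_abs_abs hζ.1.le hζ.2)
  simp only [prim, intervalIntegral]
  exact (key 0 z).sub (key z 0)

lemma abs_prim_le {h : ℝ → ℝ → ℝ} {t z C : ℝ} (hC : ∀ ζ, |ζ| ≤ |z| → |h t ζ| ≤ C) :
    |prim h t z| ≤ C * |z| := by
  have := intervalIntegral.norm_integral_le_of_norm_le_const (a := 0) (b := z) (f := h t) (C := C)
    (fun ζ hζ => hC ζ ?_)
  · simpa [prim] using this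
  · rcases le_total 0 z with h0 | h0
    · rw [uIoc_of_le h0] at hζ
      rw [abs_of_pos hζ.1, abs_of_nonneg h0]; exact hζ.2
    · rw [uIoc_of_ge h0] at hζ
      rw [abs_of_nonpos hζ.2, abs_of_nonpos h0]; linarith [hζ.1]

lemma Sm.prim (hT : 0 < T) {h : ℝ → ℝ → ℝ} (hh : Sm T (emb h)) : Sm T (emb (prim h)) := by
  have : Sm T (emb fun t z => MCH.prim h t z + 0) := by
    -- The summand `k` closes the family: `∂_z` sends `prim h + k` to `h + ∂_z k`, which is of the
    -- same form with zero primitive.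
    refine sm_of_family hT (fun a => ∃ h k : ℝ → ℝ → ℝ, Sm T (emb h) ∧ Sm T (emb k) ∧
      a = fun t z => MCH.prim h t z + k t z) ?_ ?_ ?_ ⟨h, fun _ _ => 0, hh, Sm.const 0, rfl⟩
    · rintro a ⟨h, k, hh, hk, rfl⟩ R
      obtain ⟨C, h0, hC⟩ := hh.bounded 0 R
      obtain ⟨C', h0', hC'⟩ := hk.bounded 0 R
      refine ⟨C * R + C', fun t ht z hz => ?_⟩
      refine (abs_add_le _ _).trans (add_le_add ?_ (hC' 0 t z (by simp) ht hz))
      exact (abs_prim_le fun ζ hζ => hC 0 t ζ (by simp) ht (hζ.trans hz)).trans (by gcongr)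
    · rintro a ⟨h, k, hh, hk, rfl⟩
      exact ⟨_, ⟨gt T h, gt T k, hh.pd hT Dir.t, hk.pd hT Dir.t, rfl⟩, fun t ht z =>
        (hasDerivWithinAt_prim hT hh ht z).add (hk.hasDeriv_t hT ht 0 z)⟩
    · rintro a ⟨h, k, hh, hk, rfl⟩
      refine ⟨_, ⟨fun _ _ => 0, h + gtau k, Sm.const 0, hh.add (hk.pd hT Dir.s), rfl⟩,
        fun t ht z => ((hasDerivAt_prim hh ht z).add (hk.hasDeriv_s hT ht 0 z)).congr_deriv ?_⟩
      simp [MCH.prim, gtau, dTau, emb]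
  simpa using this

/-- An integrable majorant independent of `t`, from `1 + ζ² ≤ (1 + |ζ|)²`. -/
lemma Rap.bound_inv {h : ℝ → ℝ → ℝ} (hh : Rap T All (emb h)) :
    ∃ C : ℝ, 0 ≤ C ∧ ∀ t ∈ Icc 0 T, ∀ ζ, |h t ζ| ≤ C * (1 + ζ ^ 2)⁻¹ := by
  obtain ⟨C, h0, hC⟩ := hh 2 0
  refine ⟨C, h0, fun t ht ζ => ?_⟩
  have h1 := hC 0 t ζ (by simp) ht trivial
  rw [← div_eq_mul_inv, le_div_iff₀ (by positivity), mul_comm]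
  refine le_trans ?_ h1
  change (1 + ζ ^ 2) * |h t ζ| ≤ (1 + |ζ|) ^ 2 * |h t ζ|
  gcongr
  nlinarith [abs_nonneg ζ, sq_abs ζ]

lemma ClRap.integrable {h : ℝ → ℝ → ℝ} (hh : ClRap T All (emb h)) {t : ℝ} (ht : t ∈ Icc 0 T) :
    Integrable (h t) := by
  obtain ⟨C, h0, hC⟩ := hh.base.bound_inv
  exact (integrable_inv_one_add_sq.const_mul C).mono' (continuous_slice hh.1 ht).aestronglyMeasurable
    (Eventually.of_forall fun ζ => hC t ht ζ)

lemma ClRap.hasDerivWithinAt_setIntegral (hT : 0 < T) {h : ℝ → ℝ → ℝ} (hh : ClRap T All (emb h))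
    (s : Set ℝ) {t : ℝ} (ht : t ∈ Icc 0 T) :
    HasDerivWithinAt (fun t => ∫ ζ in s, h t ζ) (∫ ζ in s, gt T h t ζ) (Icc 0 T) t := by
  obtain ⟨C, h0, hC⟩ := Rap.bound_inv (h := gt T h) (hh.pd hT Dir.t).base
  exact hasDerivWithinAt_integral (bound := fun ζ => C * (1 + ζ ^ 2)⁻¹)
    (fun s hs => (hh.integrable hs).integrableOn) (fun s hs ζ => hh.1.hasDeriv_t hT hs 0 ζ)
    (Eventually.of_forall fun ζ s hs => hC s hs ζ)
    (integrable_inv_one_add_sq.const_mul C).integrableOn ht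

lemma abs_setIntegral_le {h : ℝ → ℝ} {M : ℝ} {s : Set ℝ} (hs : MeasurableSet s) (hM : 0 ≤ M)
    (hh : ∀ ζ ∈ s, |h ζ| ≤ M * (1 + ζ ^ 2)⁻¹) : |∫ ζ in s, h ζ| ≤ M * Real.pi := by
  have h1 : ‖∫ ζ in s, h ζ‖ ≤ ∫ ζ in s, M * (1 + ζ ^ 2)⁻¹ :=
    norm_integral_le_of_norm_le (integrable_inv_one_add_sq.const_mul M).integrableOn
      ((ae_restrict_mem hs).mono fun ζ hζ => hh ζ hζ)
  refine h1.trans ?_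
  rw [← integral_univ_inv_one_add_sq, ← integral_const_mul]
  exact setIntegral_le_integral (integrable_inv_one_add_sq.const_mul M)
    (Eventually.of_forall fun ζ => by positivity)

lemma ClRap.sm_setIntegral (hT : 0 < T) {h : ℝ → ℝ → ℝ} (hh : ClRap T All (emb h)) {s : Set ℝ}
    (hs : MeasurableSet s) : Sm T (emb fun t _ => ∫ ζ in s, h t ζ) := by
  refine sm_of_family hT (fun a => ∃ h : ℝ → ℝ → ℝ, ClRap T All (emb h) ∧
    a = fun t _ => ∫ ζ in s, h t ζ) ?_ ?_ ?_ ⟨h, hh, rfl⟩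
  · rintro a ⟨h, hh, rfl⟩ R
    obtain ⟨C, h0, hC⟩ := hh.base.bound_inv
    exact ⟨_, fun t ht z _ => abs_setIntegral_le hs h0 fun ζ _ => hC t ht ζ⟩
  · rintro a ⟨h, hh, rfl⟩
    exact ⟨_, ⟨gt T h, hh.pd hT Dir.t, rfl⟩, fun t ht _ => hh.hasDerivWithinAt_setIntegral hT s ht⟩
  · rintro a ⟨h, hh, rfl⟩
    exact ⟨_, ⟨fun _ _ => 0, ClRap.zero, rfl⟩, fun t ht z =>
      (hasDerivAt_const z _).congr_deriv (by simp)⟩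

/-! ### Tail integrals -/

/-- The integral over `(z, ∞)`, with respect to the second variable. -/
noncomputable def tail (h : ℝ → ℝ → ℝ) : ℝ → ℝ → ℝ := fun t z => ∫ ζ in Ioi z, h t ζ

lemma tail_eq {h : ℝ → ℝ → ℝ} (hh : ClRap T All (emb h)) {t : ℝ} (ht : t ∈ Icc 0 T) (z : ℝ) :
    tail h t z = (∫ ζ in Ioi 0, h t ζ) - prim h t z := by
  have := intervalIntegral.integral_interval_add_Ioi (a := 0) (b := z)
    (hh.integrable ht).integrableOn (hh.integrable ht).integrableOn
  rw [tail, prim, ← this]; ring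

lemma ClRap.sm_tail (hT : 0 < T) {h : ℝ → ℝ → ℝ} (hh : ClRap T All (emb h)) :
    Sm T (emb (tail h)) :=
  ((hh.sm_setIntegral hT (s := Ioi 0) measurableSet_Ioi).sub (hh.1.prim hT)).congr
    fun _ _ ht z => (tail_eq hh ht z).symm

lemma hasDerivWithinAt_tail (hT : 0 < T) {h : ℝ → ℝ → ℝ} (hh : ClRap T All (emb h)) {t : ℝ}
    (ht : t ∈ Icc 0 T) (z : ℝ) :
    HasDerivWithinAt (fun s => tail h s z) (tail (gt T h) t z) (Icc 0 T) t :=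
  hh.hasDerivWithinAt_setIntegral hT (Ioi z) ht

lemma hasDerivAt_tail {h : ℝ → ℝ → ℝ} (hh : ClRap T All (emb h)) {t : ℝ}
    (ht : t ∈ Icc 0 T) (z : ℝ) : HasDerivAt (tail h t) (-h t z) z := by
  have := (hasDerivAt_prim hh.1 ht z).const_sub (∫ ζ in Ioi 0, h t ζ)
  exact this.congr_of_eventuallyEq (Eventually.of_forall fun z => tail_eq hh ht z)

/-- A bound for the tail from a bound for the integrand which is even and decreasing in `|ζ|`. -/
lemma abs_tail_le {h : ℝ → ℝ → ℝ} (hh : ClRap T All (emb h)) {t z M : ℝ} (ht : t ∈ Icc 0 T)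
    (h0 : ∫ ζ, h t ζ = 0) (hM : 0 ≤ M)
    (hb : ∀ ζ, |z| ≤ |ζ| → |h t ζ| ≤ M * (1 + ζ ^ 2)⁻¹) : |tail h t z| ≤ M * Real.pi := by
  rcases le_total 0 z with hz | hz
  · refine abs_setIntegral_le measurableSet_Ioi hM fun ζ hζ => hb ζ ?_
    rw [abs_of_nonneg hz, abs_of_nonneg (hz.trans (le_of_lt hζ))]; exact le_of_lt hζ
  -- Zero mean allows the integral over the other half-line, on which `|ζ| ≥ |z|`.
  · have e : tail h t z = -∫ ζ in Iic z, h t ζ := by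
      have := intervalIntegral.integral_Iic_add_Ioi (b := z) (hh.integrable ht).integrableOn
        (hh.integrable ht).integrableOn
      rw [h0] at this
      rw [tail]; linarith
    rw [e, abs_neg]
    refine abs_setIntegral_le measurableSet_Iic hM fun ζ hζ => hb ζ ?_
    have hζ' : ζ ≤ z := hζ
    rw [abs_of_nonpos hz, abs_of_nonpos (hζ'.trans hz)]; linarith

lemma integral_gt_eq_zero (hT : 0 < T) {h : ℝ → ℝ → ℝ} (hh : ClRap T All (emb h))
    (h0 : ∀ t ∈ Icc 0 T, ∫ ζ, h t ζ = 0) : ∀ t ∈ Icc 0 T, ∫ ζ, gt T h t ζ = 0 := by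
  intro t ht
  have h1 := hh.hasDerivWithinAt_setIntegral hT univ ht
  simp only [setIntegral_univ] at h1
  have h2 : HasDerivWithinAt (fun t => ∫ ζ, h t ζ) 0 (Icc 0 T) t :=
    (hasDerivWithinAt_const t _ (0 : ℝ)).congr (fun s hs => h0 s hs) (h0 t ht)
  exact (uniqueDiffOn_Icc hT t ht).eq_deriv _ h1 h2

/-- Functions of zero mean have rapidly decreasing primitives. -/
lemma ClRap.tail (hT : 0 < T) {h : ℝ → ℝ → ℝ} (hh : ClRap T All (emb h))
    (h0 : ∀ t ∈ Icc 0 T, ∫ ζ, h t ζ = 0) : ClRap T All (emb (tail h)) := by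
  refine Cl.of_family Rap.respects (fun a => ClRap T All a ∨ ∃ h : ℝ → ℝ → ℝ, ClRap T All (emb h) ∧
    (∀ t ∈ Icc 0 T, ∫ ζ, h t ζ = 0) ∧ a = emb (MCH.tail h)) ?_ ?_ ?_ (Or.inr ⟨h, hh, h0, rfl⟩)
  · rintro a (ha | ⟨h, hh, h0, rfl⟩)
    · exact ha.1
    · exact hh.sm_tail hT
  · rintro a (ha | ⟨h, hh, h0, rfl⟩)
    · exact ha.base
    · intro n R
      obtain ⟨C, hC0, hC⟩ := hh.base (n + 2) R
      refine ⟨C * Real.pi, by positivity, fun x t z hx ht _ => ?_⟩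
      have h1 := abs_tail_le (M := C / (1 + |z|) ^ n) hh ht (h0 t ht) (by positivity) (z := z)
        fun ζ hζ => ?_
      · change (1 + |z|) ^ n * |MCH.tail h t z| ≤ _
        calc (1 + |z|) ^ n * |MCH.tail h t z| ≤ (1 + |z|) ^ n * (C / (1 + |z|) ^ n * Real.pi) := by
              gcongr
          _ = C * Real.pi := by field_simp
      · have h2 : (1 + |ζ|) ^ (n + 2) * |h t ζ| ≤ C := hC x t ζ hx ht trivial
        rw [← div_eq_mul_inv, div_div, le_div_iff₀ (by positivity)]
        refine le_trans ?_ h2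
        rw [mul_comm, pow_add]
        gcongr
        nlinarith [abs_nonneg ζ, sq_abs ζ]
  · rintro a (ha | ⟨h, hh, h0, rfl⟩) i
    · exact ⟨_, Or.inl (ha.pd hT i), EqD.refl _⟩
    · cases i
      · exact ⟨_, Or.inl ClRap.zero, fun x t _ τ => by simp [MCH.pd, dX, emb]⟩
      · exact ⟨_, Or.inr ⟨gt T h, hh.pd hT Dir.t, integral_gt_eq_zero hT hh h0, rfl⟩,
          fun x t ht τ => (hasDerivWithinAt_tail hT hh ht τ).derivWithin (uniqueDiffOn_Icc hT t ht)⟩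
      · exact ⟨_, Or.inl (hh.neg hT), fun x t ht τ => (hasDerivAt_tail hh ht τ).deriv⟩

end MCH

namespace MCH

/-! ### A fundamental system of the linearized equation

The functions `w₁` and `w₂` solve `((1 + S) w')' + (-4 + 4 S + 18 S²) w = 0`, where `S = cosh⁻²`. -/

/-- The decreasing solution `w₁ = S'`. -/
noncomputable def solA (z : ℝ) : ℝ := -2 * Real.tanh z * sechSq z

/-- The derivative of the decreasing solution. -/
noncomputable def solA' (z : ℝ) : ℝ := 4 * sechSq z - 6 * sechSq z ^ 2

/-- The coefficient of order zero of the linearized equation. -/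
noncomputable def potential (z : ℝ) : ℝ := -4 + 4 * sechSq z + 18 * sechSq z ^ 2

/-- The derivative of the function which defines the increasing solution by reduction of order. -/
noncomputable def redInt (z : ℝ) : ℝ := 1 + Real.cosh z ^ 4 - (1 - (1 + sechSq z)⁻¹) / 2

/-- The primitive of `redInt`. -/
noncomputable def red (z : ℝ) : ℝ := prim (fun _ => redInt) 0 z

/-- The increasing solution `w₂`. -/
noncomputable def solB (z : ℝ) : ℝ := sechSq z / 4 + solA z / 4 * red z

/-- The derivative of the increasing solution. -/
noncomputable def solB' (z : ℝ) : ℝ := solA z / 4 + (solA' z / 4 * red z + solA z / 4 * redInt z)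

lemma TanhAlg.solA : TanhAlg solA := (TanhAlg.smul (-2) .tanh).mul .sech

lemma TanhAlg.potential : TanhAlg potential := by
  have := ((const (-4)).add (smul 4 sech)).add (smul 18 (sech.mul sech))
  convert this using 1
  funext z
  simp only [MCH.potential, Pi.add_apply, Pi.mul_apply, sq]

lemma hasDerivAt_solA (z : ℝ) : HasDerivAt solA (solA' z) z := hasDerivAt_sechSq_deriv z

lemma hasDerivAt_solA' (z : ℝ) : HasDerivAt solA' ((4 - 12 * sechSq z) * solA z) z :=
  hasDerivAt_sechSq_deriv2 z

lemma sm_redInt {T : ℝ} : Sm T (emb fun _ => redInt) := by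
  refine Sm.of_s (u := redInt) ?_
  exact (contDiff_const.add (Real.contDiff_cosh.pow 4)).sub
    ((contDiff_const.sub TanhAlg.inv.contDiff).div_const 2)

lemma hasDerivAt_red (z : ℝ) : HasDerivAt red (redInt z) z :=
  hasDerivAt_prim (T := 1) (h := fun _ => redInt) sm_redInt ⟨le_rfl, zero_le_one⟩ z

lemma hasDerivAt_solB (z : ℝ) : HasDerivAt solB (solB' z) z :=
  ((hasDerivAt_sechSq z).div_const 4).add (((hasDerivAt_solA z).div_const 4).mul (hasDerivAt_red z))

lemma hasDerivAt_redInt (z : ℝ) : HasDerivAt redInt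
    (4 * Real.tanh z * Real.cosh z ^ 4 + Real.tanh z * sechSq z * ((1 + sechSq z)⁻¹) ^ 2) z := by
  have hp := sechSq_pos z
  have h1 := ((hasDerivAt_sechSq z).const_add 1).inv (by positivity)
  have h2 := ((Real.hasDerivAt_cosh z).pow 4).const_add 1
  refine (h2.sub ((h1.const_sub 1).div_const 2)).congr_deriv ?_
  have hs : Real.sinh z = Real.tanh z * Real.cosh z := by
    rw [Real.tanh_eq_sinh_div_cosh, div_mul_cancel₀ _ (Real.cosh_pos z).ne']
  rw [hs]
  field_simp
  push_cast
  norm_num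
  ring_nf
  simp

lemma cosh_pow_mul_sechSq (z : ℝ) : Real.cosh z ^ 4 * sechSq z ^ 2 = 1 := by
  have := (Real.cosh_pos z).ne'
  rw [sechSq_eq]
  field_simp

/-- Reduction of order suggests `w₂ = w₁ ∫ dz / ((1 + S) w₁²)` with `w₁² = 4 (1 - S) S²`. By partial
fractions four times the integrand is `cosh⁴ + (1/2) tanh⁻² + (1/2) (1 + S)⁻¹`. The singular part of
`tanh⁻²` integrates to `-coth`, and its product with `w₁` is the regular term `S / 4` of `solB`;
what remains is `redInt`. The equation is checked on the resulting globally smooth formula. -/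
lemma hasDerivAt_solB' (z : ℝ) : HasDerivAt solB'
    ((1 + sechSq z)⁻¹ * (-(solA z * solB' z) - potential z * solB z)) z := by
  have h1 := ((hasDerivAt_solA z).div_const 4)
  have h2 := ((hasDerivAt_solA' z).div_const 4).mul (hasDerivAt_red z)
  refine (h1.add (h2.add (h1.mul (hasDerivAt_redInt z)))).congr_deriv ?_
  have hr : (1 + sechSq z) * (1 + sechSq z)⁻¹ = 1 :=
    mul_inv_cancel₀ (by have := sechSq_pos z; positivity)
  have hc := cosh_pow_mul_sechSq z
  have hy : Real.tanh z ^ 2 = 1 - sechSq z := by rw [sechSq]; ring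
  simp only [solB', solB, solA, solA', redInt, potential]
  generalize Real.tanh z = y at *
  generalize (1 + sechSq z)⁻¹ = r at *
  generalize sechSq z = S at *
  generalize Real.cosh z ^ 4 = c at *
  generalize red z = B at *
  grind

/-- By Abel's identity the product is constant for a self-adjoint equation; the factors `1 / 4` in
`solB` normalize it to one. -/
lemma wronskian (z : ℝ) : (1 + sechSq z) * (solA z * solB' z - solA' z * solB z) = 1 := by
  have hr : (1 + sechSq z) * (1 + sechSq z)⁻¹ = 1 :=
    mul_inv_cancel₀ (by have := sechSq_pos z; positivity)
  have hc := cosh_pow_mul_sechSq z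
  have hy : Real.tanh z ^ 2 = 1 - sechSq z := by rw [sechSq]; ring
  simp only [solB', solB, solA, solA', redInt]
  generalize Real.tanh z = y at *
  generalize (1 + sechSq z)⁻¹ = r at *
  generalize sechSq z = S at *
  generalize Real.cosh z ^ 4 = c at *
  generalize red z = B at *
  grind

/-! ### Bounds for the fundamental system -/

lemma abs_mul_sechSq_le (n : ℝ) {a z : ℝ} (ha : |a| ≤ n) (hn : 0 ≤ n) :
    |a * sechSq z| ≤ n * 4 * Real.exp (-(2 * |z|)) := by
  rw [abs_mul, abs_of_pos (sechSq_pos z), mul_assoc]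
  exact mul_le_mul ha (sechSq_le_exp z) (sechSq_pos z).le hn

lemma abs_solA_le (z : ℝ) : |solA z| ≤ 24 * Real.exp (-(2 * |z|)) := by
  have h := abs_mul_sechSq_le 2 (a := -2 * Real.tanh z) (z := z)
    (by rw [abs_mul]; norm_num; linarith [Real.abs_tanh_lt_one z]) (by norm_num)
  have := Real.exp_pos (-(2 * |z|))
  exact h.trans (by linarith)

lemma abs_solA'_le (z : ℝ) : |solA' z| ≤ 24 * Real.exp (-(2 * |z|)) := by
  have h := abs_mul_sechSq_le 6 (a := 4 - 6 * sechSq z) (z := z)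
    (by rw [abs_le]; constructor <;> linarith [sechSq_pos z, sechSq_le_one z]) (by norm_num)
  rw [solA', show 4 * sechSq z - 6 * sechSq z ^ 2 = (4 - 6 * sechSq z) * sechSq z by ring]
  linarith

lemma cosh_le_exp_abs (z : ℝ) : Real.cosh z ≤ Real.exp |z| := by
  rw [← Real.cosh_abs, Real.cosh_eq]
  have : Real.exp (-|z|) ≤ Real.exp |z| := Real.exp_le_exp.2 (by linarith [abs_nonneg z])
  linarith

lemma abs_redInt_le (z : ℝ) : |redInt z| ≤ 2 * Real.exp (4 * |z|) := by
  have hp := sechSq_pos z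
  have h1 : (1 + sechSq z)⁻¹ ≤ 1 := inv_le_one_of_one_le₀ (by linarith)
  have h2 : 0 < (1 + sechSq z)⁻¹ := by positivity
  have h3 : Real.cosh z ^ 4 ≤ Real.exp (4 * |z|) := by
    have : Real.exp (4 * |z|) = Real.exp |z| ^ 4 := by rw [← Real.exp_nat_mul]; norm_num
    rw [this]
    exact pow_le_pow_left₀ (Real.cosh_pos z).le (cosh_le_exp_abs z) 4
  have h4 : 1 ≤ Real.exp (4 * |z|) := Real.one_le_exp (by positivity)
  have h5 : 0 < Real.cosh z ^ 4 := by have := Real.cosh_pos z; positivity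
  rw [redInt, abs_le]
  constructor <;> linarith

lemma abs_red_le (z : ℝ) : |red z| ≤ 2 * Real.exp (4 * |z|) * |z| := by
  refine abs_prim_le fun ζ hζ => (abs_redInt_le ζ).trans ?_
  gcongr

lemma exp_neg_mul_exp (z : ℝ) :
    Real.exp (-(2 * |z|)) * Real.exp (4 * |z|) = Real.exp (2 * |z|) := by
  rw [← Real.exp_add]; ring_nf

lemma abs_mul_red_le {a z : ℝ} (ha : |a| ≤ 24 * Real.exp (-(2 * |z|))) :
    |a / 4 * red z| ≤ 12 * |z| * Real.exp (2 * |z|) := by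
  rw [abs_mul, abs_div, abs_of_pos (by norm_num : (0:ℝ) < 4), ← exp_neg_mul_exp]
  calc |a| / 4 * |red z|
      ≤ 24 * Real.exp (-(2 * |z|)) / 4 * (2 * Real.exp (4 * |z|) * |z|) := by
        gcongr; exact abs_red_le z
    _ = _ := by ring

lemma abs_solB_le (z : ℝ) : |solB z| ≤ 40 * (1 + |z|) * Real.exp (2 * |z|) := by
  have h1 := abs_mul_red_le (abs_solA_le z)
  have h2 : 1 ≤ Real.exp (2 * |z|) := Real.one_le_exp (by positivity)
  have h3 : |sechSq z / 4| ≤ Real.exp (2 * |z|) := by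
    rw [abs_of_pos (by linarith [sechSq_pos z])]; linarith [sechSq_le_one z]
  have h4 : 0 ≤ |z| * Real.exp (2 * |z|) := by positivity
  refine (abs_add_le _ _).trans ?_
  nlinarith

lemma abs_solB'_le (z : ℝ) : |solB' z| ≤ 40 * (1 + |z|) * Real.exp (2 * |z|) := by
  have h1 := abs_mul_red_le (abs_solA'_le z)
  have h2 : 1 ≤ Real.exp (2 * |z|) := Real.one_le_exp (by positivity)
  have h3 : |solA z / 4| ≤ 6 * Real.exp (2 * |z|) := by
    have h := abs_solA_le z
    have : Real.exp (-(2 * |z|)) ≤ 1 := Real.exp_le_one_iff.2 (by linarith [abs_nonneg z])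
    rw [abs_div, abs_of_pos (by norm_num : (0:ℝ) < 4)]
    linarith
  have h4 : |solA z / 4 * redInt z| ≤ 12 * Real.exp (2 * |z|) := by
    rw [abs_mul, abs_div, abs_of_pos (by norm_num : (0:ℝ) < 4), ← exp_neg_mul_exp]
    calc |solA z| / 4 * |redInt z|
        ≤ 24 * Real.exp (-(2 * |z|)) / 4 * (2 * Real.exp (4 * |z|)) := by
          gcongr
          · exact abs_solA_le z
          · exact abs_redInt_le z
      _ = _ := by ring
  have h5 : 0 ≤ |z| * Real.exp (2 * |z|) := by positivity
  refine (abs_add_le _ _).trans ((add_le_add le_rfl (abs_add_le _ _)).trans ?_)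
  nlinarith

/-! ### The inverse of the linearized operator -/

variable {T : ℝ} {g : ℝ → ℝ → ℝ}

/-- The solution of `((1 + S) ψ')' + (-4 + 4 S + 18 S²) ψ = g` given by variation of parameters. -/
noncomputable def green (g : ℝ → ℝ → ℝ) (t z : ℝ) : ℝ :=
  -(solB z * tail (fun t z => solA z * g t z) t z + solA z * prim (fun t z => solB z * g t z) t z)

/-- The derivative of `green`. -/
noncomputable def green' (g : ℝ → ℝ → ℝ) (t z : ℝ) : ℝ :=
  -(solB' z * tail (fun t z => solA z * g t z) t z + solA' z * prim (fun t z => solB z * g t z) t z)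

lemma contDiff_red : ContDiff ℝ ∞ red :=
  (Sm.prim (T := 1) one_pos (h := fun _ => redInt) sm_redInt).contDiff_slice 0
    (t := 0) ⟨le_rfl, zero_le_one⟩

lemma contDiff_solB : ContDiff ℝ ∞ solB :=
  (TanhAlg.sech.contDiff.div_const 4).add ((TanhAlg.solA.contDiff.div_const 4).mul contDiff_red)

lemma contDiff_solA' : ContDiff ℝ ∞ solA' :=
  (contDiff_const.mul TanhAlg.sech.contDiff).sub (contDiff_const.mul (TanhAlg.sech.contDiff.pow 2))

lemma contDiff_solB' : ContDiff ℝ ∞ solB' := by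
  have h : ContDiff ℝ ∞ redInt := (sm_redInt (T := 1)).contDiff_slice 0 (t := 0)
    ⟨le_rfl, zero_le_one⟩
  exact (TanhAlg.solA.contDiff.div_const 4).add (((contDiff_solA'.div_const 4).mul contDiff_red).add
    ((TanhAlg.solA.contDiff.div_const 4).mul h))

lemma ClRap.solA_mul (hT : 0 < T) (hg : ClRap T All (emb g)) :
    ClRap T All (emb fun t z => solA z * g t z) := by
  have := ClRap.mul_slow hT hg (TanhAlg.solA.clSlow (S := All))
  rwa [mul_comm] at this

lemma sm_solB_mul (hg : ClRap T All (emb g)) : Sm T (emb fun t z => solB z * g t z) :=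
  (Sm.of_s contDiff_solB).mul hg.1

lemma gt_mul (w : ℝ → ℝ) (g : ℝ → ℝ → ℝ) :
    gt T (fun t z => w z * g t z) = fun t z => w z * gt T g t z := by
  funext t z
  simp only [gt]
  exact derivWithin_const_mul_field _

lemma sm_green (hT : 0 < T) (hg : ClRap T All (emb g)) : Sm T (emb (green g)) :=
  (((Sm.of_s contDiff_solB).mul ((hg.solA_mul hT).sm_tail hT)).add
    ((Sm.of_s TanhAlg.solA.contDiff).mul ((sm_solB_mul hg).prim hT))).neg

lemma sm_green' (hT : 0 < T) (hg : ClRap T All (emb g)) : Sm T (emb (green' g)) :=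
  (((Sm.of_s contDiff_solB').mul ((hg.solA_mul hT).sm_tail hT)).add
    ((Sm.of_s contDiff_solA').mul ((sm_solB_mul hg).prim hT))).neg

lemma hasDerivWithinAt_green (hT : 0 < T) (hg : ClRap T All (emb g)) {t : ℝ} (ht : t ∈ Icc 0 T)
    (z : ℝ) :
    HasDerivWithinAt (fun s => green g s z) (green (gt T g) t z) (Icc 0 T) t := by
  have h1 := hasDerivWithinAt_tail hT (hg.solA_mul hT) ht z
  have h2 := hasDerivWithinAt_prim hT (sm_solB_mul hg) ht z
  rw [gt_mul] at h1 h2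
  exact ((h1.const_mul (solB z)).add (h2.const_mul (solA z))).neg

lemma hasDerivWithinAt_green' (hT : 0 < T) (hg : ClRap T All (emb g)) {t : ℝ} (ht : t ∈ Icc 0 T)
    (z : ℝ) :
    HasDerivWithinAt (fun s => green' g s z) (green' (gt T g) t z) (Icc 0 T) t := by
  have h1 := hasDerivWithinAt_tail hT (hg.solA_mul hT) ht z
  have h2 := hasDerivWithinAt_prim hT (sm_solB_mul hg) ht z
  rw [gt_mul] at h1 h2
  exact ((h1.const_mul (solB' z)).add (h2.const_mul (solA' z))).neg

lemma hasDerivAt_green (hT : 0 < T) (hg : ClRap T All (emb g)) {t : ℝ} (ht : t ∈ Icc 0 T)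
    (z : ℝ) : HasDerivAt (green g t) (green' g t z) z := by
  have h1 := hasDerivAt_tail (hg.solA_mul hT) ht z
  have h2 := hasDerivAt_prim (sm_solB_mul hg) ht z
  refine (((hasDerivAt_solB z).mul h1).add ((hasDerivAt_solA z).mul h2)).neg.congr_deriv ?_
  simp only [green']
  ring

lemma hasDerivAt_green' (hT : 0 < T) (hg : ClRap T All (emb g)) {t : ℝ} (ht : t ∈ Icc 0 T)
    (z : ℝ) : HasDerivAt (green' g t)
      ((1 + sechSq z)⁻¹ * (g t z - solA z * green' g t z - potential z * green g t z)) z := by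
  have h1 := hasDerivAt_tail (hg.solA_mul hT) ht z
  have h2 := hasDerivAt_prim (sm_solB_mul hg) ht z
  refine (((hasDerivAt_solB' z).mul h1).add ((hasDerivAt_solA' z).mul h2)).neg.congr_deriv ?_
  simp only [green', green]
  have hw := wronskian z
  have hr : (1 + sechSq z) * (1 + sechSq z)⁻¹ = 1 :=
    mul_inv_cancel₀ (by have := sechSq_pos z; positivity)
  have hA : (4 - 12 * sechSq z) * solA z =
      (1 + sechSq z)⁻¹ * (-(solA z * solA' z) - potential z * solA z) := by
    simp only [solA', potential]
    linear_combination (-(4 - 12 * sechSq z) * solA z) * hr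
  rw [hA]
  generalize (1 + sechSq z)⁻¹ = r at *
  linear_combination (r * g t z) * hw + ((solA' z * solB z - solA z * solB' z) * g t z) * hr

/-- The decay `exp (-2|z|)` of `w₁` is inherited by the tail on both sides, by orthogonality, and
the growth of `w₂` by the other integral; the polynomial decay of `g` survives in both. -/
lemma green_bounds (hT : 0 < T) (hg : ClRap T All (emb g))
    (h0 : ∀ t ∈ Icc 0 T, ∫ ζ, solA ζ * g t ζ = 0) (n : ℕ) :
    ∃ C : ℝ, 0 ≤ C ∧ ∀ t ∈ Icc 0 T, ∀ z,
      (1 + |z|) ^ n * |tail (fun t z => solA z * g t z) t z| ≤ C * Real.exp (-(2 * |z|)) ∧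
      (1 + |z|) ^ n * |prim (fun t z => solB z * g t z) t z|
        ≤ C * ((1 + |z|) * Real.exp (2 * |z|)) := by
  obtain ⟨C, hC0, hC⟩ := hg.base (n + 2) 0
  have hg' : ∀ t ∈ Icc 0 T, ∀ ζ, (1 + |ζ|) ^ (n + 2) * |g t ζ| ≤ C :=
    fun t ht ζ => hC 0 t ζ (by simp) ht trivial
  have hpi := Real.pi_pos
  refine ⟨24 * C * Real.pi + 40 * C * (n.factorial * Real.exp 1), by positivity,
    fun t ht z => ⟨?_, ?_⟩⟩
  · have h1 := abs_tail_le (M := 24 * C * Real.exp (-(2 * |z|)) / (1 + |z|) ^ n) (z := z)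
      (hg.solA_mul hT) ht (h0 t ht) (by positivity) fun ζ hζ => ?_
    · calc (1 + |z|) ^ n * |tail (fun t z => solA z * g t z) t z|
          ≤ (1 + |z|) ^ n * (24 * C * Real.exp (-(2 * |z|)) / (1 + |z|) ^ n * Real.pi) := by gcongr
        _ = 24 * C * Real.pi * Real.exp (-(2 * |z|)) := by field_simp
        _ ≤ _ := by gcongr; linarith [show 0 ≤ 40 * C * (n.factorial * Real.exp 1) by positivity]
    · rw [← div_eq_mul_inv, div_div, le_div_iff₀ (by positivity), abs_mul]
      have h2 : (1 + |z|) ^ n * (1 + ζ ^ 2) ≤ (1 + |ζ|) ^ (n + 2) := by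
        rw [pow_add]
        gcongr
        nlinarith [abs_nonneg ζ, sq_abs ζ]
      have h3 : |solA ζ| ≤ 24 * Real.exp (-(2 * |z|)) :=
        (abs_solA_le ζ).trans (by gcongr)
      calc |solA ζ| * |g t ζ| * ((1 + |z|) ^ n * (1 + ζ ^ 2))
          ≤ |solA ζ| * |g t ζ| * (1 + |ζ|) ^ (n + 2) := by gcongr
        _ = |solA ζ| * ((1 + |ζ|) ^ (n + 2) * |g t ζ|) := by ring
        _ ≤ 24 * Real.exp (-(2 * |z|)) * C := by
            gcongr; exact hg' t ht ζ
        _ = _ := by ring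
  · set D := 40 * C * (n.factorial * Real.exp 1) with hD
    have h1 := abs_prim_le (h := fun t z => solB z * g t z) (t := t) (z := z)
      (C := D * Real.exp (2 * |z|) / (1 + |z|) ^ n) fun ζ hζ => ?_
    · calc (1 + |z|) ^ n * |prim (fun t z => solB z * g t z) t z|
          ≤ (1 + |z|) ^ n * (D * Real.exp (2 * |z|) / (1 + |z|) ^ n * |z|) := by gcongr
        _ = D * (|z| * Real.exp (2 * |z|)) := by field_simp
        _ ≤ _ := by
          gcongr
          · linarith [show 0 ≤ 24 * C * Real.pi by positivity]
          · linarith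
    · rw [le_div_iff₀ (by positivity), abs_mul]
      -- The weight is transferred from `z` to `ζ` at the cost of `exp (|z| - |ζ|)`. There is room
      -- for it, since `exp (2|ζ|)` is to be compared with `exp (2|z|)`.
      have h2 : (1 + |z|) ^ n ≤ (1 + |ζ|) ^ n * ((n.factorial * Real.exp 1)
          * Real.exp (|z| - |ζ|)) := by
        have h3 := weight_mul_exp_le n (|z| - |ζ|)
        rw [abs_of_nonneg (sub_nonneg.2 hζ), Real.exp_neg, ← div_eq_mul_inv,
          div_le_iff₀ (Real.exp_pos _)] at h3
        calc (1 + |z|) ^ n ≤ ((1 + |ζ|) * (1 + (|z| - |ζ|))) ^ n := by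
              gcongr
              nlinarith [abs_nonneg ζ, sub_nonneg.2 hζ, mul_nonneg (abs_nonneg ζ) (sub_nonneg.2 hζ)]
          _ = (1 + |ζ|) ^ n * (1 + (|z| - |ζ|)) ^ n := mul_pow _ _ _
          _ ≤ _ := by gcongr
      have h4 : Real.exp (2 * |ζ|) * Real.exp (|z| - |ζ|) ≤ Real.exp (2 * |z|) := by
        rw [← Real.exp_add]; exact Real.exp_le_exp.2 (by linarith)
      have h5 : (1 + |ζ|) * ((1 + |ζ|) ^ n * |g t ζ|) ≤ C := by
        refine le_trans ?_ (hg' t ht ζ)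
        rw [← mul_assoc, ← pow_succ']
        gcongr
        · linarith [abs_nonneg ζ]
        · norm_num
      calc |solB ζ| * |g t ζ| * (1 + |z|) ^ n
          ≤ (40 * (1 + |ζ|) * Real.exp (2 * |ζ|)) * |g t ζ| * ((1 + |ζ|) ^ n *
              ((n.factorial * Real.exp 1) * Real.exp (|z| - |ζ|))) := by
            gcongr; exact abs_solB_le ζ
        _ = 40 * (n.factorial * Real.exp 1) * ((1 + |ζ|) * ((1 + |ζ|) ^ n * |g t ζ|))
              * (Real.exp (2 * |ζ|) * Real.exp (|z| - |ζ|)) := by ring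
        _ ≤ 40 * (n.factorial * Real.exp 1) * C * Real.exp (2 * |z|) := by gcongr
        _ = D * Real.exp (2 * |z|) := by rw [hD]; ring

/-- In both products the exponentials cancel. The leftover factor `1 + |z|` is paid for by using
`green_bounds` with exponent `n + 1`. -/
lemma rap_combination (hT : 0 < T) (hg : ClRap T All (emb g))
    (h0 : ∀ t ∈ Icc 0 T, ∫ ζ, solA ζ * g t ζ = 0) {a b : ℝ → ℝ}
    (ha : ∀ z, |a z| ≤ 24 * Real.exp (-(2 * |z|)))
    (hb : ∀ z, |b z| ≤ 40 * (1 + |z|) * Real.exp (2 * |z|)) :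
    Rap T All (emb fun t z => -(b z * tail (fun t z => solA z * g t z) t z
      + a z * prim (fun t z => solB z * g t z) t z)) := by
  intro n R
  obtain ⟨C, hC0, hC⟩ := green_bounds hT hg h0 (n + 1)
  refine ⟨64 * C, by positivity, fun x t z _ ht _ => ?_⟩
  obtain ⟨h1, h2⟩ := hC t ht z
  set I := tail (fun t z => solA z * g t z) t z
  set J := prim (fun t z => solB z * g t z) t z
  change (1 + |z|) ^ n * |-(b z * I + a z * J)| ≤ 64 * C
  have he : Real.exp (2 * |z|) * Real.exp (-(2 * |z|)) = 1 := by rw [← Real.exp_add]; simp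
  have h3 : (1 + |z|) ^ n * |b z * I| ≤ 40 * C := by
    calc (1 + |z|) ^ n * |b z * I|
        ≤ (1 + |z|) ^ n * (40 * (1 + |z|) * Real.exp (2 * |z|) * |I|) := by
          rw [abs_mul]; gcongr; exact hb z
      _ = 40 * Real.exp (2 * |z|) * ((1 + |z|) ^ (n + 1) * |I|) := by rw [pow_succ]; ring
      _ ≤ 40 * Real.exp (2 * |z|) * (C * Real.exp (-(2 * |z|))) := by gcongr
      _ = 40 * C * (Real.exp (2 * |z|) * Real.exp (-(2 * |z|))) := by ring
      _ = 40 * C := by rw [he, mul_one]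
  have h4 : (1 + |z|) ^ n * |a z * J| ≤ 24 * C := by
    have hz : 0 < 1 + |z| := by positivity
    have h5 : (1 + |z|) ^ n * |J| ≤ C * Real.exp (2 * |z|) := by
      refine le_of_mul_le_mul_left ?_ hz
      calc (1 + |z|) * ((1 + |z|) ^ n * |J|) = (1 + |z|) ^ (n + 1) * |J| := by rw [pow_succ]; ring
        _ ≤ _ := h2
        _ = _ := by ring
    calc (1 + |z|) ^ n * |a z * J| = |a z| * ((1 + |z|) ^ n * |J|) := by rw [abs_mul]; ring
      _ ≤ 24 * Real.exp (-(2 * |z|)) * (C * Real.exp (2 * |z|)) := by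
          gcongr; exact ha z
      _ = 24 * C * (Real.exp (2 * |z|) * Real.exp (-(2 * |z|))) := by ring
      _ = 24 * C := by rw [he, mul_one]
  rw [abs_neg]
  calc (1 + |z|) ^ n * |b z * I + a z * J| ≤ (1 + |z|) ^ n * (|b z * I| + |a z * J|) := by
        gcongr; exact abs_add_le _ _
    _ = (1 + |z|) ^ n * |b z * I| + (1 + |z|) ^ n * |a z * J| := mul_add _ _ _
    _ ≤ _ := by linarith

/-- The inverse of the linearized operator preserves rapid decrease. -/
lemma ClRap.green (hT : 0 < T) (hg : ClRap T All (emb g))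
    (h0 : ∀ t ∈ Icc 0 T, ∫ ζ, solA ζ * g t ζ = 0) : ClRap T All (emb (green g)) := by
  have key : ClRap T All ((emb (MCH.green g) * fun _ _ z => (1 : ℝ)) +
      (emb (MCH.green' g) * fun _ _ z => (0 : ℝ)) + fun _ _ _ => 0) := by
    -- The differential equation expresses the second `z`-derivative through `green`, `green'` and
    -- `g`, so combinations of the first two plus a rapidly decreasing remainder are closed under
    -- `∂_z`. The operator `∂_t` replaces `g` by `∂_t g`, which is still orthogonal to `w₁` because
    -- `w₁` does not depend on `t`.
    refine Cl.of_family Rap.respects (fun a => ∃ (g : ℝ → ℝ → ℝ) (s₁ s₂ : ℝ → ℝ)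
      (h : ℝ → ℝ → ℝ → ℝ), ClRap T All (emb g) ∧ (∀ t ∈ Icc 0 T, ∫ ζ, solA ζ * g t ζ = 0) ∧
      TanhAlg s₁ ∧ TanhAlg s₂ ∧ ClRap T All h ∧
      a = (emb (MCH.green g) * fun _ _ z => s₁ z) + (emb (MCH.green' g) * fun _ _ z => s₂ z) + h)
      ?_ ?_ ?_ ⟨g, _, _, _, hg, h0, .const 1, .const 0, ClRap.zero, rfl⟩
    · rintro a ⟨g, s₁, s₂, h, hg, h0, hs₁, hs₂, hh, rfl⟩
      exact (((sm_green hT hg).mul (Sm.of_s hs₁.contDiff)).add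
        ((sm_green' hT hg).mul (Sm.of_s hs₂.contDiff))).add hh.1
    · rintro a ⟨g, s₁, s₂, h, hg, h0, hs₁, hs₂, hh, rfl⟩
      exact (((rap_combination hT hg h0 abs_solA_le abs_solB_le).mul_slow hs₁.clSlow.base).add
        ((rap_combination hT hg h0 abs_solA'_le abs_solB'_le).mul_slow hs₂.clSlow.base)).add hh.base
    · rintro a ⟨g, s₁, s₂, h, hg, h0, hs₁, hs₂, hh, rfl⟩ i
      cases i
      · refine ⟨_, ⟨fun _ _ => 0, _, _, _, ClRap.zero, by simp, .const 0, .const 0,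
          hh.pd hT Dir.x, rfl⟩, fun x t ht τ => ?_⟩
        have := (hh.1.hasDeriv_x hT ht x τ).const_add
          (MCH.green g t τ * s₁ τ + MCH.green' g t τ * s₂ τ)
        refine this.deriv.trans ?_
        simp [MCH.pd]
      · have h0' := integral_gt_eq_zero hT (hg.solA_mul hT) h0
        rw [gt_mul] at h0'
        refine ⟨_, ⟨gt T g, s₁, s₂, _, hg.pd hT Dir.t, h0', hs₁, hs₂, hh.pd hT Dir.t, rfl⟩,
          fun x t ht τ => ?_⟩
        exact ((((hasDerivWithinAt_green hT hg ht τ).mul_const (s₁ τ)).add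
          ((hasDerivWithinAt_green' hT hg ht τ).mul_const (s₂ τ))).add
          (hh.1.hasDeriv_t hT ht x τ)).derivWithin (uniqueDiffOn_Icc hT t ht)
      · obtain ⟨s₁', hs₁', e₁⟩ := hs₁.hasDerivAt
        obtain ⟨s₂', hs₂', e₂⟩ := hs₂.hasDerivAt
        have hr := TanhAlg.inv.mul hs₂
        refine ⟨_, ⟨g, _, _, _, hg, h0, hs₁'.sub (TanhAlg.potential.mul hr),
          (hs₁.add hs₂').sub (TanhAlg.solA.mul hr),
          ClRap.add hT (ClRap.mul_slow hT hg (hr.clSlow (S := All))) (hh.pd hT Dir.s), rfl⟩,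
          fun x t ht τ => ?_⟩
        have := ((((hasDerivAt_green hT hg ht τ).mul (e₁ τ)).add
          ((hasDerivAt_green' hT hg ht τ).mul (e₂ τ))).add (hh.1.hasDeriv_s hT ht x τ)).deriv
        refine this.trans ?_
        simp only [emb, MCH.pd, Pi.add_apply, Pi.mul_apply, Pi.sub_apply]
        ring
  refine key.congr Rap.respects fun x t _ τ => by simp

end MCH

/-! ### The transition function and the linear equation of third order -/

namespace MCH

variable {T : ℝ}

lemma Sm.to_t {u : ℝ → ℝ} (hu : Sm T (emb fun t _ => u t)) : ContDiffOn ℝ ∞ u (Icc 0 T) := by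
  refine ContDiffOn.comp (g := fun p : ℝ × ℝ => u p.1) (f := fun t : ℝ => (t, (0 : ℝ)))
    (hu.to_ts 0) (by fun_prop) ?_
  intro t ht
  simpa using ht

lemma tendsto_inv_one_add_sq {l : Filter ℝ} (hl : Tendsto (fun τ : ℝ => |τ|) l atTop) :
    Tendsto (fun z : ℝ => (1 + z ^ 2)⁻¹) l (𝓝 0) := by
  refine tendsto_inv_atTop_zero.comp (tendsto_atTop_mono' l ?_ hl)
  filter_upwards [hl.eventually_ge_atTop 1] with z hz
  nlinarith [sq_abs z]

lemma ClRap.tendsto_zero {h : ℝ → ℝ → ℝ} (hh : ClRap T All (emb h)) {t : ℝ} (ht : t ∈ Icc 0 T)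
    {l : Filter ℝ} (hl : Tendsto (fun τ : ℝ => |τ|) l atTop) : Tendsto (h t) l (𝓝 0) := by
  obtain ⟨C, h0, hC⟩ := hh.base.bound_inv
  refine squeeze_zero_norm (fun z => hC t ht z) ?_
  simpa using (tendsto_inv_one_add_sq hl).const_mul C

lemma ClRap.integral_deriv {f h : ℝ → ℝ → ℝ} (hf : ClRap T All (emb f)) (hh : ClRap T All (emb h))
    {t : ℝ} (ht : t ∈ Icc 0 T) (hd : ∀ z, HasDerivAt (h t) (f t z) z) : ∫ z, f t z = 0 := by
  rw [integral_of_hasDerivAt_of_tendsto hd (hf.integrable ht)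
    (hh.tendsto_zero ht tendsto_abs_atBot_atTop) (hh.tendsto_zero ht tendsto_abs_atTop_atTop),
    sub_zero]

lemma integral_comp_affine {k : ℝ} (hk : 0 < k) (c : ℝ) (G : ℝ → ℝ) :
    ∫ τ, G (k * τ + c) = k⁻¹ * ∫ z, G z := by
  have := Measure.integral_comp_mul_left (fun x => G (x + c)) k
  rw [this, integral_add_right_eq_self, abs_of_pos (inv_pos.2 hk), smul_eq_mul]

/-! ### The transition function -/

/-- The function `(1 - tanh z) / 2`. -/
noncomputable def trans (z : ℝ) : ℝ := (1 - Real.tanh z) / 2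

lemma TanhAlg.trans : TanhAlg trans := by
  have := smul (1 / 2) ((const 1).sub tanh)
  convert this using 1
  funext z
  simp only [MCH.trans, Pi.sub_apply]
  ring

lemma hasDerivAt_trans (z : ℝ) : HasDerivAt trans (-(sechSq z / 2)) z :=
  (((hasDerivAt_tanh z).const_sub 1).div_const 2).congr_deriv (by rw [sechSq]; ring)

lemma abs_trans_le {z : ℝ} (hz : 0 ≤ z) : |trans z| ≤ sechSq z := by
  have h0 : 0 ≤ Real.tanh z := by
    rw [Real.tanh_eq_sinh_div_cosh]
    exact div_nonneg (Real.sinh_nonneg_iff.2 hz) (Real.cosh_pos z).le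
  have h1 := (abs_lt.1 (Real.abs_tanh_lt_one z)).2
  rw [abs_of_nonneg (by rw [trans]; linarith), trans, sechSq]
  nlinarith

lemma trans_neg (z : ℝ) : trans (-z) = 1 - trans z := by
  simp only [trans, Real.tanh_neg]; ring

lemma sechSq_neg (z : ℝ) : sechSq (-z) = sechSq z := by
  simp only [sechSq, Real.tanh_neg]; ring

lemma abs_trans_sub_one_le {z : ℝ} (hz : z ≤ 0) : |trans z - 1| ≤ sechSq z := by
  have := abs_trans_le (neg_nonneg.2 hz)
  rwa [trans_neg, sechSq_neg, abs_sub_comm] at this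

lemma clRap_trans_sub (hT : 0 < T) {S : ℝ → ℝ → ℝ → Prop} (c : ℝ)
    (h : ∀ x t z, S x t z → |trans z - c| ≤ sechSq z) :
    ClRap T S (fun _ _ z => trans z - c) := by
  refine Cl.of_pd (Sm.of_s (TanhAlg.trans.sub (.const c)).contDiff) ?_ ?_
  · intro n R
    obtain ⟨C, h0, hC⟩ := weight_mul_sechSq_le n
    refine ⟨C, h0, fun x t z _ _ hs => le_trans ?_ (hC z)⟩
    gcongr
    exact h x t z hs
  · intro i
    cases i
    · exact ClRap.zero.congr Rap.respects fun x t _ τ => by simp [pd, dX]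
    · exact ClRap.zero.congr Rap.respects fun x t _ τ => by simp [pd, dT]
    · refine ((TanhAlg.clRap hT (.const (-1 / 2))).of_all).congr Rap.respects fun x t _ τ => ?_
      have := ((hasDerivAt_trans τ).sub_const c).deriv
      refine Eq.trans ?_ this.symm
      ring

lemma TanhAlg.fadd {f g : ℝ → ℝ} (hf : TanhAlg f) (hg : TanhAlg g) :
    TanhAlg fun z => f z + g z := hf.add hg

lemma TanhAlg.fsub {f g : ℝ → ℝ} (hf : TanhAlg f) (hg : TanhAlg g) :
    TanhAlg fun z => f z - g z := hf.sub hg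

lemma TanhAlg.fmul {f g : ℝ → ℝ} (hf : TanhAlg f) (hg : TanhAlg g) :
    TanhAlg fun z => f z * g z := hf.mul hg

lemma tendsto_sechSq_mul {f : ℝ → ℝ} (hf : TanhAlg f) {l : Filter ℝ}
    (hl : Tendsto (fun τ : ℝ => |τ|) l atTop) : Tendsto (fun z => sechSq z * f z) l (𝓝 0) :=
  ClRap.tendsto_zero (T := 1) (h := fun _ z => sechSq z * f z) (hf.clRap one_pos) (t := 0)
    ⟨le_rfl, zero_le_one⟩ hl

lemma tendsto_sechSq {l : Filter ℝ} (hl : Tendsto (fun τ : ℝ => |τ|) l atTop) :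
    Tendsto sechSq l (𝓝 0) := by
  simpa using tendsto_sechSq_mul (.const 1) hl

lemma tendsto_trans_atTop : Tendsto trans atTop (𝓝 0) := by
  refine squeeze_zero_norm' ?_ (tendsto_sechSq tendsto_abs_atTop_atTop)
  filter_upwards [eventually_ge_atTop 0] with z hz using abs_trans_le hz

lemma tendsto_trans_atBot : Tendsto trans atBot (𝓝 1) := by
  rw [tendsto_iff_norm_sub_tendsto_zero]
  refine squeeze_zero_norm' ?_ (tendsto_sechSq tendsto_abs_atBot_atTop)
  filter_upwards [eventually_le_atBot 0] with z hz
  rw [norm_norm]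
  exact abs_trans_sub_one_le hz

/-- The result of the linearized operator of third order for the transition function, divided
by `cosh⁻²`. -/
noncomputable def transFactor (z : ℝ) : ℝ :=
  sechSq z * sechSq z - 7 * sechSq z - (4 + 36 * sechSq z) * (Real.tanh z * (1 - Real.tanh z))

lemma TanhAlg.transFactor : TanhAlg transFactor := by
  change TanhAlg fun z => _
  simp only [MCH.transFactor]
  repeat' first
    | exact TanhAlg.const _
    | exact TanhAlg.tanh
    | exact TanhAlg.sech
    | apply TanhAlg.fsub
    | apply TanhAlg.fadd
    | apply TanhAlg.fmul

lemma linearized_trans (z : ℝ) : (1 + sechSq z) * (-(solA' z / 2)) + 2 * solA z * (-(solA z / 2))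
      + (-4 + 8 * sechSq z + 12 * sechSq z ^ 2) * (-(sechSq z / 2))
      + (4 + 36 * sechSq z) * solA z * trans z = sechSq z * transFactor z := by
  simp only [solA', solA, trans, transFactor, sechSq]
  ring

/-- The linearized operator of second order for the transition function, up to the term
`-4 * trans`, divided by `cosh⁻²`. -/
noncomputable def transPrim (z : ℝ) : ℝ :=
  (1 + 2 * sechSq z) * Real.tanh z + (4 + 18 * sechSq z) * trans z

lemma TanhAlg.transPrim : TanhAlg transPrim := by
  change TanhAlg fun z => _
  simp only [MCH.transPrim]
  repeat' first
    | exact TanhAlg.const _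
    | exact TanhAlg.tanh
    | exact TanhAlg.trans
    | exact TanhAlg.sech
    | apply TanhAlg.fsub
    | apply TanhAlg.fadd
    | apply TanhAlg.fmul

lemma hasDerivAt_transPrim (z : ℝ) :
    HasDerivAt (fun z => sechSq z * transPrim z - 4 * trans z) (sechSq z * transFactor z) z := by
  have hS := hasDerivAt_sechSq z
  have hy := hasDerivAt_tanh z
  have hχ := hasDerivAt_trans z
  have := (hS.mul ((((hS.const_mul 2).const_add 1).mul hy).add
    (((hS.const_mul 18).const_add 4).mul hχ))).sub (hχ.const_mul 4)
  refine this.congr_deriv ?_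
  simp only [Pi.mul_apply, Pi.add_apply, transFactor, trans, sechSq]
  ring

/-- The integrand is `(M χ)'`, where `M χ` equals `S` times `transPrim` minus `4 χ` and `χ` falls
from `1` to `0`. The value `4` matches the factor `a₀ = 4 κ²` in the definition of `ν_m`. -/
lemma integral_transFactor : ∫ z, sechSq z * transFactor z = 4 := by
  have hi : Integrable (fun z => sechSq z * transFactor z) :=
    ClRap.integrable (T := 1) (h := fun _ z => sechSq z * transFactor z)
      (TanhAlg.transFactor.clRap one_pos) (t := 0) ⟨le_rfl, zero_le_one⟩
  have hP := TanhAlg.transPrim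
  rw [integral_of_hasDerivAt_of_tendsto hasDerivAt_transPrim hi
    ((tendsto_sechSq_mul hP tendsto_abs_atBot_atTop).sub (tendsto_trans_atBot.const_mul 4))
    ((tendsto_sechSq_mul hP tendsto_abs_atTop_atTop).sub (tendsto_trans_atTop.const_mul 4))]
  norm_num

/-- Green's identity: `∫ S (M χ)' = -∫ S' M χ = -∫ χ M S' = 0`, without boundary terms. Explicitly,
an antiderivative is `S M χ - (1 + S) (χ' S' - χ S'')`; divided by `S`, it is the function in `h2`.
-/
lemma integral_transFactor_mul : ∫ z, sechSq z * transFactor z * sechSq z = 0 := by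
  have h1 : TanhAlg fun z => transFactor z * sechSq z := TanhAlg.transFactor.mul .sech
  have h2 : TanhAlg fun z => sechSq z * transPrim z - 4 * trans z
      + (1 + sechSq z) * (solA z * (1 / 2) + trans z * (4 - 6 * sechSq z)) := by
    repeat' first
      | exact TanhAlg.const _
      | exact TanhAlg.trans
      | exact TanhAlg.transPrim
      | exact TanhAlg.sech
      | exact TanhAlg.solA
      | apply TanhAlg.fsub
      | apply TanhAlg.fadd
      | apply TanhAlg.fmul
  have := ClRap.integral_deriv (T := 1) (f := fun _ z => sechSq z * (transFactor z * sechSq z))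
    (h := fun _ z => sechSq z * (sechSq z * transPrim z - 4 * trans z
      + (1 + sechSq z) * (solA z * (1 / 2) + trans z * (4 - 6 * sechSq z))))
    (h1.clRap one_pos) (h2.clRap one_pos) (t := 0) ⟨le_rfl, zero_le_one⟩ fun z => ?_
  · simpa only [mul_assoc] using this
  · have hS := hasDerivAt_sechSq z
    have hχ := hasDerivAt_trans z
    have := hS.mul ((hasDerivAt_transPrim z).add ((hS.const_add 1).mul
      (((hasDerivAt_solA z).mul_const (1 / 2)).add (hχ.mul ((hS.const_mul 6).const_sub 4)))))
    refine this.congr_deriv ?_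
    simp only [Pi.mul_apply, Pi.add_apply, transFactor, transPrim, trans, solA, solA', sechSq]
    ring

/-! ### Rapidly decreasing solutions of the linearized equation of third order -/

/-- The operator is the derivative of `M`. Zero mean gives a rapidly decreasing primitive `g` of
`f`, and integration by parts turns `∫ f S = 0` into `∫ g S' = 0`, the solvability condition for `M
ψ = g`. -/
lemma exists_rapid_solution (hT : 0 < T) {f : ℝ → ℝ → ℝ} (hf : ClRap T All (emb f))
    (h0 : ∀ t ∈ Icc 0 T, ∫ z, f t z = 0) (h1 : ∀ t ∈ Icc 0 T, ∫ z, f t z * sechSq z = 0) :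
    ∃ ψ ψ₁ ψ₂ ψ₃ : ℝ → ℝ → ℝ, ClRap T All (emb ψ) ∧ ∀ t ∈ Icc 0 T, ∀ z,
      HasDerivAt (ψ t) (ψ₁ t z) z ∧ HasDerivAt (ψ₁ t) (ψ₂ t z) z ∧ HasDerivAt (ψ₂ t) (ψ₃ t z) z ∧
      (1 + sechSq z) * ψ₃ t z + 2 * solA z * ψ₂ t z
        + (-4 + 8 * sechSq z + 12 * sechSq z ^ 2) * ψ₁ t z
        + (4 + 36 * sechSq z) * solA z * ψ t z = f t z := by
  have htail := hf.tail hT h0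
  set g : ℝ → ℝ → ℝ := fun t z => -tail f t z with hg
  have hgr : ClRap T All (emb g) := htail.neg hT
  have hgd : ∀ t ∈ Icc 0 T, ∀ z, HasDerivAt (g t) (f t z) z := fun t ht z =>
    ((hasDerivAt_tail hf ht z).neg).congr_deriv (neg_neg _)
  have hortho : ∀ t ∈ Icc 0 T, ∫ z, solA z * g t z = 0 := by
    intro t ht
    have hfs : ClRap T All (emb fun t z => f t z * sechSq z) :=
      ClRap.mul_slow hT hf (TanhAlg.sech.clSlow (S := All))
    have hgs : ClRap T All (emb fun t z => g t z * sechSq z) :=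
      ClRap.mul_slow hT hgr (TanhAlg.sech.clSlow (S := All))
    have hga := hgr.solA_mul hT
    have := ClRap.integral_deriv (f := fun t z => f t z * sechSq z + solA z * g t z)
      (ClRap.add hT hfs hga) hgs ht fun z =>
        ((hgd t ht z).mul (hasDerivAt_sechSq z)).congr_deriv (by simp only [solA]; ring)
    have e := integral_add (hfs.integrable ht) (hga.integrable ht)
    rw [h1 t ht, zero_add] at e
    exact e.symm.trans this
  -- `ψ₂` is the second derivative as given by `M ψ = g`, and the witness for `ψ₃` is solved from
  -- the equation of third order; it remains to check `ψ₂' = ψ₃`.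
  set ψ₂ : ℝ → ℝ → ℝ := fun t z => (1 + sechSq z)⁻¹ *
    (g t z - solA z * green' g t z - potential z * green g t z) with hψ₂
  have hr : ∀ z, (1 + sechSq z) * (1 + sechSq z)⁻¹ = 1 := fun z =>
    mul_inv_cancel₀ (by have := sechSq_pos z; positivity)
  refine ⟨green g, green' g, ψ₂, fun t z => (1 + sechSq z)⁻¹ * (f t z - 2 * solA z * ψ₂ t z
    - (-4 + 8 * sechSq z + 12 * sechSq z ^ 2) * green' g t z
    - (4 + 36 * sechSq z) * solA z * green g t z), hgr.green hT hortho, fun t ht z =>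
    ⟨hasDerivAt_green hT hgr ht z, hasDerivAt_green' hT hgr ht z, ?_, ?_⟩⟩
  · have hS := hasDerivAt_sechSq z
    have hinv := (hS.const_add 1).inv (by have := sechSq_pos z; positivity)
    have hpot : HasDerivAt potential ((4 + 36 * sechSq z) * solA z) z := by
      refine (((hS.const_mul 4).const_add (-4)).add ((hS.pow 2).const_mul 18)).congr_deriv ?_
      simp only [solA]; norm_num; ring
    have := hinv.mul (((hgd t ht z).sub ((hasDerivAt_solA z).mul (hasDerivAt_green' hT hgr ht z))).sub
      (hpot.mul (hasDerivAt_green hT hgr ht z)))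
    refine this.congr_deriv ?_
    have hr' := hr z
    simp only [Pi.inv_apply, Pi.sub_apply, Pi.mul_apply, hψ₂, div_eq_mul_inv, ← inv_pow]
    simp only [potential, solA, solA']
    generalize (1 + sechSq z)⁻¹ = r at *
    generalize sechSq z = S at *
    grind
  · have hr' := hr z
    linear_combination (f t z - 2 * solA z * ψ₂ t z
      - (-4 + 8 * sechSq z + 12 * sechSq z ^ 2) * green' g t z
      - (4 + 36 * sechSq z) * solA z * green g t z) * hr'

end MCH

/-! ### Solvability of the linear equation for the next term -/

namespace MCH

namespace Setup.Data

variable {P : Setup} (h : P.Data) {Q : Terms} {m : ℕ}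
include h

/-- With `|C₀| ≤ R`, the condition `τ ≥ 0` guarantees only `κ τ + C₀ ≥ -R`. The estimates for
`trans` are therefore extended over a bounded strip before the change of variable. -/
lemma inGt_trans : InGt P.T fun t τ => trans (P.κ t * τ + P.C₀ t) := by
  obtain ⟨R, h0, hR⟩ := bounded_of_contDiffOn h.hC₀
  have hpos : ClRap P.T (fun _ _ z => -R ≤ z) (fun _ _ z => trans z - 0) :=
    (clRap_trans_sub h.hT (S := Pos) 0 fun x t z hz => by
      simpa using abs_trans_le hz).extend h.hT (R' := R) fun x t _ z hz => by
        rcases le_total 0 z with h' | h'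
        · exact Or.inl h'
        · exact Or.inr (abs_le.2 ⟨hz, h'.trans h0⟩)
  have hneg : ClRap P.T (fun _ _ z => z ≤ R) (fun _ _ z => trans z - 1) :=
    (clRap_trans_sub h.hT (S := Neg) 1 fun x t z hz => abs_trans_sub_one_le hz).extend h.hT
      (R' := R) fun x t _ z hz => by
        rcases le_total z 0 with h' | h'
        · exact Or.inl h'
        · exact Or.inr (abs_le.2 ⟨by linarith, hz⟩)
  have hp := ClRap.affComp (S' := Pos) h.hT hpos h.contDiffOn_κ h.hC₀ (fun _ ht => h.κ_pos ht)
    fun x t ht τ hτ => by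
      have h1 := mul_nonneg (h.κ_pos ht).le hτ
      linarith [(abs_le.1 (hR t ht)).1]
  have hn := ClRap.affComp (S' := Neg) h.hT hneg h.contDiffOn_κ h.hC₀ (fun _ ht => h.κ_pos ht)
    fun x t ht τ hτ => by
      have h1 := mul_nonneg (h.κ_pos ht).le (neg_nonneg.2 hτ)
      linarith [(abs_le.1 (hR t ht)).2]
  simp only [sub_zero] at hp
  exact inGt_of_rap hp hn

lemma tendsto_trans {t : ℝ} (ht : t ∈ Icc 0 P.T) :
    Tendsto (fun τ => trans (P.κ t * τ + P.C₀ t)) atBot (𝓝 1) :=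
  tendsto_trans_atBot.comp (tendsto_atBot_add_const_right _ _
    (tendsto_id.const_mul_atBot (h.κ_pos ht)))

lemma ν_eq {t : ℝ} (ht : t ∈ Icc 0 P.T) :
    P.ν Q m t = (4 * P.κ t ^ 2 * P.dφ t)⁻¹ * ∫ τ, P.F Q m t τ := by
  rw [ν, E, h.a_eq ht]
  rw [neg_div, neg_neg, div_eq_inv_mul]

lemma contDiffOn_ν (hF : ClRap P.T All (emb (P.F Q m))) :
    ContDiffOn ℝ ∞ (P.ν Q m) (Icc 0 P.T) := by
  have h1 : ContDiffOn ℝ ∞ (fun t => ∫ τ, P.F Q m t τ) (Icc 0 P.T) := by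
    have := Sm.to_t (hF.sm_setIntegral h.hT MeasurableSet.univ)
    simpa using this
  have h2 : ContDiffOn ℝ ∞ (fun t => (4 * P.κ t ^ 2 * P.dφ t)⁻¹) (Icc 0 P.T) := by
    refine ((contDiffOn_const.mul (h.contDiffOn_κ.pow 2)).mul h.contDiffOn_dφ).inv fun t ht => ?_
    have := (h.κ_pos ht).ne'
    have := h.dφ_ne ht
    positivity
  exact (h2.mul h1).congr fun t ht => h.ν_eq ht

/-- The right-hand side of the linear equation in the normalized variable `κ τ + C₀`. -/
lemma clRap_normalized (hF : ClRap P.T All (emb (P.F Q m))) :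
    ClRap P.T All (emb fun t z => P.F Q m t ((P.κ t)⁻¹ * z + -((P.κ t)⁻¹ * P.C₀ t))
      * (P.κ t ^ 3 * P.dφ t)⁻¹) := by
  have hk : ContDiffOn ℝ ∞ (fun t => (P.κ t)⁻¹) (Icc 0 P.T) :=
    h.contDiffOn_κ.inv fun t ht => (h.κ_pos ht).ne'
  have h1 := hF.affComp (S' := All) h.hT hk (hk.mul h.hC₀).neg (fun t ht => inv_pos.2 (h.κ_pos ht))
    fun _ _ _ _ _ => trivial
  have h2 : ContDiffOn ℝ ∞ (fun t => (P.κ t ^ 3 * P.dφ t)⁻¹) (Icc 0 P.T) := by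
    refine ((h.contDiffOn_κ.pow 3).mul h.contDiffOn_dφ).inv fun t ht => ?_
    have := (h.κ_pos ht).ne'
    have := h.dφ_ne ht
    positivity
  exact h1.mul_slow h.hT (ClSlow.of_t h.hT h2)

/-- The change of variable `dz = κ dτ` lowers the power of `κ` from three to two. -/
lemma integral_normalized (w : ℝ → ℝ) {t : ℝ} (ht : t ∈ Icc 0 P.T) :
    ∫ z, P.F Q m t ((P.κ t)⁻¹ * z + -((P.κ t)⁻¹ * P.C₀ t)) * (P.κ t ^ 3 * P.dφ t)⁻¹ * w z =
      (P.κ t ^ 2 * P.dφ t)⁻¹ * ∫ τ, P.F Q m t τ * w (P.κ t * τ + P.C₀ t) := by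
  have hk := (h.κ_pos ht).ne'
  have := integral_comp_affine (inv_pos.2 (h.κ_pos ht)) (-((P.κ t)⁻¹ * P.C₀ t)) fun τ =>
    P.F Q m t τ * w (P.κ t * τ + P.C₀ t)
  have e : (fun z => P.F Q m t ((P.κ t)⁻¹ * z + -((P.κ t)⁻¹ * P.C₀ t)) * (P.κ t ^ 3 * P.dφ t)⁻¹
      * w z) = fun z => (P.κ t ^ 3 * P.dφ t)⁻¹ * (P.F Q m t ((P.κ t)⁻¹ * z + -((P.κ t)⁻¹ * P.C₀ t))
        * w (P.κ t * ((P.κ t)⁻¹ * z + -((P.κ t)⁻¹ * P.C₀ t)) + P.C₀ t)) := by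
    funext z
    rw [show P.κ t * ((P.κ t)⁻¹ * z + -((P.κ t)⁻¹ * P.C₀ t)) + P.C₀ t = z by field_simp; ring]
    ring
  rw [e, integral_const_mul, this, inv_inv, ← mul_assoc]
  congr 1
  have := h.dφ_ne ht
  field_simp

/-- Solvability of the linear equation under the orthogonality condition. -/
lemma exists_solvesLinear (hF : ClRap P.T All (emb (P.F Q m))) (ho : P.Orthogonal Q m) :
    ∃ η ψ : ℝ → ℝ → ℝ, P.SolvesLinear Q m η ψ := by
  have hT := h.hT
  set G : ℝ → ℝ → ℝ := fun t z => P.F Q m t ((P.κ t)⁻¹ * z + -((P.κ t)⁻¹ * P.C₀ t))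
      * (P.κ t ^ 3 * P.dφ t)⁻¹ with hG
  have hGr : ClRap P.T All (emb G) := h.clRap_normalized hF
  have hK : ClRap P.T All (emb fun t z => sechSq z * transFactor z * P.ν Q m t) :=
    ClRap.mul_slow hT (TanhAlg.transFactor.clRap hT) (ClSlow.of_t hT (h.contDiffOn_ν hF))
  -- The subtracted function is the normalized operator applied to `ν_m χ`; `f` is left for `ψ`.
  set f : ℝ → ℝ → ℝ := fun t z => G t z - sechSq z * transFactor z * P.ν Q m t with hf
  have hfr : ClRap P.T All (emb f) := ClRap.sub hT hGr hK
  -- This is where the value of `ν_m` matters: `∫ G = (κ² φ')⁻¹ ∫ 𝓕_m = 4 ν_m`, and `(M χ)'` has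
  -- integral `4`.
  have h0 : ∀ t ∈ Icc 0 P.T, ∫ z, f t z = 0 := by
    intro t ht
    have e := h.integral_normalized (Q := Q) (m := m) (fun _ => 1) ht
    simp only [mul_one] at e
    have := integral_sub (hGr.integrable ht) (hK.integrable ht)
    have e₂ : ∫ z, sechSq z * transFactor z * P.ν Q m t = 4 * P.ν Q m t := by
      rw [integral_mul_const, integral_transFactor]
    rw [e₂] at this
    refine this.trans ?_
    rw [h.ν_eq ht, show ∫ z, G t z = _ from e]
    have := (h.κ_pos ht).ne'
    have := h.dφ_ne ht
    field_simp
    ring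
  have hS : ClSlow P.T All (fun _ _ z => sechSq z) := TanhAlg.sech.clSlow
  -- As `v₀ = -φ' S` with `φ' ≠ 0`, the orthogonality condition says that `G` is orthogonal to `S`;
  -- the subtracted part is so automatically.
  have h1 : ∀ t ∈ Icc 0 P.T, ∫ z, f t z * sechSq z = 0 := by
    intro t ht
    have e := h.integral_normalized (Q := Q) (m := m) sechSq ht
    have hor := ho t ht
    rw [h.v0_eq ht] at hor
    have e' : (fun τ => P.F Q m t τ * (fun τ => -P.dφ t * sechSq (P.κ t * τ + P.C₀ t)) τ) =
        fun τ => -P.dφ t * (P.F Q m t τ * sechSq (P.κ t * τ + P.C₀ t)) := by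
      funext τ; ring
    rw [e', integral_const_mul] at hor
    have hor' := (mul_eq_zero.1 hor).resolve_left (neg_ne_zero.2 (h.dφ_ne ht))
    rw [hor', mul_zero] at e
    have i₁ : Integrable fun z => G t z * sechSq z :=
      ClRap.integrable (h := fun t z => G t z * sechSq z) (ClRap.mul_slow hT hGr hS) ht
    have i₂ : Integrable fun z => sechSq z * transFactor z * P.ν Q m t * sechSq z :=
      ClRap.integrable (h := fun t z => sechSq z * transFactor z * P.ν Q m t * sechSq z)
        (ClRap.mul_slow hT hK hS) ht
    have := integral_sub i₁ i₂
    have e₂ : ∫ z, sechSq z * transFactor z * P.ν Q m t * sechSq z = 0 := by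
      have : (fun z => sechSq z * transFactor z * P.ν Q m t * sechSq z) =
          fun z => P.ν Q m t * (sechSq z * transFactor z * sechSq z) := by funext z; ring
      rw [this, integral_const_mul, integral_transFactor_mul, mul_zero]
    rw [e₂, show ∫ z, G t z * sechSq z = 0 from e, sub_zero] at this
    rw [← this]
    congr 1
    funext z
    simp only [hf]; ring
  obtain ⟨ψ, ψ₁, ψ₂, ψ₃, hψ, H⟩ := exists_rapid_solution hT hfr h0 h1
  have hψr : ClRap P.T All (emb fun t τ => ψ t (P.κ t * τ + P.C₀ t)) := h.clRap_affine hψ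
  refine ⟨fun t τ => trans (P.κ t * τ + P.C₀ t), fun t τ => ψ t (P.κ t * τ + P.C₀ t),
    h.inGt_trans, fun t ht => h.tendsto_trans ht, inGt0_of_rap hψr, fun t ht τ => ?_⟩
  have hsm : ContDiff ℝ ∞ fun τ => P.ν Q m t * trans (P.κ t * τ + P.C₀ t)
      + ψ t (P.κ t * τ + P.C₀ t) := by
    have h2 : ContDiff ℝ ∞ fun τ => trans (P.κ t * τ + P.C₀ t) :=
      TanhAlg.trans.contDiff.comp (by fun_prop)
    exact (contDiff_const.mul h2).add (hψr.1.contDiff_slice 0 ht)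
  rw [h.linOp_affine (g := fun z => P.ν Q m t * trans z + ψ t z)
    (g₁ := fun z => P.ν Q m t * -(sechSq z / 2) + ψ₁ t z)
    (g₂ := fun z => P.ν Q m t * -(solA z / 2) + ψ₂ t z)
    (g₃ := fun z => P.ν Q m t * -(solA' z / 2) + ψ₃ t z) ht rfl hsm
    (fun z => ((hasDerivAt_trans z).const_mul _).add (H t ht z).1)
    (fun z => (((hasDerivAt_sechSq z).div_const 2).neg.const_mul _).add (H t ht z).2.1)
    (fun z => (((hasDerivAt_solA z).div_const 2).neg.const_mul _).add (H t ht z).2.2.1)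
    (z := P.κ t * τ + P.C₀ t) rfl]
  set z := P.κ t * τ + P.C₀ t with hz
  have e₁ := (H t ht z).2.2.2
  have e₂ := linearized_trans z
  have hτ : (P.κ t)⁻¹ * z + -((P.κ t)⁻¹ * P.C₀ t) = τ := by
    have := (h.κ_pos ht).ne'
    rw [hz]; field_simp; ring
  have e₃ : P.κ t ^ 3 * P.dφ t * G t z = P.F Q m t τ := by
    simp only [hG, hτ]
    have := (h.κ_pos ht).ne'
    have := h.dφ_ne ht
    field_simp
  rw [← e₃]
  simp only [hf] at e₁
  change P.κ t ^ 3 * P.dφ t * ((1 + sechSq z) * (P.ν Q m t * -(solA' z / 2) + ψ₃ t z)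
    + 2 * solA z * (P.ν Q m t * -(solA z / 2) + ψ₂ t z)
    + (-4 + 8 * sechSq z + 12 * sechSq z ^ 2) * (P.ν Q m t * -(sechSq z / 2) + ψ₁ t z)
    + (4 + 36 * sechSq z) * solA z * (P.ν Q m t * trans z + ψ t z)) = _
  linear_combination (P.κ t ^ 3 * P.dφ t) * e₁ + (P.κ t ^ 3 * P.dφ t * P.ν Q m t) * e₂

end Setup.Data

end MCH

/-! ### Assembly of solvability and accuracy -/

theorem theorem4 (P : MCH.Setup) (a b : ℝ → ℝ → ℝ → ℝ)
    (hT : 0 < P.T)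
    -- the coefficients and their expansions
    (ha : ∀ k ≤ P.N, MCH.Smooth2 P.T (P.a k))
    (hb : ∀ k ≤ P.N, MCH.Smooth2 P.T (P.b k))
    (hab : ∀ x : ℝ, ∀ t ∈ Set.Icc 0 P.T, P.a 0 x t * P.b 0 x t ≠ 0)
    (haO : MCH.BigOOn (MCH.strip P.T) (P.N + 1) (fun x t ε => a x t ε - P.aSum ε x t))
    (hbO : MCH.BigOOn (MCH.strip P.T) (P.N + 1) (fun x t ε => b x t ε - P.bSum ε x t))
    -- the phase function and the shift of the main term
    (hφ : ContDiffOn ℝ ∞ P.φ (Set.Icc 0 P.T))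
    (hφ' : ∀ t ∈ Set.Icc 0 P.T, HasDerivWithinAt P.φ
      (6 * (P.a 0 (P.φ t) t / P.b 0 (P.φ t) t)) (Set.Icc 0 P.T) t)
    (hpos : ∀ t ∈ Set.Icc 0 P.T, 0 < P.a 0 (P.φ t) t)
    (hC₀ : ContDiffOn ℝ ∞ P.C₀ (Set.Icc 0 P.T)) :
    -- construction: the orthogonality condition of index `m` yields the next term
    (∀ (Q : MCH.Terms) (m : ℕ), 1 ≤ m → m ≤ P.N →
      (∀ j, 1 ≤ j → j < m → P.SolvesLinear Q j (Q.η j) (Q.ψ j) ∧ P.SolvesTransport Q j) →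
      MCH.InGt0 P.T (P.F Q m) ∧
      (P.Orthogonal Q m → ∃ η ψ : ℝ → ℝ → ℝ, P.SolvesLinear Q m η ψ)) ∧
    -- accuracy of the function built from any terms so constructed
    (∀ Q : MCH.Terms,
      (∀ j, 1 ≤ j → j ≤ P.N → P.SolvesLinear Q j (Q.η j) (Q.ψ j) ∧ P.SolvesTransport Q j) →
      ∀ μ : ℝ, 0 < μ →
        -- the discrepancy is the left-hand side of the equation for `u_N` wherever `u_N` is
        -- given by one formula near the point
        (∀ ε > 0, ∀ x : ℝ, ∀ t ∈ Set.Icc 0 P.T, |x - P.φ t| ≠ μ →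
          MCH.eqn P.T (a x t ε) (b x t ε) ε (fun x t => P.uN Q μ x t ε) x t
            = P.discrepancy a b Q μ x t ε) ∧
        -- accuracy `O(ε^N)` on the whole strip
        MCH.BigOOn (MCH.strip P.T) P.N (P.discrepancy a b Q μ) ∧
        -- `u_N` is the `N`-th approximation
        MCH.SolitonLikeExpansion P.T P.N P.φ (fun _ _ _ => 0) (P.V Q) (P.uN Q μ) ∧
        -- accuracy `O(ε^(N+1))` as `τ → ±∞`
        (∀ m : ℕ, ∀ K : Set (ℝ × ℝ), IsCompact K → K ⊆ MCH.strip P.T →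
          ∃ C : ℝ, ∃ ε₀ : ℝ, 0 < ε₀ ∧ ∀ ε ∈ Set.Ioo 0 ε₀, ∀ z ∈ K,
            |P.discrepancy a b Q μ z.1 z.2 ε|
              ≤ C * (ε ^ (P.N + 1) + ε ^ P.N / (1 + |(z.1 - P.φ z.2) / ε|) ^ m)) ∧
        MCH.BigOOn {z ∈ MCH.strip P.T | z.1 ≠ P.φ z.2} (P.N + 1) (P.discrepancy a b Q μ)) := by
  have h : P.Data := ⟨hT, ha, hb, hab, hφ, hφ', hpos, hC₀⟩
  have hR := h.regular
  refine ⟨fun Q m _ _ hQ => ?_, fun Q hQ μ hμ => ?_⟩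
  · have hF := hR.rap_F hQ
    exact ⟨MCH.inGt0_of_rap hF, h.exists_solvesLinear hF⟩
  · have hQ' : P.Admissible Q (P.N + 1) := fun j h₁ h₂ => hQ j h₁ (Nat.lt_succ_iff.1 h₂)
    refine ⟨fun ε _ x t ht hx => hR.eqn_uN hμ ht hx _ _, hR.bigO_strip hQ' haO hbO hμ,
      hR.solitonLike hQ' hμ h.v0_ne, fun m K hK hKT => ?_, hR.bigO_off_curve hQ' haO hbO hμ⟩
    obtain ⟨C, ε₀, -, hε₀, H⟩ := hR.discrepancy_bound hQ' haO hbO hμ m hK hKT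
    exact ⟨C, ε₀, hε₀, H⟩
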